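/- Let $\mathbf A,\mathbf P$ be real $d\times n$ matrices ($n\ge1$) and $\mathbf M$ a real $d\times k$ matrix with $k\ge 2$. Write $B_{\cdot,j}$ for the $j$-th column of a matrix $\mathbf B$, $B_{\cdot,S}=\frac1{|S|}\sum_{j\in S}B_{\cdot,j}$, $|\cdot|$ for the Euclidean norm, $\|\cdot\|$ for the spectral norm, $\mathrm{nnz}(\mathbf A)$ for the number of nonzero entries of $\mathbf A$, and $\sigma=\|\mathbf A-\mathbf P\|/\sqrt n$. Let $\alpha\in(0,1)$ and $\delta>0$ with $\delta n$ an integer. Assume that the columns of $\mathbf M$ are linearly independent, that every $P_{\cdot,j}$ lies in the convex hull of the columns of $\mathbf M$, and: (Well-Separatedness) for every $\ell$, the component of $M_{\cdot,\ell}$ orthogonal to the span of the other columns of $\mathbf M$ has length at least $\alpha\max_{\ell'}|M_{\cdot,\ell'}|$; (Proximate Latent Points) for every $\ell$ there is $S_\ell\subseteq[n]$ with $|S_\ell|=\delta n$ and $|M_{\cdot,\ell}-P_{\cdot,j}|\le 4\sigma/\sqrt\delta$ for all $j\in S_\ell$; (Spectrally Bounded Perturbations) $\displaystyle\frac{\sigma}{\sqrt\delta}\le\frac{\alpha^3\min_\ell|M_{\cdot,\ell}|}{4500\,k^9}$.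 Algorithm LKS, with input $\mathbf A,k,\delta$ and $t=\lceil a\log d\rceil$ ($a>0$ an absolute constant), is the following. Let $\mathbf Q_0$ be a random $d\times k$ matrix with orthonormal columns, let $\mathbf Q_{i}$ be obtained from $\mathbf A\mathbf A^T\mathbf Q_{i-1}$ by Gram–Schmidt for $i=1,\dots,t$, and let $V$ be the column span of $\mathbf Q_t$. For $r=0,\dots,k-1$, pick a random unit vector $u$ in the subspace of vectors of $V$ orthogonal to $A_{\cdot,R_1},\dots,A_{\cdot,R_r}$, and let $R_{r+1}$ be a set $S\subseteq[n]$ with $|S|=\delta n$ that maximizes $|u\cdot A_{\cdot,S}|$. There are absolute constants $a,c>0$ such that the following holds. Algorithm LKS finds sets $R_1,\dots,R_k\subseteq[n]$ of cardinality $\delta n$ such that, with probability at least $1-c/\sqrt k$, after a permutation of the columns of $\mathbf M$, $$|A_{\cdot,R_\ell}-M_{\cdot,\ell}|\le\frac{150k^4}{\alpha}\frac{\sigma}{\sqrt\delta}\qquad\text{for }\ell=1,\dots,k .$$ Moreover, LKS can be carried out in time $O^*\bigl(k(\mathrm{nnz}(\mathbf A)+kd)\bigr)$: there are absolute constants $C,p$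 and a single program for a random access machine with real arithmetic (unit cost for each arithmetic operation, square root, comparison, memory access and draw of a standard normal number) that, given $n,d,k,\delta n,t$ and the list of the nonzero entries of $\mathbf A$, carries out LKS in at most $$C\,\frac{(\log (nkd))^{p}}{(\delta\alpha)^{p}}\;k\,\bigl(\mathrm{nnz}(\mathbf A)+kd\bigr)$$ steps. -/

import Mathlib

/-! ### The latent simplex model -/

namespace LatentSimplex

noncomputable section

/-- Column `j` of a `d × n` matrix, as a vector of Euclidean space. -/
def col {d n : ℕ} (B : Matrix (Fin d) (Fin n) ℝ) (j : Fin n) : EuclideanSpace ℝ (Fin d) :=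
  WithLp.toLp 2 (fun i => B i j)

/-- The average of the columns of `B` with index in `S`. -/
def avg {d n : ℕ} (B : Matrix (Fin d) (Fin n) ℝ) (S : Finset (Fin n)) :
    EuclideanSpace ℝ (Fin d) :=
  (S.card : ℝ)⁻¹ • ∑ j ∈ S, col B j

/-- The number of nonzero entries. -/
def nnz {d n : ℕ} (A : Matrix (Fin d) (Fin n) ℝ) : ℕ :=
  Nat.card {q : Fin d × Fin n // A q.1 q.2 ≠ 0}

open scoped Matrix.Norms.L2Operator in
/-- The perturbation size: spectral norm of `A - P`, divided by `√n`. -/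
def sigma {d n : ℕ} (A P : Matrix (Fin d) (Fin n) ℝ) : ℝ :=
  ‖A - P‖ / √(n : ℝ)

/-- Every latent point is a convex combination of the vertices. -/
def LatentPoints {d n k : ℕ} (M : Matrix (Fin d) (Fin k) ℝ) (P : Matrix (Fin d) (Fin n) ℝ) :
    Prop :=
  ∀ j, col P j ∈ convexHull ℝ (Set.range (col M))

/-- Well-Separatedness: the component of each vertex orthogonal to all the other vertices has
length at least `α` times the length of the longest vertex. -/
def WellSeparated {d k : ℕ} (M : Matrix (Fin d) (Fin k) ℝ) (α : ℝ) : Prop :=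
  ∀ l l' : Fin k,
    α * ‖col M l'‖ ≤ ‖(Submodule.span ℝ (col M '' {m | m ≠ l}))ᗮ.starProjection (col M l)‖

/-- Proximate Latent Points, with `s = δ n`. -/
def ProximateLatentPoints {d n k : ℕ} (A P : Matrix (Fin d) (Fin n) ℝ)
    (M : Matrix (Fin d) (Fin k) ℝ) (δ : ℝ) (s : ℕ) : Prop :=
  ∀ l : Fin k, ∃ S : Finset (Fin n), S.card = s ∧
    ∀ j ∈ S, ‖col M l - col P j‖ ≤ 4 * sigma A P / √δ

/-- Spectrally Bounded Perturbations. -/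
def SpectrallyBounded {d n k : ℕ} (A P : Matrix (Fin d) (Fin n) ℝ)
    (M : Matrix (Fin d) (Fin k) ℝ) (α δ : ℝ) : Prop :=
  ∀ l : Fin k, sigma A P / √δ ≤ α ^ 3 * ‖col M l‖ / (4500 * (k : ℝ) ^ 9)

/-! ### Algorithm LKS

The source of randomness is a sequence `ω` of independent standard normal numbers. A random
matrix with orthonormal columns is the Gram-Schmidt orthonormalization of a Gaussian matrix, and a
random unit vector of a subspace is the normalized projection of a Gaussian vector; by rotation
invariance these have the uniform distributions. -/

/-- The law of a sequence of independent standard normal numbers. -/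
def tapeLaw : MeasureTheory.Measure (ℕ → ℝ) :=
  MeasureTheory.Measure.infinitePi (fun _ : ℕ => ProbabilityTheory.gaussianReal 0 1)

/-- The `m`-th block of `d` numbers of the sequence: a standard Gaussian vector. -/
def gaussVec (ω : ℕ → ℝ) (d m : ℕ) : EuclideanSpace ℝ (Fin d) :=
  WithLp.toLp 2 (fun i => ω (m * d + i))

/-- The columns of `Q_t` in the subspace power iteration: `Q_0` is random with orthonormal
columns, and `Q_{t+1}` is obtained from `A Aᵀ Q_t` by Gram-Schmidt. -/
def subspacePower {d n : ℕ} (A : Matrix (Fin d) (Fin n) ℝ) (k : ℕ) (ω : ℕ → ℝ) :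
    ℕ → Fin k → EuclideanSpace ℝ (Fin d)
  | 0 => InnerProductSpace.gramSchmidtNormed ℝ (fun m : Fin k => gaussVec ω d m)
  | t + 1 => InnerProductSpace.gramSchmidtNormed ℝ (fun m : Fin k =>
      WithLp.toLp 2 (A.mulVec (A.transpose.mulVec (WithLp.ofLp (subspacePower A k ω t m)))))

/-- The subspace `U` of round `r`: the vectors of the span of `Q_t` that are orthogonal to the
averages over the sets found in the earlier rounds. -/
def roundSpace {d n k : ℕ} (A : Matrix (Fin d) (Fin n) ℝ) (t : ℕ) (ω : ℕ → ℝ)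
    (R : Fin k → Finset (Fin n)) (r : Fin k) : Submodule ℝ (EuclideanSpace ℝ (Fin d)) :=
  Submodule.span ℝ (Set.range (subspacePower A k ω t)) ⊓
    (Submodule.span ℝ ((fun i => avg A (R i)) '' {i | i < r}))ᗮ

/-- The random unit vector `u` of round `r`. The first `k` Gaussian vectors are used for `Q_0`,
so round `r` uses the vector number `k + r`. -/
def roundDir {d n k : ℕ} (A : Matrix (Fin d) (Fin n) ℝ) (t : ℕ) (ω : ℕ → ℝ)
    (R : Fin k → Finset (Fin n)) (r : Fin k) : EuclideanSpace ℝ (Fin d) :=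
  ‖(roundSpace A t ω R r).starProjection (gaussVec ω d (k + r))‖⁻¹ •
    (roundSpace A t ω R r).starProjection (gaussVec ω d (k + r))

/-- `R` is a possible output of Algorithm LKS with subset size `s` and `t` power iterations on the
randomness `ω`: in each round `r`, the set `R r` maximizes `|u · A_S|` over all `S` of
cardinality `s` (ties may be broken in any way). -/
def IsLKSRun {d n k : ℕ} (A : Matrix (Fin d) (Fin n) ℝ) (s t : ℕ) (ω : ℕ → ℝ)
    (R : Fin k → Finset (Fin n)) : Prop :=
  ∀ r : Fin k, (R r).card = s ∧ ∀ S : Finset (Fin n), S.card = s →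
    |inner ℝ (roundDir A t ω R r) (avg A S)| ≤ |inner ℝ (roundDir A t ω R r) (avg A (R r))|

/-- After a permutation of the columns of `M`, each average `A_{R_l}` is within
`(150 k⁴ / α) σ / √δ` of the column `l`. -/
def Recovers {d n k : ℕ} (A P : Matrix (Fin d) (Fin n) ℝ) (M : Matrix (Fin d) (Fin k) ℝ)
    (α δ : ℝ) (R : Fin k → Finset (Fin n)) : Prop :=
  ∃ π : Equiv.Perm (Fin k), ∀ l : Fin k,
    ‖avg A (R l) - col M (π l)‖ ≤ 150 * (k : ℝ) ^ 4 / α * (sigma A P / √δ)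

end

end LatentSimplex

/-! ### A random access machine over the reals with a step count

The memory consists of two-dimensional arrays of natural numbers (used for counters and
addresses) and two-dimensional arrays of real numbers. Unit-cost steps are: reading or writing a
cell, reading a constant, addition and truncated subtraction of naturals, exact
`+ - * / √` on reals, comparisons, drawing one standard normal number, and each turn of a loop.
Real numbers can never be turned into natural numbers except through comparisons. -/

namespace RealRAM

noncomputable section

/-- Memory, number of random numbers drawn so far, number of steps so far. -/
structure State where
  /-- entry `(i, j)` of the natural-number array `a` -/
  nat : ℕ → ℕ → ℕ → ℕ
  /-- entry `(i, j)` of the real array `a` -/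
  real : ℕ → ℕ → ℕ → ℝ
  /-- random numbers drawn so far -/
  pos : ℕ
  /-- steps made so far -/
  time : ℕ

/-- Natural-number expressions. -/
inductive NExp where
  | lit (c : ℕ)
  | get (a : ℕ) (i j : NExp)
  | add (x y : NExp)
  | sub (x y : NExp)

/-- Real expressions. -/
inductive RExp where
  | lit (c : ℕ)
  | get (a : ℕ) (i j : NExp)
  | add (x y : RExp)
  | sub (x y : RExp)
  | mul (x y : RExp)
  | div (x y : RExp)
  | sqrt (x : RExp)

/-- Tests. -/
inductive Test where
  | natLt (x y : NExp)
  | realLt (x y : RExp)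

/-- Programs. -/
inductive Cmd where
  | skip
  | seq (c₁ c₂ : Cmd)
  /-- write the value of `e` into entry `(i, j)` of the natural-number array `a` -/
  | setNat (a : ℕ) (i j e : NExp)
  /-- write the value of `e` into entry `(i, j)` of the real array `a` -/
  | setReal (a : ℕ) (i j : NExp) (e : RExp)
  /-- write a fresh standard normal number into entry `(i, j)` of the real array `a` -/
  | draw (a : ℕ) (i j : NExp)
  | ite (b : Test) (c₁ c₂ : Cmd)
  /-- evaluate `e` once, to `N` say; then run `c` with the counter, entry `(0, 0)` of the
  natural-number array `x`, set to `0, 1, …, N - 1` in turn -/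
  | loop (x : ℕ) (e : NExp) (c : Cmd)

/-- Value of a natural-number expression. -/
def NExp.eval (st : State) : NExp → ℕ
  | .lit c => c
  | .get a i j => st.nat a (i.eval st) (j.eval st)
  | .add x y => x.eval st + y.eval st
  | .sub x y => x.eval st - y.eval st

/-- Number of steps for evaluating a natural-number expression. -/
def NExp.cost : NExp → ℕ
  | .lit _ => 1
  | .get _ i j => i.cost + j.cost + 1
  | .add x y => x.cost + y.cost + 1
  | .sub x y => x.cost + y.cost + 1

/-- Value of a real expression. -/
def RExp.eval (st : State) : RExp → ℝ
  | .lit c => c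
  | .get a i j => st.real a (i.eval st) (j.eval st)
  | .add x y => x.eval st + y.eval st
  | .sub x y => x.eval st - y.eval st
  | .mul x y => x.eval st * y.eval st
  | .div x y => x.eval st / y.eval st
  | .sqrt x => √(x.eval st)

/-- Number of steps for evaluating a real expression. -/
def RExp.cost : RExp → ℕ
  | .lit _ => 1
  | .get _ i j => i.cost + j.cost + 1
  | .add x y => x.cost + y.cost + 1
  | .sub x y => x.cost + y.cost + 1
  | .mul x y => x.cost + y.cost + 1
  | .div x y => x.cost + y.cost + 1
  | .sqrt x => x.cost + 1

/-- Truth of a test. -/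
def Test.holds (st : State) : Test → Prop
  | .natLt x y => x.eval st < y.eval st
  | .realLt x y => x.eval st < y.eval st

/-- Number of steps for a test. -/
def Test.cost : Test → ℕ
  | .natLt x y => x.cost + y.cost + 1
  | .realLt x y => x.cost + y.cost + 1

/-- Let `m` steps pass. -/
def State.tick (st : State) (m : ℕ) : State :=
  { st with time := st.time + m }

/-- Overwrite one natural-number cell. -/
def State.putNat (st : State) (a i j v : ℕ) : State :=
  { st with nat := fun a' i' j' => if a' = a ∧ i' = i ∧ j' = j then v else st.nat a' i' j' }

/-- Overwrite one real cell. -/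
def State.putReal (st : State) (a i j : ℕ) (v : ℝ) : State :=
  { st with real := fun a' i' j' => if a' = a ∧ i' = i ∧ j' = j then v else st.real a' i' j' }

open scoped Classical in
/-- The state after running a program, on the sequence `ω` of random numbers. -/
def Cmd.exec (ω : ℕ → ℝ) : Cmd → State → State
  | .skip, st => st
  | .seq c₁ c₂, st => c₂.exec ω (c₁.exec ω st)
  | .setNat a i j e, st =>
      (st.putNat a (i.eval st) (j.eval st) (e.eval st)).tick (i.cost + j.cost + e.cost + 1)
  | .setReal a i j e, st =>
      (st.putReal a (i.eval st) (j.eval st) (e.eval st)).tick (i.cost + j.cost + e.cost + 1)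
  | .draw a i j, st =>
      { (st.putReal a (i.eval st) (j.eval st) (ω st.pos)).tick (i.cost + j.cost + 1) with
        pos := st.pos + 1 }
  | .ite b c₁ c₂, st =>
      if b.holds st then c₁.exec ω (st.tick b.cost) else c₂.exec ω (st.tick b.cost)
  | .loop x e c, st =>
      (List.range (e.eval st)).foldl
        (fun st' m => c.exec ω ((st'.putNat x 0 0 m).tick 1)) (st.tick (e.cost + 1))

/-- The input: the numbers `n`, `d`, `k`, `s`, `t` and `nnz A` in row `0` of the natural-number
array `0`, and the list `e` of all nonzero entries of `A`, in any order: row numbers in the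
natural-number array `1`, column numbers in the natural-number array `2`, values in the real
array `0`. All other cells are zero. -/
def input {d n : ℕ} (A : Matrix (Fin d) (Fin n) ℝ) (k s t : ℕ)
    (e : Fin (LatentSimplex.nnz A) ≃ {q : Fin d × Fin n // A q.1 q.2 ≠ 0}) : State where
  nat := fun a i j =>
    match a, i, j with
    | 0, 0, 0 => n
    | 0, 0, 1 => d
    | 0, 0, 2 => k
    | 0, 0, 3 => s
    | 0, 0, 4 => t
    | 0, 0, 5 => LatentSimplex.nnz A
    | 1, i, 0 => if h : i < LatentSimplex.nnz A then ((e ⟨i, h⟩).1.1 : ℕ) else 0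
    | 2, i, 0 => if h : i < LatentSimplex.nnz A then ((e ⟨i, h⟩).1.2 : ℕ) else 0
    | _, _, _ => 0
  real := fun a i j =>
    match a, i, j with
    | 0, i, 0 =>
        if h : i < LatentSimplex.nnz A then A (e ⟨i, h⟩).1.1 (e ⟨i, h⟩).1.2 else 0
    | _, _, _ => 0
  pos := 0
  time := 0

/-- The output: row `l` of the natural-number array `3` lists the elements of `R l` in its
first `s` cells. -/
def Outputs {n k : ℕ} (st : State) (s : ℕ) (R : Fin k → Finset (Fin n)) : Prop :=
  ∀ (l : Fin k) (j : Fin n), j ∈ R l ↔ ∃ i < s, st.nat 3 l i = j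

end

end RealRAM

/-! ### Frame and loop rules for the random access machine -/

namespace RealRAM

/-- The program may write into the natural-number array `a`. -/
def Cmd.WritesNat : Cmd → ℕ → Prop
  | .skip, _ => False
  | .seq c₁ c₂, a => c₁.WritesNat a ∨ c₂.WritesNat a
  | .setNat b _ _ _, a => a = b
  | .setReal _ _ _ _, _ => False
  | .draw _ _ _, _ => False
  | .ite _ c₁ c₂, a => c₁.WritesNat a ∨ c₂.WritesNat a
  | .loop x _ c, a => a = x ∨ c.WritesNat a

/-- The program may write into the real array `a`. -/
def Cmd.WritesReal : Cmd → ℕ → Prop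
  | .skip, _ => False
  | .seq c₁ c₂, a => c₁.WritesReal a ∨ c₂.WritesReal a
  | .setNat _ _ _ _, _ => False
  | .setReal b _ _ _, a => a = b
  | .draw b _ _, a => a = b
  | .ite _ c₁ c₂, a => c₁.WritesReal a ∨ c₂.WritesReal a
  | .loop _ _ c, a => c.WritesReal a

/-- The program may draw random numbers. -/
def Cmd.Draws : Cmd → Prop
  | .skip => False
  | .seq c₁ c₂ => c₁.Draws ∨ c₂.Draws
  | .setNat _ _ _ _ => False
  | .setReal _ _ _ _ => False
  | .draw _ _ _ => True
  | .ite _ c₁ c₂ => c₁.Draws ∨ c₂.Draws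
  | .loop _ _ c => c.Draws

/-- The states agree on everything that the program `c` does not touch. -/
structure Frame (c : Cmd) (st st' : State) : Prop where
  nat : ∀ a, ¬ c.WritesNat a → st'.nat a = st.nat a
  real : ∀ a, ¬ c.WritesReal a → st'.real a = st.real a
  pos : ¬ c.Draws → st'.pos = st.pos

@[simp] lemma State.tick_nat (st : State) (m : ℕ) : (st.tick m).nat = st.nat := rfl
@[simp] lemma State.tick_real (st : State) (m : ℕ) : (st.tick m).real = st.real := rfl
@[simp] lemma State.tick_pos (st : State) (m : ℕ) : (st.tick m).pos = st.pos := rfl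
@[simp] lemma State.tick_time (st : State) (m : ℕ) : (st.tick m).time = st.time + m := rfl
@[simp] lemma State.putNat_nat (st : State) (a i j v a' i' j' : ℕ) :
    (st.putNat a i j v).nat a' i' j' =
      if a' = a ∧ i' = i ∧ j' = j then v else st.nat a' i' j' := rfl
@[simp] lemma State.putNat_real (st : State) (a i j v : ℕ) :
    (st.putNat a i j v).real = st.real := rfl
@[simp] lemma State.putNat_pos (st : State) (a i j v : ℕ) :
    (st.putNat a i j v).pos = st.pos := rfl
@[simp] lemma State.putNat_time (st : State) (a i j v : ℕ) :
    (st.putNat a i j v).time = st.time := rfl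
@[simp] lemma State.putReal_real (st : State) (a i j : ℕ) (v : ℝ) (a' i' j' : ℕ) :
    (st.putReal a i j v).real a' i' j' =
      if a' = a ∧ i' = i ∧ j' = j then v else st.real a' i' j' := rfl
@[simp] lemma State.putReal_nat (st : State) (a i j : ℕ) (v : ℝ) :
    (st.putReal a i j v).nat = st.nat := rfl
@[simp] lemma State.putReal_pos (st : State) (a i j : ℕ) (v : ℝ) :
    (st.putReal a i j v).pos = st.pos := rfl
@[simp] lemma State.putReal_time (st : State) (a i j : ℕ) (v : ℝ) :
    (st.putReal a i j v).time = st.time := rfl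

lemma State.putNat_nat_of_ne (st : State) {a a' : ℕ} (h : a' ≠ a) (i j v : ℕ) :
    (st.putNat a i j v).nat a' = st.nat a' := by
  funext i' j'; simp [h]

lemma State.putReal_real_of_ne (st : State) {a a' : ℕ} (h : a' ≠ a) (i j : ℕ) (v : ℝ) :
    (st.putReal a i j v).real a' = st.real a' := by
  funext i' j'; simp [h]

lemma Frame.refl (c : Cmd) (st : State) : Frame c st st :=
  ⟨fun _ _ => rfl, fun _ _ => rfl, fun _ => rfl⟩

lemma Frame.trans {c : Cmd} {st₁ st₂ st₃ : State} (h : Frame c st₁ st₂) (h' : Frame c st₂ st₃) :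
    Frame c st₁ st₃ :=
  ⟨fun a ha => (h'.nat a ha).trans (h.nat a ha), fun a ha => (h'.real a ha).trans (h.real a ha),
    fun hd => (h'.pos hd).trans (h.pos hd)⟩

lemma Frame.mono {c c' : Cmd} {st st' : State} (h : Frame c st st')
    (hn : ∀ a, c.WritesNat a → c'.WritesNat a) (hr : ∀ a, c.WritesReal a → c'.WritesReal a)
    (hd : c.Draws → c'.Draws) : Frame c' st st' :=
  ⟨fun a ha => h.nat a (mt (hn a) ha), fun a ha => h.real a (mt (hr a) ha),
    fun h' => h.pos (mt hd h')⟩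

lemma frame_tick (c : Cmd) (st : State) (m : ℕ) : Frame c st (st.tick m) :=
  ⟨fun _ _ => rfl, fun _ _ => rfl, fun _ => rfl⟩

lemma foldl_range_succ {β : Type*} (f : β → ℕ → β) (b : β) (N : ℕ) :
    (List.range (N + 1)).foldl f b = f ((List.range N).foldl f b) N := by
  simp [List.range_succ]

/-- A program changes only what it may write. -/
theorem frame_exec (ω : ℕ → ℝ) (c : Cmd) : ∀ st : State, Frame c st (c.exec ω st) := by
  induction c with
  | skip => intro st; exact Frame.refl _ _
  | seq c₁ c₂ h₁ h₂ =>
    intro st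
    refine Frame.trans (Frame.mono (h₁ st) ?_ ?_ ?_) (Frame.mono (h₂ _) ?_ ?_ ?_) <;>
      simp +contextual [Cmd.WritesNat, Cmd.WritesReal, Cmd.Draws]
  | setNat a i j e =>
    intro st
    exact ⟨fun b hb => State.putNat_nat_of_ne _ hb _ _ _, fun _ _ => rfl, fun _ => rfl⟩
  | setReal a i j e =>
    intro st
    exact ⟨fun _ _ => rfl, fun b hb => State.putReal_real_of_ne _ hb _ _ _, fun _ => rfl⟩
  | draw a i j =>
    intro st
    exact ⟨fun _ _ => rfl, fun b hb => State.putReal_real_of_ne _ hb _ _ _,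
      fun h => (h trivial).elim⟩
  | ite b c₁ c₂ h₁ h₂ =>
    intro st
    simp only [Cmd.exec]
    split_ifs
    · refine Frame.trans (frame_tick _ _ _) (Frame.mono (h₁ _) ?_ ?_ ?_) <;>
        simp +contextual [Cmd.WritesNat, Cmd.WritesReal, Cmd.Draws]
    · refine Frame.trans (frame_tick _ _ _) (Frame.mono (h₂ _) ?_ ?_ ?_) <;>
        simp +contextual [Cmd.WritesNat, Cmd.WritesReal, Cmd.Draws]
  | loop x e c h =>
    intro st
    simp only [Cmd.exec]
    generalize e.eval st = N
    induction N with
    | zero => exact frame_tick _ _ _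
    | succ N ih =>
      rw [foldl_range_succ]
      refine ih.trans (Frame.trans (st₂ := State.tick (State.putNat _ x 0 0 N) 1) ?_
        (Frame.mono (h _) ?_ ?_ ?_))
      · refine ⟨fun b hb => State.putNat_nat_of_ne _ ?_ _ _ _, fun _ _ => rfl, fun _ => rfl⟩
        exact fun hbx => hb (Or.inl hbx)
      all_goals simp +contextual [Cmd.WritesNat, Cmd.WritesReal, Cmd.Draws]

/-- Loop rule: an invariant may use that the state agrees with the initial one on everything
that the loop does not touch. -/
theorem loop_rule {ω : ℕ → ℝ} {x : ℕ} {e : NExp} {c : Cmd} {st : State}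
    (Inv : ℕ → State → Prop) (K : ℕ) (h0 : Inv 0 (st.tick (e.cost + 1)))
    (hs : ∀ m < e.eval st, ∀ st', Frame (.loop x e c) st st' → Inv m st' →
      Inv (m + 1) (c.exec ω ((st'.putNat x 0 0 m).tick 1)) ∧
      (c.exec ω ((st'.putNat x 0 0 m).tick 1)).time ≤ st'.time + K) :
    Inv (e.eval st) ((Cmd.loop x e c).exec ω st) ∧
      ((Cmd.loop x e c).exec ω st).time ≤ st.time + (e.cost + 1) + e.eval st * K := by
  have key : ∀ N ≤ e.eval st,
      let st' := (List.range N).foldl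
        (fun st' m => c.exec ω ((st'.putNat x 0 0 m).tick 1)) (st.tick (e.cost + 1))
      Frame (.loop x e c) st st' ∧ Inv N st' ∧ st'.time ≤ st.time + (e.cost + 1) + N * K := by
    intro N
    induction N with
    | zero => intro _; exact ⟨frame_tick _ _ _, h0, by simp⟩
    | succ N ih =>
      intro hN
      obtain ⟨hF, hI, hT⟩ := ih (by omega)
      simp only [foldl_range_succ]
      obtain ⟨hI', hT'⟩ := hs N (by omega) _ hF hI
      refine ⟨hF.trans (Frame.trans (st₂ := State.tick (State.putNat _ x 0 0 N) 1) ?_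
        (Frame.mono (frame_exec ω c _) ?_ ?_ ?_)), hI', ?_⟩
      · refine ⟨fun b hb => State.putNat_nat_of_ne _ ?_ _ _ _, fun _ _ => rfl, fun _ => rfl⟩
        exact fun hbx => hb (Or.inl hbx)
      any_goals simp +contextual [Cmd.WritesNat, Cmd.WritesReal, Cmd.Draws]
      refine hT'.trans ?_
      rw [Nat.succ_mul]; omega
  obtain ⟨-, h, h'⟩ := key _ le_rfl
  exact ⟨h, h'⟩

end RealRAM

/-! ### Vector operations -/

namespace RealRAM

/-- The cell `(0, 0)` of a natural-number array, used as a variable. -/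
def var (x : ℕ) : NExp := .get x (.lit 0) (.lit 0)

/-- The `j`-th input parameter. -/
def inp (j : ℕ) : NExp := .get 0 (.lit 0) (.lit j)

@[simp] lemma eval_var (st : State) (x : ℕ) : (var x).eval st = st.nat x 0 0 := rfl
@[simp] lemma eval_inp (st : State) (j : ℕ) : (inp j).eval st = st.nat 0 0 j := rfl
@[simp] lemma cost_var (x : ℕ) : (var x).cost = 3 := rfl
@[simp] lemma cost_inp (x : ℕ) : (inp x).cost = 3 := rfl

/-- Write `e` into the cells `0, …, len - 1` of row `r` of the real array `a`. -/
def mapRow (x a r : ℕ) (len : NExp) (e : RExp) : Cmd :=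
  .loop x len (.setReal a (var r) (var x) e)

theorem mapRow_spec {ω : ℕ → ℝ} {x a r : ℕ} {len : NExp} {e : RExp} {st : State}
    (f : ℕ → ℝ) (hxr : r ≠ x)
    (he : ∀ m < len.eval st, ∀ st', Frame (mapRow x a r len e) st st' →
      (∀ q, m ≤ q → st'.real a (st.nat r 0 0) q = st.real a (st.nat r 0 0) q) →
      (∀ i, i ≠ st.nat r 0 0 → st'.real a i = st.real a i) →
      st'.nat x 0 0 = m → e.eval st' = f m) :
    (∀ q, ((mapRow x a r len e).exec ω st).real a (st.nat r 0 0) q =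
      if q < len.eval st then f q else st.real a (st.nat r 0 0) q) ∧
    (∀ i, i ≠ st.nat r 0 0 → ((mapRow x a r len e).exec ω st).real a i = st.real a i) ∧
    ((mapRow x a r len e).exec ω st).time ≤
      st.time + (len.cost + 1) + len.eval st * (e.cost + 8) := by
  have := loop_rule (ω := ω) (x := x) (e := len) (c := .setReal a (var r) (var x) e) (st := st)
    (fun m st' => (∀ q, st'.real a (st.nat r 0 0) q =
      if q < m then f q else st.real a (st.nat r 0 0) q) ∧
      ∀ i, i ≠ st.nat r 0 0 → st'.real a i = st.real a i) (e.cost + 8) (by simp) ?_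
  · exact ⟨this.1.1, this.1.2, this.2⟩
  intro m hm st' hF ⟨h1, h2⟩
  have hr : st'.nat r = st.nat r := hF.nat r (by simp [Cmd.WritesNat, hxr])
  have hev : e.eval ((st'.putNat x 0 0 m).tick 1) = f m := by
    refine he m hm _ (hF.trans ⟨fun b hb => State.putNat_nat_of_ne _ ?_ _ _ _, fun _ _ => rfl,
      fun _ => rfl⟩) ?_ ?_ ?_
    · exact fun hbx => hb (Or.inl hbx)
    · intro q hq; simp [h1, hq.not_gt]
    · intro i hi; simp [h2 i hi]
    · simp
  refine ⟨⟨?_, ?_⟩, ?_⟩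
  · intro q
    simp only [Cmd.exec, hev]
    simp [hr, hxr, h1]
    split_ifs <;> first | rfl | omega | simp_all
  · intro i hi
    simp only [Cmd.exec, hev]
    funext q
    simp [hr, hxr, hi, h2 i hi]
  · simp [Cmd.exec]; omega

/-- Add up the values of `e` in the cell `(0, j)` of the real array `a`. -/
def accum (x a j : ℕ) (len : NExp) (e : RExp) : Cmd :=
  .loop x len (.setReal a (.lit 0) (.lit j) (.add (.get a (.lit 0) (.lit j)) e))

theorem accum_spec {ω : ℕ → ℝ} {x a j : ℕ} {len : NExp} {e : RExp} {st : State}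
    (f : ℕ → ℝ)
    (he : ∀ m < len.eval st, ∀ st', Frame (accum x a j len e) st st' →
      st'.nat x 0 0 = m → e.eval st' = f m) :
    (∀ i q, ((accum x a j len e).exec ω st).real a i q =
      if i = 0 ∧ q = j then st.real a 0 j + ∑ m ∈ Finset.range (len.eval st), f m
        else st.real a i q) ∧
    ((accum x a j len e).exec ω st).time ≤
      st.time + (len.cost + 1) + len.eval st * (e.cost + 8) := by
  have := loop_rule (ω := ω) (x := x) (e := len)
    (c := .setReal a (.lit 0) (.lit j) (.add (.get a (.lit 0) (.lit j)) e)) (st := st)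
    (fun m st' => ∀ i q, st'.real a i q =
      if i = 0 ∧ q = j then st.real a 0 j + ∑ m ∈ Finset.range m, f m
        else st.real a i q) (e.cost + 8)
    (by intro i q; simp; rintro rfl rfl; rfl) ?_
  · exact this
  intro m hm st' hF h1
  have hev : e.eval ((st'.putNat x 0 0 m).tick 1) = f m := by
    refine he m hm _ (hF.trans ⟨fun b hb => State.putNat_nat_of_ne _ ?_ _ _ _, fun _ _ => rfl,
      fun _ => rfl⟩) ?_
    · exact fun hbx => hb (Or.inl hbx)
    · simp
  refine ⟨?_, ?_⟩
  · intro i q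
    simp only [Cmd.exec, RExp.eval, hev]
    simp [NExp.eval, h1, Finset.sum_range_succ]
    split_ifs <;> simp [add_assoc]
  · simp [Cmd.exec, RExp.cost, NExp.cost]; omega

/-- Sparse matrix-vector product: for each nonzero entry `z`, add the entry times
`src (p z)` to `dst (q z)`. -/
def scatter (x da dr qa sa sr pa : ℕ) : Cmd :=
  .loop x (inp 5) (.setReal da (var dr) (.get qa (var x) (.lit 0))
    (.add (.get da (var dr) (.get qa (var x) (.lit 0)))
      (.mul (.get 0 (var x) (.lit 0)) (.get sa (var sr) (.get pa (var x) (.lit 0))))))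

theorem scatter_spec {ω : ℕ → ℝ} {x da dr qa sa sr pa : ℕ} {st : State}
    (hd : dr ≠ x) (hq : qa ≠ x) (hs : sr ≠ x) (hp : pa ≠ x) (hsa : sa ≠ da)
    (hda : da ≠ 0) :
    (∀ q, ((scatter x da dr qa sa sr pa).exec ω st).real da (st.nat dr 0 0) q =
      st.real da (st.nat dr 0 0) q + ∑ z ∈ Finset.range (st.nat 0 0 5),
        if st.nat qa z 0 = q then st.real 0 z 0 * st.real sa (st.nat sr 0 0) (st.nat pa z 0)
          else 0) ∧
    (∀ i, i ≠ st.nat dr 0 0 →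
      ((scatter x da dr qa sa sr pa).exec ω st).real da i = st.real da i) ∧
    ((scatter x da dr qa sa sr pa).exec ω st).time ≤ st.time + 4 + st.nat 0 0 5 * 40 := by
  have := loop_rule (ω := ω) (x := x) (e := inp 5)
    (c := .setReal da (var dr) (.get qa (var x) (.lit 0))
    (.add (.get da (var dr) (.get qa (var x) (.lit 0)))
      (.mul (.get 0 (var x) (.lit 0)) (.get sa (var sr) (.get pa (var x) (.lit 0))))))
    (st := st)
    (fun m st' => (∀ q, st'.real da (st.nat dr 0 0) q =
      st.real da (st.nat dr 0 0) q + ∑ z ∈ Finset.range m,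
        if st.nat qa z 0 = q then st.real 0 z 0 * st.real sa (st.nat sr 0 0) (st.nat pa z 0)
          else 0) ∧
      ∀ i, i ≠ st.nat dr 0 0 → st'.real da i = st.real da i) 40 (by simp) ?_
  · exact ⟨this.1.1, this.1.2, this.2⟩
  intro m hm st' hF ⟨h1, h2⟩
  have e1 : st'.nat dr = st.nat dr := hF.nat _ (by simp [Cmd.WritesNat, hd])
  have e2 : st'.nat qa = st.nat qa := hF.nat _ (by simp [Cmd.WritesNat, hq])
  have e3 : st'.nat sr = st.nat sr := hF.nat _ (by simp [Cmd.WritesNat, hs])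
  have e4 : st'.nat pa = st.nat pa := hF.nat _ (by simp [Cmd.WritesNat, hp])
  have e5 : st'.real 0 = st.real 0 := hF.real _ (by simp [Cmd.WritesReal, hda.symm])
  have e6 : st'.real sa = st.real sa := hF.real _ (by simp [Cmd.WritesReal, hsa])
  refine ⟨⟨?_, ?_⟩, ?_⟩
  · intro q
    simp only [Cmd.exec, RExp.eval, NExp.eval, eval_var]
    simp [hd, hq, hs, hp, e1, e2, e3, e4, e5, e6, h1, Finset.sum_range_succ]
    by_cases h : q = st.nat qa m 0
    · simp [h, add_assoc]
    · simp [h, Ne.symm h]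
  · intro i hi
    simp only [Cmd.exec, RExp.eval, NExp.eval, eval_var]
    funext q
    simp [hd, e1, hi, h2 i hi]
  · simp [Cmd.exec, RExp.cost, NExp.cost]

/-- The inner product of the first `d` entries. -/
def dot (d : ℕ) (f g : ℕ → ℝ) : ℝ := ∑ l ∈ Finset.range d, f l * g l

/-- Add to row `dr` of `da` the multiple `sgn` of the sum of the projections of row `sr` of `sa`
on the rows `0, …, len - 1` of `ba`. -/
def addProj (x y da dr sa sr ba : ℕ) (len : NExp) (sgn : RExp) : Cmd :=
  .loop x len
    (.seq (.setReal 8 (.lit 0) (.lit 0) (.lit 0))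
    (.seq (.setReal 8 (.lit 0) (.lit 1) (.lit 0))
    (.seq (accum y 8 0 (inp 1) (.mul (.get ba (var x) (var y)) (.get sa (var sr) (var y))))
    (.seq (accum y 8 1 (inp 1) (.mul (.get ba (var x) (var y)) (.get ba (var x) (var y))))
      (mapRow y da dr (inp 1) (.add (.get da (var dr) (var y))
        (.mul (.mul sgn (.div (.get 8 (.lit 0) (.lit 0)) (.get 8 (.lit 0) (.lit 1))))
          (.get ba (var x) (var y)))))))))

theorem addProj_spec {ω : ℕ → ℝ} {x y da dr sa sr ba : ℕ} {len : NExp} {sgn : RExp} {st : State}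
    (g : ℝ) (hg : ∀ st', sgn.eval st' = g) (hgc : sgn.cost ≤ 3)
    (h0 : 0 ≠ x) (h0' : 0 ≠ y) (hxy : x ≠ y) (hdx : dr ≠ x) (hdy : dr ≠ y) (hsx : sr ≠ x)
    (hsy : sr ≠ y) (hsa : sa ≠ da) (hs8 : sa ≠ 8) (hd8 : da ≠ 8) (hb8 : ba ≠ 8)
    (hba : ba ≠ da ∨ len.eval st ≤ st.nat dr 0 0) :
    (∀ q < st.nat 0 0 1, ((addProj x y da dr sa sr ba len sgn).exec ω st).real da
        (st.nat dr 0 0) q =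
      st.real da (st.nat dr 0 0) q + g * ∑ i ∈ Finset.range (len.eval st),
        dot (st.nat 0 0 1) (st.real ba i) (st.real sa (st.nat sr 0 0)) /
          dot (st.nat 0 0 1) (st.real ba i) (st.real ba i) * st.real ba i q) ∧
    (∀ i, i ≠ st.nat dr 0 0 →
      ((addProj x y da dr sa sr ba len sgn).exec ω st).real da i = st.real da i) ∧
    ((addProj x y da dr sa sr ba len sgn).exec ω st).time ≤
      st.time + (len.cost + 1) + len.eval st * (23 + st.nat 0 0 1 * 92) := by
  have := loop_rule (ω := ω) (x := x) (e := len)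
    (c := (.seq (.setReal 8 (.lit 0) (.lit 0) (.lit 0))
    (.seq (.setReal 8 (.lit 0) (.lit 1) (.lit 0))
    (.seq (accum y 8 0 (inp 1) (.mul (.get ba (var x) (var y)) (.get sa (var sr) (var y))))
    (.seq (accum y 8 1 (inp 1) (.mul (.get ba (var x) (var y)) (.get ba (var x) (var y))))
      (mapRow y da dr (inp 1) (.add (.get da (var dr) (var y))
        (.mul (.mul sgn (.div (.get 8 (.lit 0) (.lit 0)) (.get 8 (.lit 0) (.lit 1))))
          (.get ba (var x) (var y)))))))))) (st := st)
    (fun m st' => (∀ q < st.nat 0 0 1, st'.real da (st.nat dr 0 0) q =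
      st.real da (st.nat dr 0 0) q + g * ∑ i ∈ Finset.range m,
        dot (st.nat 0 0 1) (st.real ba i) (st.real sa (st.nat sr 0 0)) /
          dot (st.nat 0 0 1) (st.real ba i) (st.real ba i) * st.real ba i q) ∧
      ∀ i, i ≠ st.nat dr 0 0 → st'.real da i = st.real da i)
    (23 + st.nat 0 0 1 * 92) (by simp) ?_
  · exact ⟨this.1.1, this.1.2, this.2⟩
  intro m hm st' hF ⟨h1, h2⟩
  have wn : ∀ a, a ≠ x → a ≠ y → st'.nat a = st.nat a := fun a hx hy => hF.nat a (by
    simp [Cmd.WritesNat, accum, mapRow, hx, hy])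
  have wr : ∀ a, a ≠ 8 → a ≠ da → st'.real a = st.real a := fun a hx hy => hF.real a (by
    simp [Cmd.WritesReal, accum, mapRow, hx, hy])
  have hbm : st'.real ba m = st.real ba m := by
    rcases eq_or_ne ba da with h | h
    · subst h
      exact h2 _ (by rcases hba with hba | hba <;> [exact absurd rfl hba; omega])
    · rw [wr ba hb8 h]
  simp only [Cmd.exec]
  set s2 := (State.tick (State.putReal (State.tick (State.putReal _ 8 _ _ _) _) 8 _ _ _) _)
    with hs2
  have n2 : ∀ a, a ≠ x → a ≠ y → s2.nat a = st.nat a := by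
    intro a hx hy
    simp [hs2, wn a hx hy, State.putNat_nat_of_ne _ hx]
  have n2x : s2.nat x 0 0 = m := by simp [hs2]
  have r2 : ∀ a, a ≠ 8 → s2.real a = st'.real a := by
    intro a ha
    simp [hs2, State.putReal_real_of_ne _ ha]
  have r28 : s2.real 8 0 0 = 0 ∧ s2.real 8 0 1 = 0 := by
    simp [hs2, RExp.eval, NExp.eval]
  have t2 : s2.time = st'.time + 9 := by
    simp [hs2, RExp.cost, NExp.cost]
  clear_value s2
  have A := accum_spec (ω := ω) (x := y) (a := 8) (j := 0) (len := inp 1)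
    (e := .mul (.get ba (var x) (var y)) (.get sa (var sr) (var y))) (st := s2)
    (fun l => st.real ba m l * st.real sa (st.nat sr 0 0) l) (by
      intro l hl s hs hy
      have e1 := hs.nat x (by simp [Cmd.WritesNat, accum, hxy])
      have e2 := hs.nat sr (by simp [Cmd.WritesNat, accum, hsy])
      have e3 := hs.real ba (by simp [Cmd.WritesReal, accum, hb8])
      have e4 := hs.real sa (by simp [Cmd.WritesReal, accum, hs8])
      simp [RExp.eval, e1, e2, e3, e4, hy, n2x, n2 sr hsx hsy, r2 ba hb8, r2 sa hs8, hbm,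
        wr sa hs8 hsa])
  have FA := frame_exec ω (accum y 8 0 (inp 1)
    (.mul (.get ba (var x) (var y)) (.get sa (var sr) (var y)))) s2
  set s3 := Cmd.exec ω (accum y 8 0 _ _) s2 with hs3
  have n3 : ∀ a, a ≠ y → s3.nat a = s2.nat a := fun a ha => FA.nat a (by
    simp [Cmd.WritesNat, accum, ha])
  have r3 : ∀ a, a ≠ 8 → s3.real a = s2.real a := fun a ha => FA.real a (by
    simp [Cmd.WritesReal, accum, ha])
  clear_value s3
  have B := accum_spec (ω := ω) (x := y) (a := 8) (j := 1) (len := inp 1)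
    (e := .mul (.get ba (var x) (var y)) (.get ba (var x) (var y))) (st := s3)
    (fun l => st.real ba m l * st.real ba m l) (by
      intro l hl s hs hy
      have e1 := hs.nat x (by simp [Cmd.WritesNat, accum, hxy])
      have e3 := hs.real ba (by simp [Cmd.WritesReal, accum, hb8])
      simp [RExp.eval, e1, e3, hy, n3 x hxy, r3 ba hb8, n2x, r2 ba hb8, hbm])
  have FB := frame_exec ω (accum y 8 1 (inp 1)
    (.mul (.get ba (var x) (var y)) (.get ba (var x) (var y)))) s3
  set s4 := Cmd.exec ω (accum y 8 1 _ _) s3 with hs4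
  have n4 : ∀ a, a ≠ y → s4.nat a = s3.nat a := fun a ha => FB.nat a (by
    simp [Cmd.WritesNat, accum, ha])
  have r4 : ∀ a, a ≠ 8 → s4.real a = s3.real a := fun a ha => FB.real a (by
    simp [Cmd.WritesReal, accum, ha])
  clear_value s4
  have d0 : s4.nat 0 0 1 = st.nat 0 0 1 := by rw [n4 0 h0', n3 0 h0', n2 0 h0 h0']
  have d3 : s3.nat 0 0 1 = st.nat 0 0 1 := by rw [n3 0 h0', n2 0 h0 h0']
  have d2 : s2.nat 0 0 1 = st.nat 0 0 1 := by rw [n2 0 h0 h0']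
  have hD : s4.nat dr 0 0 = st.nat dr 0 0 := by rw [n4 dr hdy, n3 dr hdy, n2 dr hdx hdy]
  have hx4 : s4.nat x 0 0 = m := by rw [n4 x hxy, n3 x hxy, n2x]
  have hb4 : s4.real ba m = st.real ba m := by rw [r4 ba hb8, r3 ba hb8, r2 ba hb8, hbm]
  have hda4 : s4.real da = st'.real da := by rw [r4 da hd8, r3 da hd8, r2 da hd8]
  have hnum : s4.real 8 0 0 =
      dot (st.nat 0 0 1) (st.real ba m) (st.real sa (st.nat sr 0 0)) := by
    simp [B.1, A.1, r28, d2, dot]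
  have hden : s4.real 8 0 1 = dot (st.nat 0 0 1) (st.real ba m) (st.real ba m) := by
    simp [B.1, A.1, r28, d3, dot]
  have C := mapRow_spec (ω := ω) (x := y) (a := da) (r := dr) (len := inp 1)
    (e := (.add (.get da (var dr) (var y))
        (.mul (.mul sgn (.div (.get 8 (.lit 0) (.lit 0)) (.get 8 (.lit 0) (.lit 1))))
          (.get ba (var x) (var y))))) (st := s4)
    (fun l => st'.real da (st.nat dr 0 0) l + g * (dot (st.nat 0 0 1) (st.real ba m)
      (st.real sa (st.nat sr 0 0)) / dot (st.nat 0 0 1) (st.real ba m) (st.real ba m)) *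
      st.real ba m l) hdy (by
      intro l hl s hs hq hrow hy
      have e1 := hs.nat x (by simp [Cmd.WritesNat, mapRow, hxy])
      have e2 := hs.nat dr (by simp [Cmd.WritesNat, mapRow, hdy])
      have e8 := hs.real 8 (by simp [Cmd.WritesReal, mapRow, hd8.symm])
      have e3 : s.real ba m = st.real ba m := by
        rcases eq_or_ne ba da with h | h
        · subst h
          rw [hrow m (by rcases hba with hba | hba <;> [exact absurd rfl hba; omega]), hb4]
        · rw [hs.real ba (by simp [Cmd.WritesReal, mapRow, h]), hb4]
      rw [hD] at hq
      simp [RExp.eval, NExp.eval, hg, e1, e2, e8, hy, hx4, e3, hD, hq, hnum, hden, hda4])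
  have n0' : st.nat 0 0 1 = (inp 1).eval s4 := by simp [d0]
  rw [hD] at C
  refine ⟨⟨?_, ?_⟩, ?_⟩
  · intro q hq
    rw [C.1, eval_inp, d0, if_pos hq, h1 q hq, Finset.sum_range_succ]
    ring
  · intro i hi
    rw [C.2.1 i hi, hda4, h2 i hi]
  · refine C.2.2.trans ?_
    have hb := B.2
    have ha := A.2
    simp only [eval_inp, cost_inp, RExp.cost, NExp.cost, cost_var, d0, d2, d3] at hb ha ⊢
    have : st.nat 0 0 1 * (3 + 3 + 1 + (sgn.cost + (1 + 1 + 1 + (1 + 1 + 1) + 1) + 1 +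
      (3 + 3 + 1) + 1) + 1 + 8) ≤ st.nat 0 0 1 * 38 := Nat.mul_le_mul_left _ (by omega)
    omega

end RealRAM

/-! ### Tournament trees

The tree has the nodes `1, …, 2 n - 1`; the children of `r` are `2 r` and `2 r + 1`, and the node
`n + j` is the leaf of the player `j`. -/

namespace RealRAM

/-- The winner at node `r` is the better one of the winners at its children. -/
def NodeOk (X : ℕ → ℝ) (T : ℕ → ℕ) (r : ℕ) : Prop :=
  (T r = T (2 * r) ∨ T r = T (2 * r + 1)) ∧ X (T (2 * r)) ≤ X (T r) ∧ X (T (2 * r + 1)) ≤ X (T r)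

/-- The winner at node `r` is a player whose leaf lies below `r`. -/
def Below (n : ℕ) (T : ℕ → ℕ) (r : ℕ) : Prop := T r < n ∧ ∃ i, (n + T r) / 2 ^ i = r

/-- A tournament tree that is correct except possibly at the proper ancestors of `q`. -/
structure TreeInv (n : ℕ) (X : ℕ → ℝ) (T : ℕ → ℕ) (q : ℕ) : Prop where
  leaf : ∀ j < n, T (n + j) = j
  below : ∀ r, 1 ≤ r → r < 2 * n → Below n T r
  ok : ∀ r, 1 ≤ r → r < n → (∀ i, 1 ≤ i → r ≠ q / 2 ^ i) → NodeOk X T r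

/-- Recompute the winner at node `r`. -/
noncomputable def replay (X : ℕ → ℝ) (T : ℕ → ℕ) (r : ℕ) : ℕ → ℕ :=
  Function.update T r (if X (T (2 * r)) < X (T (2 * r + 1)) then T (2 * r + 1) else T (2 * r))

lemma replay_of_ne {X : ℕ → ℝ} {T : ℕ → ℕ} {r q : ℕ} (h : q ≠ r) : replay X T r q = T q := by
  simp [replay, h]

lemma nodeOk_replay {X : ℕ → ℝ} {T : ℕ → ℕ} {r : ℕ} (h : 1 ≤ r) :
    NodeOk X (replay X T r) r := by
  unfold NodeOk
  rw [replay_of_ne (q := 2 * r) (by omega), replay_of_ne (q := 2 * r + 1) (by omega)]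
  simp only [replay, Function.update_self]
  split_ifs with h1
  · exact ⟨Or.inr rfl, h1.le, le_rfl⟩
  · exact ⟨Or.inl rfl, le_rfl, not_lt.mp h1⟩

lemma nodeOk_replay_of_ne {X : ℕ → ℝ} {T : ℕ → ℕ} {r q : ℕ} (h : NodeOk X T q) (h1 : q ≠ r)
    (h2 : 2 * q ≠ r) (h3 : 2 * q + 1 ≠ r) : NodeOk X (replay X T r) q := by
  unfold NodeOk
  rwa [replay_of_ne h1, replay_of_ne h2, replay_of_ne h3]

lemma below_parent {n : ℕ} {T T' : ℕ → ℕ} {r c : ℕ} (h : Below n T c) (hc : c / 2 = r)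
    (hT : T' r = T c) : Below n T' r := by
  obtain ⟨h1, i, hi⟩ := h
  refine ⟨hT ▸ h1, i + 1, ?_⟩
  rw [hT, pow_succ, ← Nat.div_div_eq_div_mul, hi, hc]

lemma below_replay {n : ℕ} {X : ℕ → ℝ} {T : ℕ → ℕ} {r : ℕ} (h : Below n T (2 * r))
    (h' : Below n T (2 * r + 1)) : Below n (replay X T r) r := by
  by_cases hX : X (T (2 * r)) < X (T (2 * r + 1))
  · exact below_parent h' (by omega) (by simp [replay, hX])
  · exact below_parent h (by omega) (by simp [replay, hX])

lemma TreeInv.replay {n : ℕ} {X : ℕ → ℝ} {T : ℕ → ℕ} {q : ℕ} (h : TreeInv n X T q)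
    (hq : q < 2 * n) : TreeInv n X (replay X T (q / 2)) (q / 2) := by
  refine ⟨fun j hj => ?_, fun r h1 h2 => ?_, fun r h1 h2 h3 => ?_⟩
  · rw [replay_of_ne (by omega), h.leaf j hj]
  · rcases eq_or_ne r (q / 2) with rfl | hr
    · exact below_replay (h.below _ (by omega) (by omega)) (h.below _ (by omega) (by omega))
    · have := h.below r h1 h2
      unfold Below
      rwa [replay_of_ne hr]
  · rcases eq_or_ne r (q / 2) with rfl | hr
    · exact nodeOk_replay h1
    · have h4 : r ≠ q / 2 / 2 := by simpa using h3 1 le_rfl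
      refine nodeOk_replay_of_ne (h.ok r h1 h2 fun i hi => ?_) hr (by omega) (by omega)
      obtain ⟨i, rfl⟩ := Nat.exists_eq_add_of_le' hi
      rcases Nat.eq_zero_or_pos i with rfl | hi'
      · simpa using hr
      · have := h3 i hi'
        rwa [Nat.div_div_eq_div_mul, ← pow_succ'] at this

lemma TreeInv.le_root {n : ℕ} {X : ℕ → ℝ} {T : ℕ → ℕ} (h : TreeInv n X T 0) {j : ℕ} (hj : j < n) :
    X j ≤ X (T 1) := by
  have key : ∀ r, 1 ≤ r → r < 2 * n → X (T r) ≤ X (T 1) := by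
    intro r
    induction r using Nat.strong_induction_on with
    | _ r ih =>
      intro h1 h2
      rcases eq_or_ne r 1 with rfl | hr
      · exact le_rfl
      · have hok := h.ok (r / 2) (by omega) (by omega) (fun i _ => by
          rw [Nat.zero_div]; omega)
        refine le_trans ?_ (ih (r / 2) (by omega) (by omega) (by omega))
        rcases Nat.even_or_odd' r with ⟨c, rfl | rfl⟩
        · have : 2 * c / 2 = c := by omega
          rw [this] at hok ⊢
          exact hok.2.1
        · have : (2 * c + 1) / 2 = c := by omega
          rw [this] at hok ⊢
          exact hok.2.2
  have := key (n + j) (by omega) (by omega)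
  rwa [h.leaf j hj] at this

lemma TreeInv.update {n : ℕ} {X : ℕ → ℝ} {T : ℕ → ℕ} (h : TreeInv n X T 0) (j : ℕ) (v : ℝ) :
    TreeInv n (Function.update X j v) T (n + j) := by
  refine ⟨h.leaf, h.below, fun r h1 h2 h3 => ?_⟩
  have hok := h.ok r h1 h2 (fun i _ => by rw [Nat.zero_div]; omega)
  have key : ∀ c, 1 ≤ c → c < 2 * n → c / 2 = r → T c ≠ j := by
    rintro c hc1 hc2 rfl rfl
    obtain ⟨-, i, hi⟩ := h.below c hc1 hc2
    refine h3 (i + 1) (by omega) ?_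
    rw [pow_succ, ← Nat.div_div_eq_div_mul, hi]
  have k1 := key (2 * r) (by omega) (by omega) (by omega)
  have k2 := key (2 * r + 1) (by omega) (by omega) (by omega)
  have k0 : T r ≠ j := by rcases hok.1 with h | h <;> rwa [h]
  unfold NodeOk at hok ⊢
  simpa [k0, k1, k2] using hok

/-! ### The program for the selection of the `s` largest values -/

/-- Recompute the winner at the node whose number is in variable 14; the values are in the row of
the real array 5 given by variable 30. -/
def replayCmd : Cmd :=
  .ite (.realLt (.get 5 (var 30) (.get 10 (.add (var 14) (var 14)) (.lit 0)))
      (.get 5 (var 30) (.get 10 (.add (.add (var 14) (var 14)) (.lit 1)) (.lit 0))))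
    (.setNat 10 (var 14) (.lit 0) (.get 10 (.add (.add (var 14) (var 14)) (.lit 1)) (.lit 0)))
    (.setNat 10 (var 14) (.lit 0) (.get 10 (.add (var 14) (var 14)) (.lit 0)))

/-- The tournament tree in memory. -/
def tree (st : State) : ℕ → ℕ := fun r => st.nat 10 r 0

lemma replayCmd_spec (ω : ℕ → ℝ) (st : State) :
    tree (replayCmd.exec ω st) =
      replay (st.real 5 (st.nat 30 0 0)) (tree st) (st.nat 14 0 0) ∧
    (replayCmd.exec ω st).time ≤ st.time + 50 := by
  have e : ∀ c : ℕ, c + c = 2 * c := fun c => by ring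
  simp only [replayCmd, Cmd.exec, Test.holds, RExp.eval, NExp.eval, eval_var, e]
  constructor
  · funext q
    split_ifs with h
    · simp [tree, replay, Function.update_apply, h]
    · simp [tree, replay, Function.update_apply, h]
  · split_ifs <;> simp [Test.cost, RExp.cost, NExp.cost]

lemma replayCmd_frame (ω : ℕ → ℝ) (st : State) :
    (∀ a, a ≠ 10 → (replayCmd.exec ω st).nat a = st.nat a) ∧
    (∀ a, (replayCmd.exec ω st).real a = st.real a) := by
  have h := frame_exec ω replayCmd st
  exact ⟨fun a ha => h.nat a (by simp [replayCmd, Cmd.WritesNat, ha]),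
    fun a => h.real a (by simp [replayCmd, Cmd.WritesReal])⟩

/-- Table of the halves of the numbers up to `2 n`, and the number of levels of the tree. -/
def halfTable : Cmd :=
  .seq (.loop 20 (inp 0) (.seq (.setNat 11 (.add (var 20) (var 20)) (.lit 0) (var 20))
      (.setNat 11 (.add (.add (var 20) (var 20)) (.lit 1)) (.lit 0) (var 20))))
    (.seq (.setNat 16 (.lit 0) (.lit 0) (.lit 0))
    (.seq (.setNat 17 (.lit 0) (.lit 0) (.lit 1))
    (.loop 20 (.add (inp 0) (inp 0))
      (.ite (.natLt (var 17) (.add (inp 0) (inp 0)))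
        (.seq (.setNat 17 (.lit 0) (.lit 0) (.add (var 17) (var 17)))
          (.setNat 16 (.lit 0) (.lit 0) (.add (var 16) (.lit 1)))) .skip))))

/-- The half table is correct and the number of levels is about `log₂ n`. -/
def HalfOk (n : ℕ) (st : State) : Prop :=
  (∀ q < 2 * n, st.nat 11 q 0 = q / 2) ∧ 2 * n ≤ 2 ^ st.nat 16 0 0 ∧ 2 ^ st.nat 16 0 0 ≤ 4 * n

lemma halfTable_spec (ω : ℕ → ℝ) (st : State) (hn : 1 ≤ st.nat 0 0 0) :
    HalfOk (st.nat 0 0 0) (halfTable.exec ω st) ∧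
    (halfTable.exec ω st).time ≤ st.time + 130 * (st.nat 0 0 0 + 1) := by
  simp only [halfTable, Cmd.exec]
  have A := loop_rule (ω := ω) (x := 20) (e := inp 0)
    (c := (.seq (.setNat 11 (.add (var 20) (var 20)) (.lit 0) (var 20))
      (.setNat 11 (.add (.add (var 20) (var 20)) (.lit 1)) (.lit 0) (var 20)))) (st := st)
    (fun m st' => ∀ q < 2 * m, st'.nat 11 q 0 = q / 2) 40 (by simp) (by
      intro m hm st' hF h
      constructor
      · intro q hq
        simp [Cmd.exec, NExp.eval]
        split_ifs with h1 h2
        · omega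
        · omega
        · exact h q (by omega)
      · simp [Cmd.exec, NExp.cost])
  have FA := frame_exec ω (Cmd.loop 20 (inp 0)
    (.seq (.setNat 11 (.add (var 20) (var 20)) (.lit 0) (var 20))
      (.setNat 11 (.add (.add (var 20) (var 20)) (.lit 1)) (.lit 0) (var 20)))) st
  simp only [Cmd.exec] at A FA
  set s1 := List.foldl _ (st.tick ((inp 0).cost + 1)) _ with hs1
  clear_value s1
  have n1 : s1.nat 0 = st.nat 0 := FA.nat 0 (by simp [Cmd.WritesNat])
  set s2 := State.tick (State.putNat (State.tick (State.putNat s1 16 _ _ _) _) 17 _ _ _) _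
    with hs2
  have B := loop_rule (ω := ω) (x := 20) (e := .add (inp 0) (inp 0))
    (c := (.ite (.natLt (var 17) (.add (inp 0) (inp 0)))
        (.seq (.setNat 17 (.lit 0) (.lit 0) (.add (var 17) (var 17)))
          (.setNat 16 (.lit 0) (.lit 0) (.add (var 16) (.lit 1)))) .skip)) (st := s2)
    (fun m st' => st'.nat 17 0 0 = 2 ^ st'.nat 16 0 0 ∧ 2 ^ st'.nat 16 0 0 ≤ 4 * st.nat 0 0 0 ∧
      (2 * st.nat 0 0 0 ≤ st'.nat 17 0 0 ∨ st'.nat 16 0 0 = m)) 40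
    (by simp [hs2, NExp.eval]; omega) (by
      intro m hm st' hF ⟨h1, h2, h3⟩
      have e0 : st'.nat 0 = st.nat 0 := by
        rw [hF.nat 0 (by simp [Cmd.WritesNat]), hs2]
        funext i j
        simp [n1]
      by_cases hlt : st'.nat 17 0 0 < st.nat 0 0 0 + st.nat 0 0 0
      · have : (Test.natLt (var 17) (.add (inp 0) (inp 0))).holds
            ((st'.putNat 20 0 0 m).tick 1) := by simp [Test.holds, NExp.eval, e0, hlt]
        rw [Cmd.exec, if_pos this]
        constructor
        · simp [Cmd.exec, NExp.eval, h1, pow_succ]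
          omega
        · simp [Cmd.exec, Test.cost, NExp.cost]
      · have : ¬ (Test.natLt (var 17) (.add (inp 0) (inp 0))).holds
            ((st'.putNat 20 0 0 m).tick 1) := by simpa [Test.holds, NExp.eval, e0] using hlt
        rw [Cmd.exec, if_neg this]
        constructor
        · simp [Cmd.exec, h1]
          omega
        · simp [Cmd.exec, Test.cost, NExp.cost])
  have FB := frame_exec ω (Cmd.loop 20 (.add (inp 0) (inp 0))
      (.ite (.natLt (var 17) (.add (inp 0) (inp 0)))
        (.seq (.setNat 17 (.lit 0) (.lit 0) (.add (var 17) (var 17)))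
          (.setNat 16 (.lit 0) (.lit 0) (.add (var 16) (.lit 1)))) .skip)) s2
  simp only [Cmd.exec] at B FB
  set s3 := List.foldl _ (s2.tick _) _ with hs3
  clear_value s3
  have e2 : NExp.eval s2 (.add (inp 0) (inp 0)) = st.nat 0 0 0 + st.nat 0 0 0 := by
    simp [NExp.eval, hs2, n1]
  have t2 : s2.time = s1.time + 8 := by simp [hs2, NExp.cost]
  rw [e2] at B
  refine ⟨⟨?_, ?_, B.1.2.1⟩, ?_⟩
  · intro q hq
    rw [FB.nat 11 (by simp [Cmd.WritesNat])]
    have := A.1 q (by simpa using hq)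
    simpa [hs2] using this
  · obtain ⟨⟨h1, h2, h3⟩, -⟩ := B
    rcases h3 with h3 | h3
    · omega
    · rw [h3]
      have := Nat.lt_two_pow_self (n := st.nat 0 0 0 + st.nat 0 0 0)
      omega
  · have hA := A.2
    have hB := B.2
    simp only [eval_inp, cost_inp, NExp.cost] at hA hB
    omega

end RealRAM

namespace RealRAM

/-- Recompute the winners on the path from the node in variable 14 to the root. -/
def climb : Cmd :=
  .loop 23 (var 16) (.seq (.setNat 14 (.lit 0) (.lit 0) (.get 11 (var 14) (.lit 0))) replayCmd)

lemma climb_spec (ω : ℕ → ℝ) {n : ℕ} (st : State) (hh : HalfOk n st)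
    (hq : st.nat 14 0 0 < 2 * n)
    (ht : TreeInv n (st.real 5 (st.nat 30 0 0)) (tree st) (st.nat 14 0 0)) :
    TreeInv n (st.real 5 (st.nat 30 0 0)) (tree (climb.exec ω st)) 0 ∧
    (climb.exec ω st).time ≤ st.time + 4 + st.nat 16 0 0 * 60 := by
  have A := loop_rule (ω := ω) (x := 23) (e := var 16)
    (c := (.seq (.setNat 14 (.lit 0) (.lit 0) (.get 11 (var 14) (.lit 0))) replayCmd)) (st := st)
    (fun m st' => st'.nat 14 0 0 = st.nat 14 0 0 / 2 ^ m ∧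
      TreeInv n (st.real 5 (st.nat 30 0 0)) (tree st') (st'.nat 14 0 0)) 60
    ⟨by simp, ht⟩ (by
      intro m hm st' hF ⟨h1, h2⟩
      have e11 := hF.nat 11 (by simp [Cmd.WritesNat, replayCmd])
      have e30 := hF.nat 30 (by simp [Cmd.WritesNat, replayCmd])
      have e5 := hF.real 5 (by simp [Cmd.WritesReal, replayCmd])
      have hlt : st'.nat 14 0 0 < 2 * n := by
        rw [h1]; exact (Nat.div_le_self _ _).trans_lt hq
      simp only [Cmd.exec]
      set s1 := State.tick (State.putNat _ 14 _ _ _) _ with hs1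
      have k14 : s1.nat 14 0 0 = st'.nat 14 0 0 / 2 := by
        simp [hs1, NExp.eval, e11, hh.1 _ hlt]
      have kt : tree s1 = tree st' := by funext r; simp [hs1, tree]
      have k30 : s1.nat 30 0 0 = st.nat 30 0 0 := by simp [hs1, e30]
      have k5 : s1.real 5 = st.real 5 := by simp [hs1, e5]
      have kT : s1.time = st'.time + 9 := by simp [hs1, NExp.cost]
      clear_value s1
      have R := replayCmd_spec ω s1
      have F := replayCmd_frame ω s1
      refine ⟨⟨?_, ?_⟩, ?_⟩
      · rw [F.1 14 (by simp), k14, h1, Nat.div_div_eq_div_mul, pow_succ]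
      · rw [R.1, F.1 14 (by simp), k14, kt, k30, k5]
        exact h2.replay hlt
      · have := R.2
        omega)
  refine ⟨?_, ?_⟩
  · obtain ⟨⟨h1, h2⟩, -⟩ := A
    rw [h1, eval_var, Nat.div_eq_of_lt (hq.trans_le hh.2.1)] at h2
    exact h2
  · exact A.2

lemma climb_frame (ω : ℕ → ℝ) (st : State) :
    (∀ a, a ≠ 10 → a ≠ 14 → a ≠ 23 → (climb.exec ω st).nat a = st.nat a) ∧
    (∀ a, (climb.exec ω st).real a = st.real a) := by
  have h := frame_exec ω climb st
  exact ⟨fun a h1 h2 h3 => h.nat a (by simp [climb, replayCmd, Cmd.WritesNat, h1, h2, h3]),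
    fun a => h.real a (by simp [climb, replayCmd, Cmd.WritesReal])⟩

/-- Set up the leaves and play all matches. -/
def buildTree : Cmd :=
  .seq (.loop 20 (inp 0) (.setNat 10 (.add (inp 0) (var 20)) (.lit 0) (var 20)))
    (.loop 20 (.sub (inp 0) (.lit 1))
      (.seq (.setNat 14 (.lit 0) (.lit 0) (.sub (.sub (inp 0) (.lit 1)) (var 20))) replayCmd))

lemma buildTree_spec (ω : ℕ → ℝ) (st : State) :
    TreeInv (st.nat 0 0 0) (st.real 5 (st.nat 30 0 0)) (tree (buildTree.exec ω st)) 0 ∧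
    (buildTree.exec ω st).time ≤ st.time + 10 + st.nat 0 0 0 * 100 := by
  set n := st.nat 0 0 0 with hn
  have A := loop_rule (ω := ω) (x := 20) (e := inp 0)
    (c := .setNat 10 (.add (inp 0) (var 20)) (.lit 0) (var 20)) (st := st)
    (fun m st' => ∀ j < m, st'.nat 10 (n + j) 0 = j) 20 (by simp) (by
      intro m hm st' hF h
      have e0 := hF.nat 0 (by simp [Cmd.WritesNat])
      constructor
      · intro j hj
        simp [Cmd.exec, NExp.eval, e0, ← hn]
        split_ifs with h1
        · exact h1.symm
        · exact h j (by omega)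
      · simp [Cmd.exec, NExp.cost])
  have FA := frame_exec ω (Cmd.loop 20 (inp 0)
    (.setNat 10 (.add (inp 0) (var 20)) (.lit 0) (var 20))) st
  unfold buildTree
  rw [Cmd.exec]
  set s1 := Cmd.exec ω (Cmd.loop 20 (inp 0) _) st with hs1
  clear_value s1
  have n0 : s1.nat 0 = st.nat 0 := FA.nat 0 (by simp [Cmd.WritesNat])
  have n30 : s1.nat 30 = st.nat 30 := FA.nat 30 (by simp [Cmd.WritesNat])
  have r5 : s1.real 5 = st.real 5 := FA.real 5 (by simp [Cmd.WritesReal])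
  have B := loop_rule (ω := ω) (x := 20) (e := .sub (inp 0) (.lit 1))
    (c := (.seq (.setNat 14 (.lit 0) (.lit 0) (.sub (.sub (inp 0) (.lit 1)) (var 20))) replayCmd))
    (st := s1)
    (fun m st' => (∀ j < n, tree st' (n + j) = j) ∧
      (∀ r, 1 ≤ r → n ≤ r + m → r < 2 * n → Below n (tree st') r) ∧
      (∀ r, 1 ≤ r → n ≤ r + m → r < n → NodeOk (st.real 5 (st.nat 30 0 0)) (tree st') r)) 70
    (by
      refine ⟨fun j hj => A.1 j (by simpa using hj), fun r h1 h2 h3 => ?_, fun r h1 h2 h3 => ?_⟩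
      · obtain ⟨j, rfl⟩ := Nat.exists_eq_add_of_le h2
        have : tree s1 (n + j) = j := A.1 j (by simp [← hn]; omega)
        refine ⟨?_, 0, ?_⟩
        · simp [tree] at this ⊢; omega
        · simp [tree] at this ⊢; omega
      · omega) (by
      intro m hm st' hF ⟨h1, h2, h3⟩
      have e0 := hF.nat 0 (by simp [Cmd.WritesNat, replayCmd])
      have e30 := hF.nat 30 (by simp [Cmd.WritesNat, replayCmd])
      have e5 := hF.real 5 (by simp [Cmd.WritesReal, replayCmd])
      have hm' : m < n - 1 := by simpa [NExp.eval, n0, ← hn] using hm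
      rw [Cmd.exec]
      set s2 := Cmd.exec ω (.setNat 14 _ _ _) _ with hs2
      have k14 : s2.nat 14 0 0 = n - 1 - m := by
        simp [hs2, Cmd.exec, NExp.eval, e0, n0, ← hn]
      have kt : tree s2 = tree st' := by funext r; simp [hs2, tree, Cmd.exec]
      have k30 : s2.nat 30 0 0 = st.nat 30 0 0 := by simp [hs2, e30, Cmd.exec, n30]
      have k5 : s2.real 5 = st.real 5 := by simp [hs2, e5, Cmd.exec, r5]
      have kT : s2.time = st'.time + 13 := by simp [hs2, NExp.cost, Cmd.exec]
      clear_value s2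
      have R := replayCmd_spec ω s2
      rw [k30, k5, kt, k14] at R
      have hpos : 1 ≤ n - 1 - m := by omega
      refine ⟨⟨?_, ?_, ?_⟩, ?_⟩
      · intro j hj
        rw [R.1, replay_of_ne (by omega), h1 j hj]
      · intro r g1 g2 g3
        rw [R.1]
        rcases eq_or_ne r (n - 1 - m) with rfl | hr
        · exact below_replay (h2 _ (by omega) (by omega) (by omega))
            (h2 _ (by omega) (by omega) (by omega))
        · have := h2 r g1 (by omega) g3
          unfold Below
          rwa [replay_of_ne hr]
      · intro r g1 g2 g3
        rw [R.1]
        rcases eq_or_ne r (n - 1 - m) with rfl | hr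
        · exact nodeOk_replay g1
        · exact nodeOk_replay_of_ne (h3 r g1 (by omega) g3) hr (by omega) (by omega)
      · have := R.2
        omega)
  have ev : NExp.eval s1 (.sub (inp 0) (.lit 1)) = n - 1 := by simp [NExp.eval, n0, ← hn]
  rw [ev] at B
  refine ⟨⟨B.1.1, fun r h1 h2 => B.1.2.1 r h1 (by omega) h2,
    fun r h1 h2 _ => B.1.2.2 r h1 (by omega) h2⟩, ?_⟩
  have hA := A.2
  have hB := B.2
  simp only [eval_inp, cost_inp, NExp.cost, ← hn] at hA hB
  omega

/-- One round of the selection: take the winner, record it, remove it, and replay. -/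
def extract : Cmd :=
  .seq (.setNat 15 (.lit 0) (.lit 0) (.get 10 (.lit 1) (.lit 0)))
  (.seq (.setNat 12 (var 30) (var 22) (var 15))
  (.seq (.setReal 10 (var 30) (.lit 0)
    (.add (.get 10 (var 30) (.lit 0)) (.get 5 (var 30) (var 15))))
  (.seq (.setReal 5 (var 30) (var 15) (.get 11 (.lit 0) (.lit 0)))
  (.seq (.setNat 14 (.lit 0) (.lit 0) (.add (inp 0) (var 15))) climb))))

lemma extract_spec (ω : ℕ → ℝ) (st : State) (hn : 1 ≤ st.nat 0 0 0) (hh : HalfOk (st.nat 0 0 0) st)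
    (ht : TreeInv (st.nat 0 0 0) (st.real 5 (st.nat 30 0 0)) (tree st) 0) :
    let C := st.nat 30 0 0
    let j := tree st 1
    let st' := extract.exec ω st
    st'.real 5 C = Function.update (st.real 5 C) j (st.real 11 0 0) ∧
    (∀ i, i ≠ C → st'.real 5 i = st.real 5 i) ∧
    TreeInv (st.nat 0 0 0) (st'.real 5 C) (tree st') 0 ∧
    (∀ i q, st'.nat 12 i q = if i = C ∧ q = st.nat 22 0 0 then j else st.nat 12 i q) ∧
    (∀ i q, st'.real 10 i q = if i = C ∧ q = 0 then st.real 10 C 0 + st.real 5 C j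
      else st.real 10 i q) ∧
    st'.time ≤ st.time + 70 + st.nat 16 0 0 * 60 := by
  intro C j st'
  have hj : j < st.nat 0 0 0 := (ht.below 1 le_rfl (by omega)).1
  have hst : st' = extract.exec ω st := rfl
  clear_value st'
  unfold extract at hst
  simp only [Cmd.exec] at hst
  set s1 := State.tick (State.putNat _ 14 _ _ _) _ with hs1
  have n12 : ∀ i q, s1.nat 12 i q =
      if i = C ∧ q = st.nat 22 0 0 then j else st.nat 12 i q := by
    intro i q; simp [hs1, NExp.eval, C, j, tree]
  have n0 : s1.nat 0 = st.nat 0 := by funext i q; simp [hs1]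
  have n30 : s1.nat 30 = st.nat 30 := by funext i q; simp [hs1]
  have n11 : s1.nat 11 = st.nat 11 := by funext i q; simp [hs1]
  have n16 : s1.nat 16 = st.nat 16 := by funext i q; simp [hs1]
  have n14 : s1.nat 14 0 0 = st.nat 0 0 0 + j := by simp [hs1, NExp.eval, j, tree]
  have t1 : tree s1 = tree st := by funext r; simp [hs1, tree]
  have r10 : ∀ i q, s1.real 10 i q = if i = C ∧ q = 0 then st.real 10 C 0 + st.real 5 C j
      else st.real 10 i q := by
    intro i q; simp [hs1, NExp.eval, RExp.eval, C, j, tree]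
  have r5 : s1.real 5 C = Function.update (st.real 5 C) j (st.real 11 0 0) := by
    funext q; simp [hs1, NExp.eval, RExp.eval, C, j, tree, Function.update_apply]
  have r5' : ∀ i, i ≠ C → s1.real 5 i = st.real 5 i := by
    intro i hi
    funext q; simp only [C] at hi; simp [hs1, NExp.eval, RExp.eval, hi]
  have T1 : s1.time ≤ st.time + 60 := by
    simp [hs1, NExp.cost, RExp.cost]
  clear_value s1
  have F := climb_frame ω s1
  have S := climb_spec ω (n := st.nat 0 0 0) s1
    (by unfold HalfOk; rwa [n11, n16]) (by omega) (by
      rw [n30, n14, t1]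
      change TreeInv _ (s1.real 5 C) _ _
      rw [r5]
      exact ht.update _ _)
  rw [← hst] at F S
  rw [n30, n16] at S
  refine ⟨?_, ?_, ?_, ?_, ?_, ?_⟩
  · rw [F.2, r5]
  · intro i hi; rw [F.2, r5' i hi]
  · rw [F.2]; exact S.1
  · intro i q; rw [F.1 12 (by simp) (by simp) (by simp), n12]
  · intro i q; rw [F.2, r10]
  · have := S.2
    omega

/-- Find the `s` largest values in a row of the real array 5. -/
def selectTop : Cmd :=
  .seq buildTree
  (.seq (.setReal 11 (.lit 0) (.lit 0) (.lit 0))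
  (.seq (accum 20 11 0 (inp 0) (.sub (.lit 0) (.add (.mul (.get 5 (var 30) (var 20))
    (.get 5 (var 30) (var 20))) (.lit 1))))
  (.seq (.setReal 10 (var 30) (.lit 0) (.lit 0))
  (.loop 22 (inp 3) extract))))

lemma selectTop_spec (ω : ℕ → ℝ) (st : State) {n C : ℕ} (hn : st.nat 0 0 0 = n)
    (hC : st.nat 30 0 0 = C) (hn1 : 1 ≤ n) (hh : HalfOk n st) (hs : st.nat 0 0 3 ≤ n) :
    let s := st.nat 0 0 3
    let st' := selectTop.exec ω st
    let L := fun i => st'.nat 12 C i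
    (∀ i < s, L i < n) ∧
    (∀ i < s, ∀ i' < s, L i = L i' → i = i') ∧
    (∀ i < s, ∀ j < n, (∀ i' < s, L i' ≠ j) → st.real 5 C j ≤ st.real 5 C (L i)) ∧
    st'.real 10 C 0 = ∑ i ∈ Finset.range s, st.real 5 C (L i) ∧
    (∀ i, i ≠ C → st'.nat 12 i = st.nat 12 i ∧ st'.real 10 i = st.real 10 i ∧
      st'.real 5 i = st.real 5 i) ∧
    st'.time ≤ st.time + 40 + n * 130 + s * (75 + st.nat 16 0 0 * 60) := by
  intro s st' L
  have hst : st' = selectTop.exec ω st := rfl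
  clear_value st'
  unfold selectTop at hst
  rw [Cmd.exec, Cmd.exec, Cmd.exec, Cmd.exec] at hst
  have A := buildTree_spec ω st
  rw [hn, hC] at A
  have FA := frame_exec ω buildTree st
  set s1 := buildTree.exec ω st
  clear_value s1
  have a1 : ∀ a, a ≠ 10 → a ≠ 14 → a ≠ 20 → s1.nat a = st.nat a := fun a h1 h2 h3 => FA.nat a (by
    simp [buildTree, replayCmd, Cmd.WritesNat, h1, h2, h3])
  have b1 : ∀ a, s1.real a = st.real a := fun a => FA.real a (by
    simp [buildTree, replayCmd, Cmd.WritesReal])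
  set s2 := Cmd.exec ω (.setReal 11 _ _ _) s1 with hs2
  have a2 : s2.nat = s1.nat := rfl
  have b2 : ∀ a, a ≠ 11 → s2.real a = st.real a := by
    intro a ha; rw [← b1]; funext i j; simp [hs2, Cmd.exec, ha]
  have b2' : s2.real 11 0 0 = 0 := by simp [hs2, Cmd.exec, NExp.eval, RExp.eval]
  have t2 : s2.time = s1.time + 4 := by simp [hs2, Cmd.exec, NExp.cost, RExp.cost]
  clear_value s2
  have B := accum_spec (ω := ω) (x := 20) (a := 11) (j := 0) (len := inp 0)
    (e := .sub (.lit 0) (.add (.mul (.get 5 (var 30) (var 20)) (.get 5 (var 30) (var 20)))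
      (.lit 1))) (st := s2) (fun j => -(st.real 5 C j * st.real 5 C j + 1)) (by
      intro m hm st'' hF hx
      have e30 := hF.nat 30 (by simp [Cmd.WritesNat, accum])
      have e5 := hF.real 5 (by simp [Cmd.WritesReal, accum])
      simp [RExp.eval, e30, e5, hx, a2, a1, b2, hC])
  have FB := frame_exec ω (accum 20 11 0 (inp 0) (.sub (.lit 0) (.add (.mul (.get 5 (var 30)
    (var 20)) (.get 5 (var 30) (var 20))) (.lit 1)))) s2
  set s3 := Cmd.exec ω (accum 20 11 0 _ _) s2
  clear_value s3
  have a3 : ∀ a, a ≠ 20 → s3.nat a = s1.nat a := fun a h1 => by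
    rw [FB.nat a (by simp [accum, Cmd.WritesNat, h1]), a2]
  have b3 : ∀ a, a ≠ 11 → s3.real a = st.real a := fun a h1 => by
    rw [FB.real a (by simp [accum, Cmd.WritesReal, h1]), b2 a h1]
  have hlow : ∀ j < n, s3.real 11 0 0 < st.real 5 C j := by
    intro j hj
    have e : s3.real 11 0 0 =
        -∑ j ∈ Finset.range n, (st.real 5 C j * st.real 5 C j + 1) := by
      rw [B.1 0 0]; simp [b2', a2, a1, hn]
      rw [← Finset.sum_neg_distrib]
      exact Finset.sum_congr rfl fun _ _ => by ring
    rw [e]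
    have := Finset.single_le_sum (f := fun j => st.real 5 C j * st.real 5 C j + 1)
      (fun i _ => add_nonneg (mul_self_nonneg _) zero_le_one) (Finset.mem_range.mpr hj)
    nlinarith [sq_nonneg (st.real 5 C j + 1)]
  set s4 := Cmd.exec ω (.setReal 10 _ _ _) s3 with hs4
  have a4 : s4.nat = s3.nat := rfl
  have b4 : ∀ a, a ≠ 10 → s4.real a = s3.real a := by
    intro a ha; funext i j; simp [hs4, Cmd.exec, ha]
  have b4' : ∀ i q, s4.real 10 i q = if i = C ∧ q = 0 then 0 else st.real 10 i q := by
    intro i q; simp [hs4, Cmd.exec, NExp.eval, RExp.eval, b3, a3, a1, hC]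
  have t4 : s4.time = s3.time + 6 := by simp [hs4, Cmd.exec, NExp.cost, RExp.cost]
  clear_value s4
  have c4 : ∀ a, a ≠ 10 → a ≠ 14 → a ≠ 20 → s4.nat a = st.nat a := fun a h1 h2 h3 => by
    rw [a4, a3 a h3, a1 a h1 h2 h3]
  have tr4 : tree s4 = tree s1 := by
    funext r; simp only [tree]; rw [a4, a3 10 (by simp)]
  have D := loop_rule (ω := ω) (x := 22) (e := inp 3) (c := extract) (st := s4)
    (fun m st' =>
      (∀ i < m, st'.nat 12 C i < n) ∧
      (∀ i < m, ∀ i' < m, st'.nat 12 C i = st'.nat 12 C i' → i = i') ∧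
      (∀ i < m, ∀ j < n, (∀ i' < m, st'.nat 12 C i' ≠ j) →
        st.real 5 C j ≤ st.real 5 C (st'.nat 12 C i)) ∧
      st'.real 10 C 0 = ∑ i ∈ Finset.range m, st.real 5 C (st'.nat 12 C i) ∧
      (∀ i, i ≠ C → st'.nat 12 i = st.nat 12 i ∧ st'.real 10 i = st.real 10 i ∧
        st'.real 5 i = st.real 5 i) ∧
      TreeInv n (st'.real 5 C) (tree st') 0 ∧
      (∀ j < n, (∀ i < m, st'.nat 12 C i ≠ j) → st'.real 5 C j = st.real 5 C j) ∧
      (∀ i < m, st'.real 5 C (st'.nat 12 C i) = s3.real 11 0 0))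
    (75 + st.nat 16 0 0 * 60) (by
      refine ⟨by simp, by simp, by simp, by simp [b4'], fun i hi => ⟨?_, ?_, ?_⟩, ?_, ?_, by simp⟩
      · simp [c4]
      · funext q; simp [b4', hi]
      · simp [b4, b3]
      · have := A.1
        change TreeInv n (s4.real 5 C) (tree s4) 0
        rw [tr4, b4 5 (by simp), b3 5 (by simp)]
        exact this
      · intro j hj _; simp [b4, b3]) (by
      intro m hm st'' hF ⟨h1, h2, h3, h4, h5, h6, h7, h8⟩
      have hm' : m < s := by simpa [c4, s] using hm
      have hW : ∀ a, a ≠ 22 → ¬ Cmd.WritesNat extract a →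
          st''.nat a = s4.nat a := fun a h h' => hF.nat a (by simp [Cmd.WritesNat, h, h'])
      have e0 : st''.nat 0 = st.nat 0 := by
        rw [hW 0 (by simp) (by simp [extract, climb, replayCmd, Cmd.WritesNat]), c4] <;> simp
      have e30 : st''.nat 30 = st.nat 30 := by
        rw [hW 30 (by simp) (by simp [extract, climb, replayCmd, Cmd.WritesNat]), c4] <;> simp
      have e11 : st''.nat 11 = st.nat 11 := by
        rw [hW 11 (by simp) (by simp [extract, climb, replayCmd, Cmd.WritesNat]), c4] <;> simp
      have e16 : st''.nat 16 = st.nat 16 := by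
        rw [hW 16 (by simp) (by simp [extract, climb, replayCmd, Cmd.WritesNat]), c4] <;> simp
      have er : st''.real 11 = s3.real 11 := by
        rw [hF.real 11 (by simp [extract, climb, replayCmd, Cmd.WritesReal]), b4 11 (by simp)]
      set u := (st''.putNat 22 0 0 m).tick 1 with hu
      have u0 : u.nat 0 0 0 = n := by simp [hu, e0, hn]
      have u30 : u.nat 30 0 0 = C := by simp [hu, e30, hC]
      have u11 : u.nat 11 = st.nat 11 := by funext i q; simp [hu, e11]
      have u16 : u.nat 16 = st.nat 16 := by funext i q; simp [hu, e16]
      have u22 : u.nat 22 0 0 = m := by simp [hu]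
      have u12 : u.nat 12 = st''.nat 12 := by funext i q; simp [hu]
      have ut : tree u = tree st'' := by funext r; simp [hu, tree]
      have ur : u.real = st''.real := rfl
      have uT : u.time = st''.time + 1 := rfl
      clear_value u
      have E := extract_spec ω u (by omega) (by
        rw [u0]; unfold HalfOk; rwa [u11, u16]) (by rw [u0, u30, ut, ur]; exact h6)
      simp only [u0, u30, ut, ur, u16, u22, u12] at E
      obtain ⟨E1, E2, E3, E4, E5, E6⟩ := E
      set v := extract.exec ω u
      clear_value v
      set j := tree st'' 1 with hj
      have hjn : j < n := (h6.below 1 le_rfl (by omega)).1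
      have hfree : ∃ j₀ < n, ∀ i < m, st''.nat 12 C i ≠ j₀ := by
        by_contra! hcon
        have hsub : Finset.range n ⊆ (Finset.range m).image (fun i => st''.nat 12 C i) := by
          intro j' hj'
          obtain ⟨i, hi, h⟩ := hcon j' (Finset.mem_range.mp hj')
          exact Finset.mem_image.mpr ⟨i, Finset.mem_range.mpr hi, h⟩
        have := (Finset.card_le_card hsub).trans Finset.card_image_le
        simp at this
        omega
      have hjfree : ∀ i < m, st''.nat 12 C i ≠ j := by
        intro i hi hij
        obtain ⟨j₀, hj₀, hf⟩ := hfree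
        have k1 := h6.le_root hj₀
        rw [← hj, ← hij, h8 i hi, h7 j₀ hj₀ hf] at k1
        exact absurd (hlow j₀ hj₀) (not_lt.mpr k1)
      have vL : ∀ i < m, v.nat 12 C i = st''.nat 12 C i := by
        intro i hi; rw [E4, if_neg (by omega)]
      have vm : v.nat 12 C m = j := by rw [E4, if_pos ⟨rfl, rfl⟩]
      refine ⟨⟨?_, ?_, ?_, ?_, ?_, ?_, ?_, ?_⟩, ?_⟩
      · intro i hi
        rcases Nat.lt_succ_iff_lt_or_eq.mp hi with hi | rfl
        · rw [vL i hi]; exact h1 i hi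
        · rw [vm]; exact hjn
      · intro i hi i' hi' h
        rcases Nat.lt_succ_iff_lt_or_eq.mp hi with hi | rfl <;>
          rcases Nat.lt_succ_iff_lt_or_eq.mp hi' with hi' | rfl
        · rw [vL i hi, vL i' hi'] at h; exact h2 i hi i' hi' h
        · rw [vL i hi, vm] at h; exact absurd h (hjfree i hi)
        · rw [vL i' hi', vm] at h; exact absurd h.symm (hjfree i' hi')
        · rfl
      · intro i hi j' hj' hf
        have hf' : ∀ i' < m, st''.nat 12 C i' ≠ j' := fun i' hi' => by
          rw [← vL i' hi']; exact hf i' (by omega)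
        rcases Nat.lt_succ_iff_lt_or_eq.mp hi with hi | rfl
        · rw [vL i hi]; exact h3 i hi j' hj' hf'
        · rw [vm]
          have := h6.le_root hj'
          rwa [h7 j' hj' hf', ← hj, h7 j hjn hjfree] at this
      · rw [E5, if_pos ⟨rfl, rfl⟩, h4, Finset.sum_range_succ, vm, h7 j hjn hjfree]
        congr 1
        exact Finset.sum_congr rfl fun i hi => by rw [vL i (Finset.mem_range.mp hi)]
      · intro i hi
        refine ⟨?_, ?_, ?_⟩
        · rw [← (h5 i hi).1]; funext q; rw [E4, if_neg (by tauto)]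
        · rw [← (h5 i hi).2.1]; funext q; rw [E5, if_neg (by tauto)]
        · rw [E2 i hi, (h5 i hi).2.2]
      · exact E3
      · intro j' hj' hf
        have hf' : ∀ i' < m, st''.nat 12 C i' ≠ j' := fun i' hi' => by
          rw [← vL i' hi']; exact hf i' (by omega)
        have : j' ≠ j := fun h => hf m (by omega) (by rw [vm, h])
        rw [E1, Function.update_of_ne this, h7 j' hj' hf']
      · intro i hi
        rcases Nat.lt_succ_iff_lt_or_eq.mp hi with hi | rfl
        · rw [vL i hi, E1, Function.update_of_ne (hjfree i hi), h8 i hi]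
        · rw [vm, E1, Function.update_self, er]
      · omega)
  rw [← hst] at D
  have es : (inp 3).eval s4 = s := by simp [c4, s]
  rw [es] at D
  obtain ⟨⟨h1, h2, h3, h4, h5, -⟩, hT⟩ := D
  refine ⟨h1, h2, h3, h4, h5, ?_⟩
  have hA := A.2
  have hB := B.2
  have e2 : (inp 0).eval s2 = n := by simp [a2, a1, hn]
  simp only [e2, cost_inp, RExp.cost, cost_var] at hB hT
  omega

end RealRAM

/-! ### Sparse matrices in memory -/

namespace RealRAM

open LatentSimplex

/-- The input is in memory, and variable 31 is zero. -/
structure Loaded {d n : ℕ} (A : Matrix (Fin d) (Fin n) ℝ) (k s t : ℕ)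
    (e : Fin (nnz A) ≃ {q : Fin d × Fin n // A q.1 q.2 ≠ 0}) (st : State) : Prop where
  params : st.nat 0 = (input A k s t e).nat 0
  rows : st.nat 1 = (input A k s t e).nat 1
  cols : st.nat 2 = (input A k s t e).nat 2
  zero : st.nat 31 0 0 = 0
  vals : st.real 0 = (input A k s t e).real 0

section

variable {d n : ℕ} {A : Matrix (Fin d) (Fin n) ℝ} {k s t : ℕ}
  {e : Fin (nnz A) ≃ {q : Fin d × Fin n // A q.1 q.2 ≠ 0}}

lemma Loaded.of_eq {st st' : State} (h : Loaded A k s t e st) (h0 : st'.nat 0 = st.nat 0)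
    (h1 : st'.nat 1 = st.nat 1) (h2 : st'.nat 2 = st.nat 2) (h31 : st'.nat 31 = st.nat 31)
    (hr : st'.real 0 = st.real 0) : Loaded A k s t e st' :=
  ⟨h0.trans h.params, h1.trans h.rows, h2.trans h.cols, h31 ▸ h.zero, hr.trans h.vals⟩

lemma Loaded.of_frame {c : Cmd} {st st' : State} (h : Loaded A k s t e st) (hF : Frame c st st')
    (hw : ∀ a, a = 0 ∨ a = 1 ∨ a = 2 ∨ a = 31 → ¬ c.WritesNat a) (hr : ¬ c.WritesReal 0) :
    Loaded A k s t e st' :=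
  h.of_eq (hF.nat _ (hw _ (by simp))) (hF.nat _ (hw _ (by simp))) (hF.nat _ (hw _ (by simp)))
    (hF.nat _ (hw _ (by simp))) (hF.real _ hr)

lemma loaded_input : Loaded A k s t e (input A k s t e) := ⟨rfl, rfl, rfl, rfl, rfl⟩

lemma Loaded.n_eq {st : State} (h : Loaded A k s t e st) : st.nat 0 0 0 = n := by
  rw [h.params]; rfl
lemma Loaded.d_eq {st : State} (h : Loaded A k s t e st) : st.nat 0 0 1 = d := by
  rw [h.params]; rfl
lemma Loaded.k_eq {st : State} (h : Loaded A k s t e st) : st.nat 0 0 2 = k := by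
  rw [h.params]; rfl
lemma Loaded.s_eq {st : State} (h : Loaded A k s t e st) : st.nat 0 0 3 = s := by
  rw [h.params]; rfl
lemma Loaded.t_eq {st : State} (h : Loaded A k s t e st) : st.nat 0 0 4 = t := by
  rw [h.params]; rfl
lemma Loaded.nnz_eq {st : State} (h : Loaded A k s t e st) : st.nat 0 0 5 = nnz A := by
  rw [h.params]; rfl

lemma sum_support (f : Fin d × Fin n → ℝ) (hf : ∀ q : Fin d × Fin n, A q.1 q.2 = 0 → f q = 0) :
    ∑ z : Fin (nnz A), f (e z).1 = ∑ q, f q := by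
  classical
  rw [Equiv.sum_comp e (fun q => f q.1),
    ← Finset.sum_subtype (Finset.univ.filter fun q : Fin d × Fin n => A q.1 q.2 ≠ 0) (by simp) f]
  refine Finset.sum_filter_of_ne fun q _ hq => ?_
  exact fun h => hq (hf q h)

lemma Loaded.sum_cols {st : State} (h : Loaded A k s t e st) (f : ℕ → ℝ) (c : Fin n) :
    (∑ z ∈ Finset.range (st.nat 0 0 5),
      if st.nat 2 z 0 = c then st.real 0 z 0 * f (st.nat 1 z 0) else 0) = ∑ i, A i c * f i := by
  rw [h.nnz_eq, h.rows, h.cols, h.vals, Finset.sum_range]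
  have := sum_support (A := A) (e := e)
    (fun q => if q.2 = c then A q.1 q.2 * f q.1 else 0) (by rintro q hq; simp [hq])
  rw [Fintype.sum_prod_type] at this
  simp only [Finset.sum_ite_eq', Finset.mem_univ, if_true] at this
  rw [← this]
  refine Finset.sum_congr rfl fun z _ => ?_
  simp [input, Fin.ext_iff]

lemma Loaded.sum_rows {st : State} (h : Loaded A k s t e st) (f : ℕ → ℝ) (i : Fin d) :
    (∑ z ∈ Finset.range (st.nat 0 0 5),
      if st.nat 1 z 0 = i then st.real 0 z 0 * f (st.nat 2 z 0) else 0) = ∑ j, A i j * f j := by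
  rw [h.nnz_eq, h.rows, h.cols, h.vals, Finset.sum_range]
  have := sum_support (A := A) (e := e)
    (fun q => if q.1 = i then A q.1 q.2 * f q.2 else 0) (by rintro q hq; simp [hq])
  rw [Fintype.sum_prod_type_right] at this
  simp only [Finset.sum_ite_eq', Finset.mem_univ, if_true] at this
  rw [← this]
  refine Finset.sum_congr rfl fun z _ => ?_
  simp [input, Fin.ext_iff]

/-- Replace row `dr` of `da` by the product of the transposed matrix with row `sr` of `sa`. -/
def mulT (da dr sa sr : ℕ) : Cmd :=
  .seq (mapRow 25 da dr (inp 0) (.lit 0)) (scatter 25 da dr 2 sa sr 1)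

/-- Replace row `dr` of `da` by the product of the matrix with row `sr` of `sa`. -/
def mulN (da dr sa sr : ℕ) : Cmd :=
  .seq (mapRow 25 da dr (inp 1) (.lit 0)) (scatter 25 da dr 1 sa sr 2)

lemma zeroRow_spec (ω : ℕ → ℝ) {x a r : ℕ} {len : NExp} (st : State) (hr : r ≠ x) :
    (∀ q < len.eval st, ((mapRow x a r len (.lit 0)).exec ω st).real a (st.nat r 0 0) q = 0) ∧
    (∀ i, i ≠ st.nat r 0 0 → ((mapRow x a r len (.lit 0)).exec ω st).real a i = st.real a i) ∧
    ((mapRow x a r len (.lit 0)).exec ω st).time ≤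
      st.time + (len.cost + 1) + len.eval st * 9 := by
  have := mapRow_spec (ω := ω) (x := x) (a := a) (r := r) (len := len) (e := .lit 0) (st := st)
    (fun _ => 0) hr (by intros; simp [RExp.eval])
  refine ⟨fun q hq => ?_, this.2.1, this.2.2⟩
  rw [this.1, if_pos hq]

lemma mulT_spec (ω : ℕ → ℝ) {da dr sa sr : ℕ} {st : State} (h : Loaded A k s t e st)
    (hd : dr ≠ 25) (hs : sr ≠ 25) (hsa : sa ≠ da) (hda : da ≠ 0) :
    (∀ c : Fin n, ((mulT da dr sa sr).exec ω st).real da (st.nat dr 0 0) c =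
      ∑ i : Fin d, A i c * st.real sa (st.nat sr 0 0) i) ∧
    (∀ i, i ≠ st.nat dr 0 0 → ((mulT da dr sa sr).exec ω st).real da i = st.real da i) ∧
    ((mulT da dr sa sr).exec ω st).time ≤ st.time + 10 + 40 * (n + nnz A) := by
  rw [mulT, Cmd.exec]
  have Z := zeroRow_spec ω (x := 25) (a := da) (r := dr) (len := inp 0) st hd
  have F := frame_exec ω (mapRow 25 da dr (inp 0) (.lit 0)) st
  set s1 := (mapRow 25 da dr (inp 0) (.lit 0)).exec ω st
  clear_value s1
  have hn : ∀ a, a ≠ 25 → s1.nat a = st.nat a := fun a ha => F.nat a (by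
    simp [mapRow, Cmd.WritesNat, ha])
  have hr : ∀ a, a ≠ da → s1.real a = st.real a := fun a ha => F.real a (by
    simp [mapRow, Cmd.WritesReal, ha])
  have h1 : Loaded A k s t e s1 := h.of_eq (hn _ (by simp)) (hn _ (by simp)) (hn _ (by simp))
    (hn _ (by simp)) (hr _ hda.symm)
  have S := scatter_spec (ω := ω) (x := 25) (da := da) (dr := dr) (qa := 2) (sa := sa) (sr := sr)
    (pa := 1) (st := s1) hd (by simp) hs (by simp) hsa hda
  rw [hn dr hd, hn sr hs, hr sa hsa] at S
  refine ⟨fun c => ?_, fun i hi => ?_, ?_⟩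
  · rw [S.1, Z.1 c (by simp [h.n_eq]), zero_add, h1.sum_cols]
  · rw [S.2.1 i hi, Z.2.1 i hi]
  · have h2 := Z.2.2
    have h3 := S.2.2
    rw [h1.nnz_eq] at h3
    simp only [eval_inp, h.n_eq, cost_inp] at h2
    omega

lemma mulN_spec (ω : ℕ → ℝ) {da dr sa sr : ℕ} {st : State} (h : Loaded A k s t e st)
    (hd : dr ≠ 25) (hs : sr ≠ 25) (hsa : sa ≠ da) (hda : da ≠ 0) :
    (∀ i : Fin d, ((mulN da dr sa sr).exec ω st).real da (st.nat dr 0 0) i =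
      ∑ j : Fin n, A i j * st.real sa (st.nat sr 0 0) j) ∧
    (∀ i, i ≠ st.nat dr 0 0 → ((mulN da dr sa sr).exec ω st).real da i = st.real da i) ∧
    ((mulN da dr sa sr).exec ω st).time ≤ st.time + 10 + 40 * (d + nnz A) := by
  rw [mulN, Cmd.exec]
  have Z := zeroRow_spec ω (x := 25) (a := da) (r := dr) (len := inp 1) st hd
  have F := frame_exec ω (mapRow 25 da dr (inp 1) (.lit 0)) st
  set s1 := (mapRow 25 da dr (inp 1) (.lit 0)).exec ω st
  clear_value s1
  have hn : ∀ a, a ≠ 25 → s1.nat a = st.nat a := fun a ha => F.nat a (by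
    simp [mapRow, Cmd.WritesNat, ha])
  have hr : ∀ a, a ≠ da → s1.real a = st.real a := fun a ha => F.real a (by
    simp [mapRow, Cmd.WritesReal, ha])
  have h1 : Loaded A k s t e s1 := h.of_eq (hn _ (by simp)) (hn _ (by simp)) (hn _ (by simp))
    (hn _ (by simp)) (hr _ hda.symm)
  have S := scatter_spec (ω := ω) (x := 25) (da := da) (dr := dr) (qa := 1) (sa := sa) (sr := sr)
    (pa := 2) (st := s1) hd (by simp) hs (by simp) hsa hda
  rw [hn dr hd, hn sr hs, hr sa hsa] at S
  refine ⟨fun c => ?_, fun i hi => ?_, ?_⟩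
  · rw [S.1, Z.1 c (by simp [h.d_eq]), zero_add, h1.sum_rows]
  · rw [S.2.1 i hi, Z.2.1 i hi]
  · have h2 := Z.2.2
    have h3 := S.2.2
    rw [h1.nnz_eq] at h3
    simp only [eval_inp, h.d_eq, cost_inp] at h2
    omega

end

/-- Fill row `r` of the real array `a` with random numbers. -/
def drawRow (a r : ℕ) : Cmd := .loop 25 (inp 1) (.draw a (var r) (var 25))

lemma drawRow_spec (ω : ℕ → ℝ) {a r : ℕ} (st : State) (hr : r ≠ 25) :
    (∀ q < st.nat 0 0 1, ((drawRow a r).exec ω st).real a (st.nat r 0 0) q = ω (st.pos + q)) ∧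
    (∀ i, i ≠ st.nat r 0 0 → ((drawRow a r).exec ω st).real a i = st.real a i) ∧
    ((drawRow a r).exec ω st).pos = st.pos + st.nat 0 0 1 ∧
    ((drawRow a r).exec ω st).time ≤ st.time + 4 + st.nat 0 0 1 * 8 := by
  have := loop_rule (ω := ω) (x := 25) (e := inp 1) (c := .draw a (var r) (var 25)) (st := st)
    (fun m st' => (∀ q < m, st'.real a (st.nat r 0 0) q = ω (st.pos + q)) ∧
      (∀ i, i ≠ st.nat r 0 0 → st'.real a i = st.real a i) ∧ st'.pos = st.pos + m) 8 (by simp) ?_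
  · exact ⟨this.1.1, this.1.2.1, this.1.2.2, this.2⟩
  intro m hm st' hF ⟨h1, h2, h3⟩
  have e1 : st'.nat r = st.nat r := hF.nat r (by simp [Cmd.WritesNat, hr])
  refine ⟨⟨?_, ?_, ?_⟩, ?_⟩
  · intro q hq
    rcases Nat.lt_succ_iff_lt_or_eq.mp hq with hq | rfl
    · simp [Cmd.exec, hr, e1, hq.ne, h1 q hq]
    · simp [Cmd.exec, hr, e1, h3]
  · intro i hi
    funext q
    simp [Cmd.exec, hr, e1, hi, h2 i hi]
  · simp [Cmd.exec, h3]; omega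
  · simp [Cmd.exec]

end RealRAM

/-! ### Projections on a growing or shrinking subspace -/

namespace LatentSimplex

section

variable {E : Type*} [NormedAddCommGroup E] [InnerProductSpace ℝ E]

/-- The projection of `x` on the line spanned by `b`. -/
noncomputable def lineProj (b x : E) : E := (inner ℝ b x / inner ℝ b b) • b

lemma inner_sub_lineProj (b x : E) : inner ℝ b (x - lineProj b x) = 0 := by
  rcases eq_or_ne b 0 with rfl | hb
  · simp
  · have : inner ℝ b b ≠ 0 := inner_self_ne_zero.mpr hb
    rw [inner_sub_right, lineProj, inner_smul_right]
    field_simp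
    ring

variable [FiniteDimensional ℝ E]

lemma starProjection_sup_singleton (U : Submodule ℝ E) (a x : E) :
    (U ⊔ Submodule.span ℝ {a}).starProjection x =
      U.starProjection x + lineProj (a - U.starProjection a) x := by
  set b := a - U.starProjection a with hb
  have hbU : b ∈ Uᗮ := U.sub_starProjection_mem_orthogonal a
  refine Submodule.eq_starProjection_of_mem_orthogonal ?_ ?_
  · refine Submodule.add_mem _ (Submodule.mem_sup_left (U.starProjection_apply_mem x)) ?_
    refine Submodule.smul_mem _ _ (Submodule.sub_mem _ ?_
      (Submodule.mem_sup_left (U.starProjection_apply_mem a)))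
    exact Submodule.mem_sup_right (Submodule.mem_span_singleton_self a)
  · rw [Submodule.mem_orthogonal]
    intro y hy
    obtain ⟨u, hu, v, hv, rfl⟩ := Submodule.mem_sup.mp hy
    obtain ⟨c, rfl⟩ := Submodule.mem_span_singleton.mp hv
    have hU : ∀ u ∈ U, inner ℝ u (x - (U.starProjection x + lineProj b x)) = 0 := by
      intro u hu
      rw [← sub_sub, inner_sub_right, lineProj, inner_smul_right,
        (Submodule.mem_orthogonal _ _).mp hbU u hu,
        (Submodule.mem_orthogonal _ _).mp (U.sub_starProjection_mem_orthogonal x) u hu]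
      simp
    have ha : a = U.starProjection a + b := by simp [hb]
    have hb0 : inner ℝ b (x - (U.starProjection x + lineProj b x)) = 0 := by
      rw [add_comm, ← sub_sub, inner_sub_right, inner_sub_lineProj, zero_sub, neg_eq_zero]
      exact (Submodule.mem_orthogonal' _ _).mp hbU _ (U.starProjection_apply_mem x)
    rw [inner_add_left, hU u hu, inner_smul_left, ha, inner_add_left,
      hU _ (U.starProjection_apply_mem a), hb0]
    simp

lemma starProjection_inf_orthogonal_singleton (U : Submodule ℝ E) (a x : E) :
    (U ⊓ (Submodule.span ℝ {a})ᗮ).starProjection x =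
      U.starProjection x - lineProj (U.starProjection a) x := by
  set b := U.starProjection a with hb
  have hbU : b ∈ U := U.starProjection_apply_mem a
  have hx : inner ℝ b (U.starProjection x) = inner ℝ b x := by
    have := (Submodule.mem_orthogonal _ _).mp (U.sub_starProjection_mem_orthogonal x) b hbU
    rw [inner_sub_right] at this
    linarith
  have hmem : U.starProjection x - lineProj b x ∈ U :=
    Submodule.sub_mem _ (U.starProjection_apply_mem x) (Submodule.smul_mem _ _ hbU)
  refine Submodule.eq_starProjection_of_mem_orthogonal ⟨hmem, ?_⟩ ?_
  · refine (Submodule.mem_orthogonal_singleton_iff_inner_right).mpr ?_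
    have h1 : inner ℝ (a - b) (U.starProjection x - lineProj b x) = 0 :=
      (Submodule.mem_orthogonal' _ _).mp (U.sub_starProjection_mem_orthogonal a) _ hmem
    have h2 : inner ℝ b (U.starProjection x - lineProj b x) = 0 := by
      have := inner_sub_lineProj b x
      rw [inner_sub_right] at this ⊢
      rw [hx]; exact this
    rw [inner_sub_left] at h1
    linarith
  · rw [Submodule.mem_orthogonal]
    rintro y ⟨hyU, hya⟩
    have h1 : inner ℝ y a = 0 := Submodule.mem_orthogonal_singleton_iff_inner_left.mp hya
    have h2 : inner ℝ y b = 0 := by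
      have := (Submodule.mem_orthogonal _ _).mp (U.sub_starProjection_mem_orthogonal a) y hyU
      rw [inner_sub_right, h1] at this
      linarith
    have h3 := (Submodule.mem_orthogonal _ _).mp (U.sub_starProjection_mem_orthogonal x) y hyU
    rw [← sub_add, inner_add_right, h3, lineProj, inner_smul_right, h2]
    simp

lemma lineProj_starProjection_eq {U : Submodule ℝ E} {a : E} (c : ℝ) (hc : c ≠ 0) (x : E) :
    lineProj (U.starProjection (c • a)) x = lineProj (U.starProjection a) x := by
  simp only [lineProj, map_smul, inner_smul_left, inner_smul_right, smul_smul]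
  congr 1
  rcases eq_or_ne (inner ℝ (U.starProjection a) (U.starProjection a)) 0 with h | h
  · simp [inner_self_eq_zero.mp h]
  · simp only [conj_trivial]
    field_simp

end

section

variable {d n k : ℕ}

/-- The Gram matrix `A Aᵀ` as a linear map. -/
noncomputable def gramMap (A : Matrix (Fin d) (Fin n) ℝ) :
    EuclideanSpace ℝ (Fin d) →ₗ[ℝ] EuclideanSpace ℝ (Fin d) :=
  (Matrix.toEuclideanLin (A * A.transpose))

lemma gramMap_apply (A : Matrix (Fin d) (Fin n) ℝ) (v : EuclideanSpace ℝ (Fin d)) :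
    gramMap A v = WithLp.toLp 2 (A.mulVec (A.transpose.mulVec (WithLp.ofLp v))) := by
  simp [gramMap, Matrix.mulVec_mulVec, Matrix.toLpLin_apply]

/-- The range of the power iteration. -/
lemma span_subspacePower (A : Matrix (Fin d) (Fin n) ℝ) (ω : ℕ → ℝ) (t : ℕ) :
    Submodule.span ℝ (Set.range (subspacePower A k ω t)) =
      Submodule.span ℝ (Set.range fun m : Fin k => (gramMap A ^ t) (gaussVec ω d m)) := by
  induction t with
  | zero =>
    rw [subspacePower, InnerProductSpace.span_gramSchmidtNormed_range,
      InnerProductSpace.span_gramSchmidt]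
    simp
  | succ t ih =>
    rw [subspacePower, InnerProductSpace.span_gramSchmidtNormed_range,
      InnerProductSpace.span_gramSchmidt]
    have h1 : (fun m : Fin k => WithLp.toLp 2
        (A.mulVec (A.transpose.mulVec (WithLp.ofLp (subspacePower A k ω t m))))) =
        gramMap A ∘ subspacePower A k ω t := by
      funext m; simp [gramMap_apply]
    have h2 : (fun m : Fin k => (gramMap A ^ (t + 1)) (gaussVec ω d m)) =
        gramMap A ∘ fun m : Fin k => (gramMap A ^ t) (gaussVec ω d m) := by
      funext m; simp [pow_succ']
    rw [h1, h2, Set.range_comp, Set.range_comp, Submodule.span_image, Submodule.span_image, ih]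

/-- The space of round `r`, for an arbitrary natural number `r`. -/
noncomputable def stepSpace (A : Matrix (Fin d) (Fin n) ℝ) (t : ℕ) (ω : ℕ → ℝ)
    (R : Fin k → Finset (Fin n)) (r : ℕ) : Submodule ℝ (EuclideanSpace ℝ (Fin d)) :=
  Submodule.span ℝ (Set.range (subspacePower A k ω t)) ⊓
    (Submodule.span ℝ ((fun i => avg A (R i)) '' {i | (i : ℕ) < r}))ᗮ

lemma roundSpace_eq (A : Matrix (Fin d) (Fin n) ℝ) (t : ℕ) (ω : ℕ → ℝ)
    (R : Fin k → Finset (Fin n)) (r : Fin k) : roundSpace A t ω R r = stepSpace A t ω R r := rfl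

lemma stepSpace_zero (A : Matrix (Fin d) (Fin n) ℝ) (t : ℕ) (ω : ℕ → ℝ)
    (R : Fin k → Finset (Fin n)) :
    stepSpace A t ω R 0 = Submodule.span ℝ (Set.range (subspacePower A k ω t)) := by
  simp [stepSpace]

lemma stepSpace_succ (A : Matrix (Fin d) (Fin n) ℝ) (t : ℕ) (ω : ℕ → ℝ)
    (R : Fin k → Finset (Fin n)) (r : Fin k) :
    stepSpace A t ω R (r + 1) =
      stepSpace A t ω R r ⊓ (Submodule.span ℝ {avg A (R r)})ᗮ := by
  have : {i : Fin k | (i : ℕ) < r + 1} = {i : Fin k | (i : ℕ) < r} ∪ {r} := by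
    ext i
    simp only [Set.mem_ofPred_eq, Set.union_singleton, Set.mem_insert_iff, Fin.ext_iff]
    omega
  rw [stepSpace, stepSpace, this, Set.image_union, Set.image_singleton, Submodule.span_union,
    ← Submodule.inf_orthogonal, inf_assoc]

lemma stepSpace_congr (A : Matrix (Fin d) (Fin n) ℝ) (t : ℕ) {ω ω' : ℕ → ℝ}
    {R R' : Fin k → Finset (Fin n)} {r : ℕ}
    (hω : ∀ m : Fin k, gaussVec ω d m = gaussVec ω' d m)
    (hR : ∀ i : Fin k, (i : ℕ) < r → R i = R' i) :
    stepSpace A t ω R r = stepSpace A t ω' R' r := by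
  rw [stepSpace, stepSpace, span_subspacePower, span_subspacePower]
  simp only [hω]
  congr 3
  exact Set.image_congr fun i hi => by rw [hR i hi]

end

end LatentSimplex

/-! ### Power iteration and orthogonalization -/

namespace RealRAM

open LatentSimplex

/-- The vector with the first `d` entries of a row. -/
noncomputable def vec (d : ℕ) (f : ℕ → ℝ) : EuclideanSpace ℝ (Fin d) :=
  WithLp.toLp 2 (fun i => f i)

lemma inner_vec (d : ℕ) (f g : ℕ → ℝ) : inner ℝ (vec d f) (vec d g) = dot d f g := by
  rw [dot, Finset.sum_range]
  simp [vec, PiLp.inner_apply, mul_comm]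

lemma vec_ext {d : ℕ} {f : ℕ → ℝ} {v : EuclideanSpace ℝ (Fin d)} (h : ∀ i : Fin d, f i = v i) :
    vec d f = v := by
  ext i; exact h i

lemma addProj_vec {ω : ℕ → ℝ} {x y da dr sa sr ba : ℕ} {len : NExp} {sgn : RExp} {st : State}
    (g : ℝ) (hg : ∀ st', sgn.eval st' = g) (hgc : sgn.cost ≤ 3)
    (h0 : 0 ≠ x) (h0' : 0 ≠ y) (hxy : x ≠ y) (hdx : dr ≠ x) (hdy : dr ≠ y) (hsx : sr ≠ x)
    (hsy : sr ≠ y) (hsa : sa ≠ da) (hs8 : sa ≠ 8) (hd8 : da ≠ 8) (hb8 : ba ≠ 8)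
    (hba : ba ≠ da ∨ len.eval st ≤ st.nat dr 0 0) {d : ℕ} (hd : st.nat 0 0 1 = d) :
    vec d (((addProj x y da dr sa sr ba len sgn).exec ω st).real da (st.nat dr 0 0)) =
      vec d (st.real da (st.nat dr 0 0)) + g • ∑ i ∈ Finset.range (len.eval st),
        lineProj (vec d (st.real ba i)) (vec d (st.real sa (st.nat sr 0 0))) ∧
    (∀ i, i ≠ st.nat dr 0 0 →
      ((addProj x y da dr sa sr ba len sgn).exec ω st).real da i = st.real da i) ∧
    ((addProj x y da dr sa sr ba len sgn).exec ω st).time ≤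
      st.time + (len.cost + 1) + len.eval st * (23 + d * 92) := by
  have := addProj_spec (ω := ω) (x := x) (y := y) (da := da) (dr := dr) (sa := sa) (sr := sr)
    (ba := ba) (len := len) (sgn := sgn) (st := st) g hg hgc h0 h0' hxy hdx hdy hsx hsy hsa hs8
    hd8 hb8 hba
  rw [hd] at this
  refine ⟨vec_ext fun q => ?_, this.2⟩
  rw [this.1 q q.2]
  simp [vec, lineProj, ← inner_vec]

section

variable {d n : ℕ} {A : Matrix (Fin d) (Fin n) ℝ} {k s t : ℕ}
  {e : Fin (nnz A) ≃ {q : Fin d × Fin n // A q.1 q.2 ≠ 0}}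

/-- Draw the `k` initial vectors. -/
def drawAll : Cmd := .loop 24 (inp 2) (drawRow 1 24)

lemma drawAll_spec (ω : ℕ → ℝ) {st : State} (h : Loaded A k s t e st) (hp : st.pos = 0) :
    (∀ j < k, vec d ((drawAll.exec ω st).real 1 j) = gaussVec ω d j) ∧
    (drawAll.exec ω st).pos = k * d ∧
    (drawAll.exec ω st).time ≤ st.time + 4 + k * (5 + 8 * d) := by
  have := loop_rule (ω := ω) (x := 24) (e := inp 2) (c := drawRow 1 24) (st := st)
    (fun m st' => (∀ j < m, vec d (st'.real 1 j) = gaussVec ω d j) ∧ st'.pos = m * d)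
    (5 + 8 * d) (by simp [hp]) ?_
  · rw [eval_inp, h.k_eq] at this
    exact ⟨this.1.1, this.1.2, this.2⟩
  intro m hm st' hF ⟨h1, h2⟩
  have e0 := hF.nat 0 (by simp [Cmd.WritesNat, drawRow])
  set u := (st'.putNat 24 0 0 m).tick 1 with hu
  have u0 : u.nat 0 0 1 = d := by simp [hu, e0, h.d_eq]
  have u24 : u.nat 24 0 0 = m := by simp [hu]
  have ur : u.real = st'.real := rfl
  have up : u.pos = st'.pos := rfl
  have uT : u.time = st'.time + 1 := rfl
  clear_value u
  have D := drawRow_spec ω (a := 1) (r := 24) u (by simp)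
  rw [u0, u24, up, h2, ur] at D
  refine ⟨⟨?_, ?_⟩, ?_⟩
  · intro j hj
    rcases Nat.lt_succ_iff_lt_or_eq.mp hj with hj | rfl
    · rw [D.2.1 j hj.ne, h1 j hj]
    · exact vec_ext fun i => by rw [D.1 i i.2]; rfl
  · rw [D.2.2.1]; ring
  · have := D.2.2.2
    omega

/-- Apply `A Aᵀ` to the row of the real array 1 given by variable 24. -/
def powerStep : Cmd := .seq (mulT 5 31 1 24) (mulN 1 24 5 31)

lemma powerStep_spec (ω : ℕ → ℝ) {st : State} (h : Loaded A k s t e st) :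
    vec d ((powerStep.exec ω st).real 1 (st.nat 24 0 0)) =
      gramMap A (vec d (st.real 1 (st.nat 24 0 0))) ∧
    (∀ i, i ≠ st.nat 24 0 0 → (powerStep.exec ω st).real 1 i = st.real 1 i) ∧
    (powerStep.exec ω st).time ≤ st.time + 20 + 40 * (n + d + 2 * nnz A) := by
  rw [powerStep, Cmd.exec]
  have T := mulT_spec ω (da := 5) (dr := 31) (sa := 1) (sr := 24) h (by simp) (by simp) (by simp)
    (by simp)
  have F := frame_exec ω (mulT 5 31 1 24) st
  set s1 := (mulT 5 31 1 24).exec ω st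
  clear_value s1
  have h1 : Loaded A k s t e s1 := h.of_frame F
    (by rintro a (rfl | rfl | rfl | rfl) <;> simp [mulT, mapRow, scatter, Cmd.WritesNat])
    (by simp [mulT, mapRow, scatter, Cmd.WritesReal])
  have n24 : s1.nat 24 = st.nat 24 := F.nat 24 (by simp [mulT, mapRow, scatter, Cmd.WritesNat])
  have r1 : s1.real 1 = st.real 1 := F.real 1 (by simp [mulT, mapRow, scatter, Cmd.WritesReal])
  have N := mulN_spec ω (da := 1) (dr := 24) (sa := 5) (sr := 31) h1 (by simp) (by simp)
    (by simp) (by simp)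
  rw [n24, h1.zero, r1] at N
  rw [h.zero] at T
  refine ⟨vec_ext fun i => ?_, N.2.1, ?_⟩
  · rw [N.1, gramMap_apply]
    simp only [Matrix.mulVec, dotProduct, Matrix.transpose_apply]
    refine Finset.sum_congr rfl fun j _ => ?_
    rw [T.1]
    rfl
  · have h1 := T.2.2
    have h2 := N.2.2
    omega

/-- Apply `(A Aᵀ) ^ t` to the `k` initial vectors. -/
def powerAll : Cmd := .loop 24 (inp 2) (.loop 26 (inp 4) powerStep)

lemma powerAll_spec (ω : ℕ → ℝ) {st : State} (h : Loaded A k s t e st) :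
    (∀ j < k, vec d ((powerAll.exec ω st).real 1 j) =
      (gramMap A ^ t) (vec d (st.real 1 j))) ∧
    (powerAll.exec ω st).time ≤ st.time + 4 + k * (5 + t * (21 + 40 * (n + d + 2 * nnz A))) := by
  have := loop_rule (ω := ω) (x := 24) (e := inp 2) (c := .loop 26 (inp 4) powerStep) (st := st)
    (fun m st' => (∀ j < m, vec d (st'.real 1 j) = (gramMap A ^ t) (vec d (st.real 1 j))) ∧
      ∀ j, m ≤ j → st'.real 1 j = st.real 1 j)
    (5 + t * (21 + 40 * (n + d + 2 * nnz A))) (by simp) ?_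
  · rw [eval_inp, h.k_eq] at this
    exact ⟨this.1.1, this.2⟩
  intro m hm st' hF ⟨h1, h2⟩
  have hL : Loaded A k s t e st' := h.of_frame hF
    (by rintro a (rfl | rfl | rfl | rfl) <;>
      simp [powerStep, mulT, mulN, mapRow, scatter, Cmd.WritesNat])
    (by simp [powerStep, mulT, mulN, mapRow, scatter, Cmd.WritesReal])
  set u := (st'.putNat 24 0 0 m).tick 1 with hu
  have hLu : Loaded A k s t e u := hL.of_eq rfl rfl rfl rfl rfl
  have u24 : u.nat 24 0 0 = m := by simp [hu]
  have ur : u.real = st'.real := rfl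
  have uT : u.time = st'.time + 1 := rfl
  clear_value u
  have I := loop_rule (ω := ω) (x := 26) (e := inp 4) (c := powerStep) (st := u)
    (fun i v => vec d (v.real 1 m) = (gramMap A ^ i) (vec d (st.real 1 m)) ∧
      ∀ j, j ≠ m → v.real 1 j = st'.real 1 j) (21 + 40 * (n + d + 2 * nnz A))
    (by simp [ur, h2 m le_rfl]) (by
      intro i hi v hFv ⟨g1, g2⟩
      have hLv : Loaded A k s t e v := hLu.of_frame hFv
        (by rintro a (rfl | rfl | rfl | rfl) <;>
          simp [powerStep, mulT, mulN, mapRow, scatter, Cmd.WritesNat])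
        (by simp [powerStep, mulT, mulN, mapRow, scatter, Cmd.WritesReal])
      have v24 : v.nat 24 = u.nat 24 := hFv.nat 24 (by
        simp [powerStep, mulT, mulN, mapRow, scatter, Cmd.WritesNat])
      set w := (v.putNat 26 0 0 i).tick 1 with hw
      have hLw : Loaded A k s t e w := hLv.of_eq rfl rfl rfl rfl rfl
      have w24 : w.nat 24 0 0 = m := by simp [hw, v24, u24]
      have wr : w.real = v.real := rfl
      have wT : w.time = v.time + 1 := rfl
      clear_value w
      have P := powerStep_spec ω hLw
      rw [w24, wr] at P
      refine ⟨⟨?_, fun j hj => ?_⟩, ?_⟩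
      · rw [P.1, g1, pow_succ', Module.End.mul_apply]
      · rw [P.2.1 j hj, g2 j hj]
      · have := P.2.2
        omega)
  rw [eval_inp, hLu.t_eq] at I
  refine ⟨⟨fun j hj => ?_, fun j hj => ?_⟩, ?_⟩
  · rcases Nat.lt_succ_iff_lt_or_eq.mp hj with hj | rfl
    · rw [I.1.2 j hj.ne, h1 j hj]
    · exact I.1.1
  · rw [I.1.2 j (by omega), h2 j (by omega)]
  · have := I.2
    simp only [cost_inp] at this
    omega

/-- Orthogonalize the rows of the real array 1 into the real array 2. -/
def orthAll : Cmd :=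
  .loop 24 (inp 2) (.seq (mapRow 25 2 24 (inp 1) (.get 1 (var 24) (var 25)))
    (addProj 27 25 2 24 1 24 2 (var 24) (.sub (.lit 0) (.lit 1))))

lemma span_image_lt_succ {E : Type*} [AddCommGroup E] [Module ℝ E] (v : ℕ → E) (m : ℕ) :
    Submodule.span ℝ (v '' {i | i < m + 1}) =
      Submodule.span ℝ (v '' {i | i < m}) ⊔ Submodule.span ℝ {v m} := by
  rw [← Submodule.span_union, ← Set.image_singleton, ← Set.image_union]
  congr 2
  ext i
  simp only [Set.mem_ofPred_eq, Set.union_singleton, Set.mem_insert_iff]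
  omega

lemma orthAll_spec (ω : ℕ → ℝ) {st : State} (h : Loaded A k s t e st) :
    (∀ x, (Submodule.span ℝ ((fun j => vec d (st.real 1 j)) '' {i | i < k})).starProjection x =
      ∑ i ∈ Finset.range k, lineProj (vec d ((orthAll.exec ω st).real 2 i)) x) ∧
    (orthAll.exec ω st).time ≤ st.time + 4 + k * (9 + 15 * d + k * (23 + 92 * d)) := by
  have := loop_rule (ω := ω) (x := 24) (e := inp 2)
    (c := .seq (mapRow 25 2 24 (inp 1) (.get 1 (var 24) (var 25)))
    (addProj 27 25 2 24 1 24 2 (var 24) (.sub (.lit 0) (.lit 1)))) (st := st)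
    (fun m st' => ∀ x,
      (Submodule.span ℝ ((fun j => vec d (st.real 1 j)) '' {i | i < m})).starProjection x =
        ∑ i ∈ Finset.range m, lineProj (vec d (st'.real 2 i)) x)
    (9 + 15 * d + k * (23 + 92 * d)) (by simp) ?_
  · rw [eval_inp, h.k_eq] at this
    exact ⟨this.1, this.2⟩
  intro m hm st' hF h1
  rw [eval_inp, h.k_eq] at hm
  have e0 := hF.nat 0 (by simp [Cmd.WritesNat, mapRow, addProj, accum])
  have e1 := hF.real 1 (by simp [Cmd.WritesReal, mapRow, addProj, accum])
  rw [Cmd.exec]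
  set u := (st'.putNat 24 0 0 m).tick 1 with hu
  have u0 : u.nat 0 0 1 = d := by simp [hu, e0, h.d_eq]
  have u24 : u.nat 24 0 0 = m := by simp [hu]
  have ur : u.real = st'.real := rfl
  have uT : u.time = st'.time + 1 := rfl
  clear_value u
  have M := mapRow_spec (ω := ω) (x := 25) (a := 2) (r := 24) (len := inp 1)
    (e := .get 1 (var 24) (var 25)) (st := u) (fun q => st.real 1 m q) (by simp) (by
      intro q hq v hv _ _ hx
      have g1 := hv.real 1 (by simp [Cmd.WritesReal, mapRow])
      have g2 := hv.nat 24 (by simp [Cmd.WritesNat, mapRow])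
      simp [RExp.eval, g1, g2, hx, u24, ur, e1])
  have FM := frame_exec ω (mapRow 25 2 24 (inp 1) (.get 1 (var 24) (var 25))) u
  set v := (mapRow 25 2 24 (inp 1) (.get 1 (var 24) (var 25))).exec ω u
  clear_value v
  have v0 : v.nat 0 0 1 = d := by rw [FM.nat 0 (by simp [Cmd.WritesNat, mapRow]), u0]
  have v24 : v.nat 24 0 0 = m := by rw [FM.nat 24 (by simp [Cmd.WritesNat, mapRow]), u24]
  have vr : v.real 1 = st.real 1 := by
    rw [FM.real 1 (by simp [Cmd.WritesReal, mapRow]), ur, e1]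
  rw [u24, eval_inp, u0] at M
  have Q := addProj_vec (ω := ω) (x := 27) (y := 25) (da := 2) (dr := 24) (sa := 1) (sr := 24)
    (ba := 2) (len := var 24) (sgn := .sub (.lit 0) (.lit 1)) (st := v) (-1)
    (by intro _; simp [RExp.eval]) (by simp [RExp.cost]) (by simp) (by simp) (by simp) (by simp)
    (by simp) (by simp) (by simp) (by simp) (by simp) (by simp) (by simp)
    (Or.inr (by simp)) v0
  rw [eval_var, v24, vr] at Q
  set w := (addProj 27 25 2 24 1 24 2 (var 24) (.sub (.lit 0) (.lit 1))).exec ω v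
  clear_value w
  have hold : ∀ i < m, w.real 2 i = st'.real 2 i := by
    intro i hi
    rw [Q.2.1 i hi.ne, M.2.1 i hi.ne, ur]
  have hvold : ∀ i < m, v.real 2 i = st'.real 2 i := by
    intro i hi
    rw [M.2.1 i hi.ne, ur]
  have hvm : vec d (v.real 2 m) = vec d (st.real 1 m) := vec_ext fun i => by
    rw [M.1, if_pos i.2]; rfl
  refine ⟨fun x => ?_, ?_⟩
  · have hsum : ∑ i ∈ Finset.range m, lineProj (vec d (v.real 2 i)) (vec d (st.real 1 m)) =
        ∑ i ∈ Finset.range m, lineProj (vec d (st'.real 2 i)) (vec d (st.real 1 m)) :=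
      Finset.sum_congr rfl fun i hi => by rw [hvold i (Finset.mem_range.mp hi)]
    rw [span_image_lt_succ, starProjection_sup_singleton, Finset.sum_range_succ, h1 x, h1, Q.1, hvm,
      neg_one_smul, ← sub_eq_add_neg, hsum]
    congr 1
    exact Finset.sum_congr rfl fun i hi => by rw [hold i (Finset.mem_range.mp hi)]
  · have h2 := M.2.2
    have h3 := Q.2.2
    simp only [cost_inp, cost_var, RExp.cost] at h2 h3
    have : m * (23 + d * 92) ≤ k * (23 + 92 * d) := by
      rw [mul_comm d 92]
      exact Nat.mul_le_mul_right _ hm.le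
    omega

end

end RealRAM

/-! ### The rounds -/

namespace RealRAM

open LatentSimplex

lemma sum_le_sum_of_top {ι : Type*} [DecidableEq ι] (f : ι → ℝ) (C S : Finset ι)
    (hcard : S.card = C.card) (h : ∀ a ∈ C, ∀ b, b ∉ C → f b ≤ f a) :
    ∑ j ∈ S, f j ≤ ∑ j ∈ C, f j := by
  rw [← Finset.sum_inter_add_sum_sdiff S C, ← Finset.sum_inter_add_sum_sdiff C S,
    Finset.inter_comm C S]
  gcongr 1
  have hc : (S \ C).card = (C \ S).card := by
    have h1 := Finset.card_sdiff_add_card_inter S C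
    have h2 := Finset.card_sdiff_add_card_inter C S
    rw [Finset.inter_comm] at h2
    omega
  rcases (S \ C).eq_empty_or_nonempty with he | hne
  · rw [he] at hc ⊢
    rw [Finset.card_eq_zero.mp hc.symm]
  · obtain ⟨b, hb, hmax⟩ := Finset.exists_max_image (S \ C) f hne
    calc ∑ j ∈ S \ C, f j ≤ (S \ C).card • f b := Finset.sum_le_card_nsmul _ _ _ hmax
      _ = (C \ S).card • f b := by rw [hc]
      _ ≤ ∑ j ∈ C \ S, f j := Finset.card_nsmul_le_sum _ _ _ fun a ha =>
          h a (Finset.mem_sdiff.mp ha).1 b (Finset.mem_sdiff.mp hb).2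

lemma exists_finset_of_list {n s : ℕ} (L : ℕ → ℕ) (hlt : ∀ i < s, L i < n)
    (hinj : ∀ i < s, ∀ i' < s, L i = L i' → i = i') :
    ∃ C : Finset (Fin n), C.card = s ∧ (∀ j : Fin n, j ∈ C ↔ ∃ i < s, L i = j) ∧
      ∀ f : ℕ → ℝ, ∑ i ∈ Finset.range s, f (L i) = ∑ j ∈ C, f j := by
  classical
  have hi : Function.Injective (fun i : Fin s => (⟨L i, hlt i i.2⟩ : Fin n)) := by
    intro i i' h
    exact Fin.ext (hinj i i.2 i' i'.2 (by simpa using h))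
  refine ⟨Finset.univ.map ⟨_, hi⟩, by simp, fun j => ?_, fun f => ?_⟩
  · simp only [Finset.mem_map, Finset.mem_univ, true_and, Function.Embedding.coeFn_mk]
    constructor
    · rintro ⟨i, rfl⟩; exact ⟨i, i.2, rfl⟩
    · rintro ⟨i, h, h'⟩; exact ⟨⟨i, h⟩, Fin.ext h'⟩
  · rw [Finset.sum_range]; simp

section

variable {d n : ℕ} {A : Matrix (Fin d) (Fin n) ℝ} {k s t : ℕ}
  {e : Fin (nnz A) ≃ {q : Fin d × Fin n // A q.1 q.2 ≠ 0}}

/-- Project row 0 of `sa` on the current subspace: the rows of array 2 are an orthogonal basis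
of the initial subspace, and the first rows of array 7 are an orthogonal basis of the part that was
removed since. -/
def projectCmd (da dr sa : ℕ) : Cmd :=
  .seq (mapRow 25 da dr (inp 1) (.lit 0))
  (.seq (addProj 27 25 da dr sa 31 2 (inp 2) (.lit 1))
    (addProj 27 25 da dr sa 31 7 (var 28) (.sub (.lit 0) (.lit 1))))

lemma projectCmd_spec (ω : ℕ → ℝ) {da dr sa : ℕ} {st : State} (h : Loaded A k s t e st)
    (hd25 : dr ≠ 25) (hd27 : dr ≠ 27) (hsa : sa ≠ da)
    (hs8 : sa ≠ 8) (hd8 : da ≠ 8) (hd2 : 2 ≠ da) (hd0 : 0 ≠ da)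
    (h7 : 7 ≠ da ∨ st.nat 28 0 0 ≤ st.nat dr 0 0) (hrk : st.nat 28 0 0 ≤ k)
    {U : Submodule ℝ (EuclideanSpace ℝ (Fin d))}
    (hU : ∀ x, U.starProjection x =
      ∑ i ∈ Finset.range k, lineProj (vec d (st.real 2 i)) x -
        ∑ i ∈ Finset.range (st.nat 28 0 0), lineProj (vec d (st.real 7 i)) x) :
    vec d (((projectCmd da dr sa).exec ω st).real da (st.nat dr 0 0)) =
      U.starProjection (vec d (st.real sa 0)) ∧
    (∀ i, i ≠ st.nat dr 0 0 → ((projectCmd da dr sa).exec ω st).real da i = st.real da i) ∧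
    ((projectCmd da dr sa).exec ω st).time ≤ st.time + 20 + 9 * d + 2 * (k * (23 + 92 * d)) := by
  rw [projectCmd, Cmd.exec, Cmd.exec]
  have Z := zeroRow_spec ω (x := 25) (a := da) (r := dr) (len := inp 1) st hd25
  have F := frame_exec ω (mapRow 25 da dr (inp 1) (.lit 0)) st
  set s1 := (mapRow 25 da dr (inp 1) (.lit 0)).exec ω st
  clear_value s1
  have n1 : ∀ a, a ≠ 25 → s1.nat a = st.nat a := fun a ha => F.nat a (by
    simp [mapRow, Cmd.WritesNat, ha])
  have r1 : ∀ a, a ≠ da → s1.real a = st.real a := fun a ha => F.real a (by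
    simp [mapRow, Cmd.WritesReal, ha])
  have d1 : s1.nat 0 0 1 = d := by rw [n1 0 (by simp), h.d_eq]
  have k1 : s1.nat 0 0 2 = k := by rw [n1 0 (by simp), h.k_eq]
  have z1 : s1.nat 31 0 0 = 0 := by rw [n1 31 (by simp), h.zero]
  have P := addProj_vec (ω := ω) (x := 27) (y := 25) (da := da) (dr := dr) (sa := sa) (sr := 31)
    (ba := 2) (len := inp 2) (sgn := .lit 1) (st := s1) 1
    (by intro _; simp [RExp.eval]) (by simp [RExp.cost]) (by simp) (by simp) (by simp) hd27
    hd25 (by simp) (by simp) hsa hs8 hd8 (by simp) (Or.inl hd2) d1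
  rw [n1 dr hd25, eval_inp, k1, z1, r1 sa hsa, r1 2 hd2] at P
  have FP := frame_exec ω (addProj 27 25 da dr sa 31 2 (inp 2) (.lit 1)) s1
  set s2 := (addProj 27 25 da dr sa 31 2 (inp 2) (.lit 1)).exec ω s1
  clear_value s2
  have n2 : ∀ a, a ≠ 25 → a ≠ 27 → s2.nat a = st.nat a := fun a ha hb => by
    rw [FP.nat a (by simp [addProj, accum, mapRow, Cmd.WritesNat, ha, hb]), n1 a ha]
  have r2 : ∀ a, a ≠ da → a ≠ 8 → s2.real a = st.real a := fun a ha hb => by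
    rw [FP.real a (by simp [addProj, accum, mapRow, Cmd.WritesReal, ha, hb]), r1 a ha]
  have d2 : s2.nat 0 0 1 = d := by rw [n2 0 (by simp) (by simp), h.d_eq]
  have z2 : s2.nat 31 0 0 = 0 := by rw [n2 31 (by simp) (by simp), h.zero]
  have e28 : s2.nat 28 = st.nat 28 := n2 28 (by simp) (by simp)
  have Q := addProj_vec (ω := ω) (x := 27) (y := 25) (da := da) (dr := dr) (sa := sa) (sr := 31)
    (ba := 7) (len := var 28) (sgn := .sub (.lit 0) (.lit 1)) (st := s2) (-1)
    (by intro _; simp [RExp.eval]) (by simp [RExp.cost]) (by simp) (by simp) (by simp) hd27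
    hd25 (by simp) (by simp) hsa hs8 hd8 (by simp)
    (by rwa [eval_var, e28, n2 dr hd25 hd27]) d2
  rw [n2 dr hd25 hd27, eval_var, e28, z2, r2 sa hsa hs8] at Q
  have hsum : ∑ i ∈ Finset.range (st.nat 28 0 0),
      lineProj (vec d (s2.real 7 i)) (vec d (st.real sa 0)) =
      ∑ i ∈ Finset.range (st.nat 28 0 0),
      lineProj (vec d (st.real 7 i)) (vec d (st.real sa 0)) := by
    rcases eq_or_ne 7 da with h' | h'
    · subst h'
      refine Finset.sum_congr rfl fun i hi => ?_
      have hi' := Finset.mem_range.mp hi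
      have : i ≠ st.nat dr 0 0 := by rcases h7 with h7 | h7 <;> [exact absurd rfl h7; omega]
      rw [P.2.1 i this, Z.2.1 i this]
    · rw [r2 7 h' (by simp)]
  have hz : vec d (s1.real da (st.nat dr 0 0)) = 0 := vec_ext fun i => by
    rw [Z.1 i (by simp [h.d_eq])]; simp
  refine ⟨?_, fun i hi => ?_, ?_⟩
  · rw [Q.1, P.1, hz, hsum, hU, one_smul, zero_add, neg_one_smul, sub_eq_add_neg]
  · rw [Q.2.1 i hi, P.2.1 i hi, Z.2.1 i hi]
  · have h1 := Z.2.2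
    have h2 := P.2.2
    have h3 := Q.2.2
    simp only [eval_inp, h.d_eq, cost_inp, cost_var] at h1 h2 h3
    have : st.nat 28 0 0 * (23 + d * 92) ≤ k * (23 + 92 * d) := by
      rw [mul_comm d 92]; exact Nat.mul_le_mul_right _ hrk
    have e' : k * (23 + d * 92) = k * (23 + 92 * d) := by rw [mul_comm d 92]
    omega

/-- Draw a random vector and compute its projection on the current subspace. -/
def dirCmd : Cmd := .seq (drawRow 3 31) (projectCmd 4 31 3)

/-- Compute the inner products of the direction with the columns, and their negatives. -/
def valuesCmd : Cmd :=
  .seq (mulT 5 31 4 31) (mapRow 25 5 32 (inp 0) (.sub (.lit 0) (.get 5 (var 31) (var 25))))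

/-- Find the best set for the values, and write it to the output. -/
def pickCmd : Cmd :=
  .seq (.loop 30 (.lit 2) selectTop)
  (.seq (.ite (.realLt (.get 10 (.lit 1) (.lit 0)) (.get 10 (.lit 0) (.lit 0)))
      (.setNat 33 (.lit 0) (.lit 0) (.lit 0)) (.setNat 33 (.lit 0) (.lit 0) (.lit 1)))
    (.loop 25 (inp 3) (.setNat 3 (var 28) (var 25) (.get 12 (var 33) (var 25)))))

/-- Compute the new basis vector of the removed part. -/
def removeCmd : Cmd :=
  .seq (mapRow 25 9 31 (inp 0) (.lit 0))
  (.seq (.loop 25 (inp 3) (.setReal 9 (.lit 0) (.get 3 (var 28) (var 25)) (.lit 1)))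
  (.seq (mulN 6 31 9 31) (projectCmd 7 28 6)))

lemma valuesCmd_spec (ω : ℕ → ℝ) {st : State} (h : Loaded A k s t e st) (h32 : st.nat 32 0 0 = 1) :
    (∀ j : Fin n, (valuesCmd.exec ω st).real 5 0 j = inner ℝ (vec d (st.real 4 0)) (col A j)) ∧
    (∀ j : Fin n, (valuesCmd.exec ω st).real 5 1 j = -inner ℝ (vec d (st.real 4 0)) (col A j)) ∧
    (valuesCmd.exec ω st).time ≤ st.time + 20 + 60 * (n + nnz A) := by
  rw [valuesCmd, Cmd.exec]
  have T := mulT_spec ω (da := 5) (dr := 31) (sa := 4) (sr := 31) h (by simp) (by simp) (by simp)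
    (by simp)
  have F := frame_exec ω (mulT 5 31 4 31) st
  set s1 := (mulT 5 31 4 31).exec ω st
  clear_value s1
  have n1 : ∀ a, a ≠ 25 → s1.nat a = st.nat a := fun a ha => F.nat a (by
    simp [mulT, scatter, mapRow, Cmd.WritesNat, ha])
  rw [h.zero] at T
  have M := mapRow_spec (ω := ω) (x := 25) (a := 5) (r := 32) (len := inp 0)
    (e := .sub (.lit 0) (.get 5 (var 31) (var 25))) (st := s1) (fun q => -s1.real 5 0 q)
    (by simp) (by
      intro q hq v hv _ hrow hx
      have g2 := hv.nat 31 (by simp [Cmd.WritesNat, mapRow])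
      have g3 := hrow 0 (by rw [n1 32 (by simp), h32]; simp)
      simp [RExp.eval, g2, hx, n1, h.zero, g3])
  rw [n1 32 (by simp), h32, eval_inp, n1 0 (by simp), h.n_eq] at M
  have hin : ∀ j : Fin n, ∑ i, A i j * st.real 4 0 i = inner ℝ (vec d (st.real 4 0)) (col A j) := by
    intro j
    simp [vec, col, PiLp.inner_apply]
  refine ⟨fun j => ?_, fun j => ?_, ?_⟩
  · rw [M.2.1 0 (by simp), T.1, hin]
  · rw [M.1, if_pos j.2, T.1, hin]
  · have h1 := T.2.2
    have h2 := M.2.2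
    simp only [cost_inp, cost_var, RExp.cost] at h1 h2
    omega

lemma pickCmd_spec (ω : ℕ → ℝ) {st : State} (h : Loaded A k s t e st) (hn : 1 ≤ n) (hs : s ≤ n)
    (hh : HalfOk n st) (x : Fin n → ℝ) (h0 : ∀ j : Fin n, st.real 5 0 j = x j)
    (h1 : ∀ j : Fin n, st.real 5 1 j = -x j) :
    ∃ C : Finset (Fin n), C.card = s ∧
      (∀ S : Finset (Fin n), S.card = s → |∑ j ∈ S, x j| ≤ |∑ j ∈ C, x j|) ∧
      (∀ j : Fin n, j ∈ C ↔ ∃ i < s, (pickCmd.exec ω st).nat 3 (st.nat 28 0 0) i = j) ∧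
      (∀ i < s, (pickCmd.exec ω st).nat 3 (st.nat 28 0 0) i < n) ∧
      (∀ i, i ≠ st.nat 28 0 0 → (pickCmd.exec ω st).nat 3 i = st.nat 3 i) ∧
      (pickCmd.exec ω st).time ≤ st.time + 120 + n * (450 + 120 * st.nat 16 0 0) := by
  classical
  rw [pickCmd, Cmd.exec, Cmd.exec]
  have Lp := loop_rule (ω := ω) (x := 30) (e := .lit 2) (c := selectTop) (st := st)
    (fun m st' => (∀ c, m ≤ c → st'.real 5 c = st.real 5 c) ∧
      ∀ c < m, (∀ i < s, st'.nat 12 c i < n) ∧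
      (∀ i < s, ∀ i' < s, st'.nat 12 c i = st'.nat 12 c i' → i = i') ∧
      (∀ i < s, ∀ j < n, (∀ i' < s, st'.nat 12 c i' ≠ j) →
        st.real 5 c j ≤ st.real 5 c (st'.nat 12 c i)) ∧
      st'.real 10 c 0 = ∑ i ∈ Finset.range s, st.real 5 c (st'.nat 12 c i))
    (41 + n * 130 + s * (75 + st.nat 16 0 0 * 60)) (by simp) (by
      intro m hm st' hF ⟨g1, g2⟩
      have e0 := hF.nat 0 (by simp [Cmd.WritesNat, selectTop, buildTree, replayCmd, accum,
        extract, climb])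
      have e11 := hF.nat 11 (by simp [Cmd.WritesNat, selectTop, buildTree, replayCmd, accum,
        extract, climb])
      have e16 := hF.nat 16 (by simp [Cmd.WritesNat, selectTop, buildTree, replayCmd, accum,
        extract, climb])
      set u := (st'.putNat 30 0 0 m).tick 1 with hu
      have u0 : u.nat 0 = st.nat 0 := by funext i j; simp [hu, e0]
      have u11 : u.nat 11 = st.nat 11 := by funext i j; simp [hu, e11]
      have u16 : u.nat 16 = st.nat 16 := by funext i j; simp [hu, e16]
      have u12 : u.nat 12 = st'.nat 12 := by funext i j; simp [hu]
      have u30 : u.nat 30 0 0 = m := by simp [hu]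
      have ur : u.real = st'.real := rfl
      have uT : u.time = st'.time + 1 := rfl
      clear_value u
      have S := selectTop_spec ω u (n := n) (C := m) (by rw [u0, h.n_eq]) u30 hn
        (by unfold HalfOk; rwa [u11, u16]) (by rw [u0, h.s_eq]; exact hs)
      simp only [u0, h.s_eq, ur, u12, u16, g1 m le_rfl] at S
      obtain ⟨S1, S2, S3, S4, S5, S6⟩ := S
      refine ⟨⟨fun c hc => ?_, fun c hc => ?_⟩, ?_⟩
      · rw [(S5 c (by omega)).2.2, g1 c (by omega)]
      · rcases Nat.lt_succ_iff_lt_or_eq.mp hc with hc | rfl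
        · have := S5 c hc.ne
          rw [this.1, this.2.1]
          exact g2 c hc
        · exact ⟨S1, S2, S3, S4⟩
      · omega)
  have FL := frame_exec ω (.loop 30 (.lit 2) selectTop) st
  set s1 := Cmd.exec ω (.loop 30 (.lit 2) selectTop) st
  clear_value s1
  have n1 : ∀ a, a = 0 ∨ a = 3 ∨ a = 28 → s1.nat a = st.nat a := by
    rintro a (rfl | rfl | rfl) <;>
      exact FL.nat _ (by simp [Cmd.WritesNat, selectTop, buildTree, replayCmd, accum,
        extract, climb])
  obtain ⟨⟨-, Lg⟩, LT⟩ := Lp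
  simp only [NExp.eval, NExp.cost] at Lg LT
  obtain ⟨A1, A2, A3, A4⟩ := Lg 0 (by simp)
  obtain ⟨B1, B2, B3, B4⟩ := Lg 1 (by simp)
  obtain ⟨C0, c01, c02, c03⟩ := exists_finset_of_list (s1.nat 12 0) A1 A2
  obtain ⟨C1, c11, c12, c13⟩ := exists_finset_of_list (s1.nat 12 1) B1 B2
  have top0 : ∀ S : Finset (Fin n), S.card = s → ∑ j ∈ S, x j ≤ ∑ j ∈ C0, x j := by
    intro S hS
    refine sum_le_sum_of_top x C0 S (by rw [hS, c01]) fun a ha b hb => ?_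
    obtain ⟨i, hi, hia⟩ := (c02 a).mp ha
    have := A3 i hi b b.2 (fun i' hi' he => hb ((c02 b).mpr ⟨i', hi', he⟩))
    rwa [hia, h0, h0] at this
  have top1 : ∀ S : Finset (Fin n), S.card = s → ∑ j ∈ S, -x j ≤ ∑ j ∈ C1, -x j := by
    intro S hS
    refine sum_le_sum_of_top (fun j => -x j) C1 S (by rw [hS, c11]) fun a ha b hb => ?_
    obtain ⟨i, hi, hia⟩ := (c12 a).mp ha
    have := B3 i hi b b.2 (fun i' hi' he => hb ((c12 b).mpr ⟨i', hi', he⟩))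
    rwa [hia, h1, h1] at this
  have v0 : s1.real 10 0 0 = ∑ j ∈ C0, x j := by
    rw [A4, c03 (st.real 5 0)]
    exact Finset.sum_congr rfl fun j _ => h0 j
  have v1 : s1.real 10 1 0 = ∑ j ∈ C1, -x j := by
    rw [B4, c13 (st.real 5 1)]
    exact Finset.sum_congr rfl fun j _ => h1 j
  set s2 := Cmd.exec ω (.ite _ _ _) s1 with hs2
  have hs2' : ∃ c : ℕ, s2.nat 33 0 0 = c ∧ (∀ a, a ≠ 33 → s2.nat a = s1.nat a) ∧
      s2.time ≤ s1.time + 20 ∧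
      ((c = 0 ∧ s1.real 10 1 0 < s1.real 10 0 0) ∨ (c = 1 ∧ s1.real 10 0 0 ≤ s1.real 10 1 0)) := by
    have hF := frame_exec ω (.ite (.realLt (.get 10 (.lit 1) (.lit 0)) (.get 10 (.lit 0) (.lit 0)))
      (.setNat 33 (.lit 0) (.lit 0) (.lit 0)) (.setNat 33 (.lit 0) (.lit 0) (.lit 1))) s1
    rw [← hs2] at hF
    refine ⟨_, rfl, fun a ha => hF.nat a (by simp [Cmd.WritesNat, ha]), ?_, ?_⟩
    · rw [hs2, Cmd.exec]
      split_ifs <;> simp [Cmd.exec, Test.cost, RExp.cost, NExp.cost]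
    · rw [hs2, Cmd.exec]
      split_ifs with hc
      · left
        simpa [Test.holds, RExp.eval, NExp.eval, Cmd.exec] using hc
      · right
        simpa [Test.holds, RExp.eval, NExp.eval, Cmd.exec] using hc
  clear_value s2
  obtain ⟨c, hc, n2, t2, hch⟩ := hs2'
  have e0 : s2.nat 0 = st.nat 0 := by rw [n2 0 (by simp), n1 0 (by simp)]
  have e3 : s2.nat 3 = st.nat 3 := by rw [n2 3 (by simp), n1 3 (by simp)]
  have e28 : s2.nat 28 = st.nat 28 := by rw [n2 28 (by simp), n1 28 (by simp)]
  have e12 : s2.nat 12 = s1.nat 12 := n2 12 (by simp)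
  have W := loop_rule (ω := ω) (x := 25) (e := inp 3)
    (c := .setNat 3 (var 28) (var 25) (.get 12 (var 33) (var 25))) (st := s2)
    (fun m st' => (∀ i < m, st'.nat 3 (st.nat 28 0 0) i = s1.nat 12 c i) ∧
      ∀ i, i ≠ st.nat 28 0 0 → st'.nat 3 i = st.nat 3 i) 30 (by simp [e3]) (by
      intro m hm st' hF ⟨g1, g2⟩
      have f28 := hF.nat 28 (by simp [Cmd.WritesNat])
      have f33 := hF.nat 33 (by simp [Cmd.WritesNat])
      have f12 := hF.nat 12 (by simp [Cmd.WritesNat])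
      refine ⟨⟨fun i hi => ?_, fun i hi => ?_⟩, ?_⟩
      · rcases Nat.lt_succ_iff_lt_or_eq.mp hi with hi | rfl
        · simp [Cmd.exec, f28, e28, hi.ne, g1 i hi]
        · simp [Cmd.exec, NExp.eval, f28, e28, f33, f12, hc, e12]
      · funext j
        simp [Cmd.exec, f28, e28, hi, g2 i hi]
      · simp [Cmd.exec, NExp.cost])
  rw [eval_inp, e0, h.s_eq] at W
  obtain ⟨⟨W1, W2⟩, WT⟩ := W
  set s3 := Cmd.exec ω (.loop 25 _ _) s2
  clear_value s3
  have htime : s3.time ≤ st.time + 120 + n * (450 + 120 * st.nat 16 0 0) := by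
    have k1 : s * (75 + st.nat 16 0 0 * 60) ≤ n * (75 + st.nat 16 0 0 * 60) :=
      Nat.mul_le_mul_right _ hs
    have k2 : n * (450 + 120 * st.nat 16 0 0) =
      2 * (n * (75 + st.nat 16 0 0 * 60)) + n * 300 := by ring
    simp only [cost_inp] at WT
    omega
  rcases hch with ⟨rfl, hlt⟩ | ⟨rfl, hle⟩
  · refine ⟨C0, c01, fun S hS => ?_, fun j => ?_, fun i hi => ?_, W2, htime⟩
    · have t0 := top0 S hS
      have t1 := top1 S hS
      rw [v0, v1] at hlt
      rw [Finset.sum_neg_distrib] at t1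
      refine (abs_le.mpr ⟨?_, ?_⟩).trans (le_abs_self _) <;> linarith
    · rw [c02]
      exact exists_congr fun i => and_congr_right fun hi => by rw [W1 i hi]
    · rw [W1 i hi]; exact A1 i hi
  · refine ⟨C1, c11, fun S hS => ?_, fun j => ?_, fun i hi => ?_, W2, htime⟩
    · have t0 := top0 S hS
      have t1 := top1 S hS
      rw [v0, v1] at hle
      rw [Finset.sum_neg_distrib, Finset.sum_neg_distrib] at t1
      rw [Finset.sum_neg_distrib] at hle
      refine (abs_le.mpr ⟨?_, ?_⟩).trans (neg_le_abs _) <;> linarith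
    · rw [c12]
      exact exists_congr fun i => and_congr_right fun hi => by rw [W1 i hi]
    · rw [W1 i hi]; exact B1 i hi

end

end RealRAM

/-! ### The whole program -/

namespace RealRAM

open LatentSimplex

/-- One round of the algorithm; variable 28 is the number of the round. -/
def roundCmd : Cmd := .seq dirCmd (.seq valuesCmd (.seq pickCmd removeCmd))

/-- The program for Algorithm LKS. -/
def lksCmd : Cmd :=
  .seq (.setNat 32 (.lit 0) (.lit 0) (.lit 1))
  (.seq halfTable
  (.seq drawAll
  (.seq powerAll
  (.seq orthAll (.loop 28 (inp 2) roundCmd)))))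

section

variable {d n : ℕ} {A : Matrix (Fin d) (Fin n) ℝ} {k s t : ℕ}
  {e : Fin (nnz A) ≃ {q : Fin d × Fin n // A q.1 q.2 ≠ 0}}

lemma removeCmd_spec (ω : ℕ → ℝ) {st : State} (h : Loaded A k s t e st) (hs : s ≤ n)
    (C : Finset (Fin n)) (hCs : C.card = s) (hC0 : s ≠ 0)
    (hC : ∀ j : Fin n, j ∈ C ↔ ∃ i < s, st.nat 3 (st.nat 28 0 0) i = j)
    (hrk : st.nat 28 0 0 ≤ k) {U : Submodule ℝ (EuclideanSpace ℝ (Fin d))}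
    (hU : ∀ x, U.starProjection x =
      ∑ i ∈ Finset.range k, lineProj (vec d (st.real 2 i)) x -
        ∑ i ∈ Finset.range (st.nat 28 0 0), lineProj (vec d (st.real 7 i)) x) :
    vec d ((removeCmd.exec ω st).real 7 (st.nat 28 0 0)) =
      U.starProjection ((s : ℝ) • avg A C) ∧
    (∀ i, i ≠ st.nat 28 0 0 → (removeCmd.exec ω st).real 7 i = st.real 7 i) ∧
    (removeCmd.exec ω st).time ≤
      st.time + 40 + 60 * (n + d + nnz A) + 2 * (k * (23 + 92 * d)) := by
  classical
  rw [removeCmd, Cmd.exec, Cmd.exec, Cmd.exec]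
  have Z := zeroRow_spec ω (x := 25) (a := 9) (r := 31) (len := inp 0) st (by simp)
  have F := frame_exec ω (mapRow 25 9 31 (inp 0) (.lit 0)) st
  set s1 := (mapRow 25 9 31 (inp 0) (.lit 0)).exec ω st
  clear_value s1
  have n1 : ∀ a, a ≠ 25 → s1.nat a = st.nat a := fun a ha => F.nat a (by
    simp [mapRow, Cmd.WritesNat, ha])
  have r1 : ∀ a, a ≠ 9 → s1.real a = st.real a := fun a ha => F.real a (by
    simp [mapRow, Cmd.WritesReal, ha])
  simp only [h.zero, eval_inp, h.n_eq, cost_inp] at Z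
  have I := loop_rule (ω := ω) (x := 25) (e := inp 3)
    (c := .setReal 9 (.lit 0) (.get 3 (var 28) (var 25)) (.lit 1)) (st := s1)
    (fun m st' => ∀ q < n, st'.real 9 0 q =
      if ∃ i < m, st.nat 3 (st.nat 28 0 0) i = q then 1 else 0) 20
    (by intro q hq; simp [Z.1 q hq]) (by
      intro m hm st' hF g
      have f28 := hF.nat 28 (by simp [Cmd.WritesNat])
      have f3 := hF.nat 3 (by simp [Cmd.WritesNat])
      refine ⟨fun q hq => ?_, ?_⟩
      · have hex : (∃ i ≤ m, st.nat 3 (st.nat 28 0 0) i = q) ↔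
            (q = st.nat 3 (st.nat 28 0 0) m ∨ ∃ i < m, st.nat 3 (st.nat 28 0 0) i = q) := by
          constructor
          · rintro ⟨i, hi, rfl⟩
            rcases hi.lt_or_eq with hi | rfl
            · exact Or.inr ⟨i, hi, rfl⟩
            · exact Or.inl rfl
          · rintro (rfl | ⟨i, hi, rfl⟩)
            · exact ⟨m, le_rfl, rfl⟩
            · exact ⟨i, hi.le, rfl⟩
        by_cases hq' : q = st.nat 3 (st.nat 28 0 0) m
        · simp only [Cmd.exec, NExp.eval, RExp.eval, Order.lt_add_one_iff, hex]
          simp [f28, f3, n1, hq']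
        · simp only [Cmd.exec, NExp.eval, RExp.eval, Order.lt_add_one_iff, hex]
          simp [f28, f3, n1, hq', g q hq]
      · simp [Cmd.exec, NExp.cost, RExp.cost])
  have FI := frame_exec ω (.loop 25 (inp 3)
    (.setReal 9 (.lit 0) (.get 3 (var 28) (var 25)) (.lit 1))) s1
  set s2 := Cmd.exec ω (.loop 25 (inp 3) _) s1
  clear_value s2
  have n2 : ∀ a, a ≠ 25 → s2.nat a = st.nat a := fun a ha => by
    rw [FI.nat a (by simp [Cmd.WritesNat, ha]), n1 a ha]
  have r2 : ∀ a, a ≠ 9 → s2.real a = st.real a := fun a ha => by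
    rw [FI.real a (by simp [Cmd.WritesReal, ha]), r1 a ha]
  rw [eval_inp, n1 0 (by simp), h.s_eq, cost_inp] at I
  have h2 : Loaded A k s t e s2 := h.of_eq (n2 _ (by simp)) (n2 _ (by simp)) (n2 _ (by simp))
    (n2 _ (by simp)) (r2 _ (by simp))
  have N := mulN_spec ω (da := 6) (dr := 31) (sa := 9) (sr := 31) h2 (by simp) (by simp)
    (by simp) (by simp)
  rw [h2.zero] at N
  have FN := frame_exec ω (mulN 6 31 9 31) s2
  set s3 := (mulN 6 31 9 31).exec ω s2
  clear_value s3
  have n3 : ∀ a, a ≠ 25 → s3.nat a = st.nat a := fun a ha => by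
    rw [FN.nat a (by simp [mulN, mapRow, scatter, Cmd.WritesNat, ha]), n2 a ha]
  have r3 : ∀ a, a ≠ 9 → a ≠ 6 → s3.real a = st.real a := fun a ha hb => by
    rw [FN.real a (by simp [mulN, mapRow, scatter, Cmd.WritesReal, hb]), r2 a ha]
  have h3 : Loaded A k s t e s3 := h.of_eq (n3 _ (by simp)) (n3 _ (by simp)) (n3 _ (by simp))
    (n3 _ (by simp)) (r3 _ (by simp) (by simp))
  have hvec : vec d (s3.real 6 0) = (s : ℝ) • avg A C := by
    have hs0 : (s : ℝ) ≠ 0 := Nat.cast_ne_zero.mpr hC0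
    refine vec_ext fun i => ?_
    rw [avg, hCs, smul_smul, mul_inv_cancel₀ hs0, one_smul, N.1]
    have : ∀ j : Fin n, A i j * s2.real 9 0 j = if j ∈ C then A i j else 0 := by
      intro j
      rw [I.1 j j.2]
      by_cases hj : j ∈ C
      · rw [if_pos ((hC j).mp hj), if_pos hj, mul_one]
      · rw [if_neg (fun h' => hj ((hC j).mpr h')), if_neg hj, mul_zero]
    simp only [this]
    rw [Finset.sum_ite_mem, Finset.univ_inter]
    simp [col]
  have P := projectCmd_spec ω (da := 7) (dr := 28) (sa := 6) h3 (by simp) (by simp) (by simp)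
    (by simp) (by simp) (by simp) (by simp) (Or.inr le_rfl) (by rwa [n3 28 (by simp)])
    (U := U) (by
      intro x
      rw [r3 2 (by simp) (by simp), r3 7 (by simp) (by simp), n3 28 (by simp)]
      exact hU x)
  rw [n3 28 (by simp), hvec, r3 7 (by simp) (by simp)] at P
  refine ⟨P.1, P.2.1, ?_⟩
  have t1 := Z.2.2
  have t2 := I.2
  have t3 := N.2.2
  have t4 := P.2.2
  omega

/-- What holds after `m` rounds. -/
structure RoundInv (A : Matrix (Fin d) (Fin n) ℝ) (k s t : ℕ)
    (e : Fin (nnz A) ≃ {q : Fin d × Fin n // A q.1 q.2 ≠ 0}) (ω : ℕ → ℝ) (lg m : ℕ) (st : State)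
    (R : Fin k → Finset (Fin n)) : Prop where
  loaded : Loaded A k s t e st
  half : HalfOk n st
  levels : st.nat 16 0 0 = lg
  one : st.nat 32 0 0 = 1
  pos : st.pos = (k + m) * d
  basis : ∀ x, (stepSpace A t ω R 0).starProjection x =
    ∑ i ∈ Finset.range k, lineProj (vec d (st.real 2 i)) x
  card : ∀ i : Fin k, (i : ℕ) < m → (R i).card = s
  best : ∀ i : Fin k, (i : ℕ) < m → ∀ S : Finset (Fin n), S.card = s →
    |inner ℝ (roundDir A t ω R i) (avg A S)| ≤ |inner ℝ (roundDir A t ω R i) (avg A (R i))|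
  out : ∀ i : Fin k, (i : ℕ) < m → ∀ j : Fin n, j ∈ R i ↔ ∃ q < s, st.nat 3 i q = j
  removed : ∀ i : Fin k, (i : ℕ) < m →
    vec d (st.real 7 i) = (stepSpace A t ω R i).starProjection ((s : ℝ) • avg A (R i))

lemma RoundInv.starProjection {ω : ℕ → ℝ} {lg m : ℕ} {st : State} {R : Fin k → Finset (Fin n)}
    (h : RoundInv A k s t e ω lg m st R) (hs : s ≠ 0) (hm : m ≤ k) :
    ∀ x, (stepSpace A t ω R m).starProjection x =
      ∑ i ∈ Finset.range k, lineProj (vec d (st.real 2 i)) x -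
        ∑ i ∈ Finset.range m, lineProj (vec d (st.real 7 i)) x := by
  have key : ∀ i ≤ m, ∀ x, (stepSpace A t ω R i).starProjection x =
      ∑ i ∈ Finset.range k, lineProj (vec d (st.real 2 i)) x -
        ∑ i ∈ Finset.range i, lineProj (vec d (st.real 7 i)) x := by
    intro i
    induction i with
    | zero => intro _ x; simp [h.basis]
    | succ i ih =>
      intro hi x
      have h1 := stepSpace_succ A t ω R ⟨i, by omega⟩
      simp only at h1
      have h2 := h.removed ⟨i, by omega⟩ (by simp only; omega)
      simp only at h2
      rw [h1, starProjection_inf_orthogonal_singleton, Finset.sum_range_succ, ih (by omega) x, h2,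
        lineProj_starProjection_eq _ (Nat.cast_ne_zero.mpr hs)]
      abel
  exact key m le_rfl

lemma roundDir_congr {ω : ℕ → ℝ} {R R' : Fin k → Finset (Fin n)} {r : Fin k}
    (hR : ∀ i, i < r → R i = R' i) : roundDir A t ω R r = roundDir A t ω R' r := by
  have : roundSpace A t ω R r = roundSpace A t ω R' r :=
    stepSpace_congr A t (fun _ => rfl) fun i hi => hR i hi
  simp only [roundDir, this]

lemma inner_roundDir_avg {ω : ℕ → ℝ} {R : Fin k → Finset (Fin n)} {r : Fin k}
    (S : Finset (Fin n)) (hS : S.card = s) :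
    |inner ℝ (roundDir A t ω R r) (avg A S)| =
      ‖(roundSpace A t ω R r).starProjection (gaussVec ω d (k + r))‖⁻¹ * (s : ℝ)⁻¹ *
        |∑ j ∈ S, inner ℝ ((roundSpace A t ω R r).starProjection (gaussVec ω d (k + r)))
          (col A j)| := by
  rw [roundDir, avg, hS, inner_smul_left, inner_smul_right, inner_sum, abs_mul, abs_mul,
    ← mul_assoc]
  congr 2
  · simp
  · exact abs_of_nonneg (by positivity)

lemma roundCmd_spec (ω : ℕ → ℝ) {lg m : ℕ} {st st₀ : State} {R : Fin k → Finset (Fin n)}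
    (h : RoundInv A k s t e ω lg m st₀ R) (hst : st = (st₀.putNat 28 0 0 m).tick 1) (hm : m < k)
    (hn : 1 ≤ n) (hs0 : s ≠ 0) (hs : s ≤ n) :
    (∃ R', RoundInv A k s t e ω lg (m + 1) (roundCmd.exec ω st) R') ∧
    (roundCmd.exec ω st).time ≤ st.time + 300 + 600 * (n + d + nnz A) + 4 * (k * (23 + 92 * d)) +
      120 * (n * lg) := by
  have hL : Loaded A k s t e st := by subst hst; exact h.loaded.of_eq rfl rfl rfl rfl rfl
  have hH : HalfOk n st := by subst hst; exact h.half
  have h28 : st.nat 28 0 0 = m := by subst hst; simp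
  have h16 : st.nat 16 0 0 = lg := by subst hst; simp [h.levels]
  have h32 : st.nat 32 0 0 = 1 := by subst hst; simp [h.one]
  have h3 : st.nat 3 = st₀.nat 3 := by subst hst; funext i j; simp
  have hr : st.real = st₀.real := by subst hst; rfl
  have hpos : st.pos = (k + m) * d := by subst hst; exact h.pos
  clear hst
  have hU := h.starProjection hs0 hm.le
  set U := stepSpace A t ω R m with hUdef
  set g := gaussVec ω d (k + m) with hg
  rw [roundCmd, Cmd.exec, Cmd.exec, Cmd.exec]
  -- the random direction
  have FD := frame_exec ω dirCmd st
  have hdir : vec d ((dirCmd.exec ω st).real 4 0) = U.starProjection g ∧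
      (dirCmd.exec ω st).pos = (k + (m + 1)) * d ∧
      (dirCmd.exec ω st).time ≤ st.time + 30 + 20 * d + 2 * (k * (23 + 92 * d)) := by
    rw [dirCmd, Cmd.exec]
    have D := drawRow_spec ω (a := 3) (r := 31) st (by simp)
    have F := frame_exec ω (drawRow 3 31) st
    set v := (drawRow 3 31).exec ω st
    clear_value v
    have nv : ∀ a, a ≠ 25 → v.nat a = st.nat a := fun a ha => F.nat a (by
      simp [drawRow, Cmd.WritesNat, ha])
    have rv : ∀ a, a ≠ 3 → v.real a = st.real a := fun a ha => F.real a (by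
      simp [drawRow, Cmd.WritesReal, ha])
    have hLv : Loaded A k s t e v := hL.of_eq (nv _ (by simp)) (nv _ (by simp)) (nv _ (by simp))
      (nv _ (by simp)) (rv _ (by simp))
    rw [hL.zero, hL.d_eq, hpos] at D
    have hgv : vec d (v.real 3 0) = g := vec_ext fun i => by rw [D.1 i i.2]; rfl
    have P := projectCmd_spec ω (da := 4) (dr := 31) (sa := 3) hLv (by simp) (by simp) (by simp)
      (by simp) (by simp) (by simp) (by simp) (Or.inl (by simp))
      (by rw [nv 28 (by simp), h28]; exact hm.le) (U := U) (by
        intro x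
        rw [rv 2 (by simp), rv 7 (by simp), nv 28 (by simp), h28, hr]
        exact hU x)
    rw [hLv.zero, hgv] at P
    have FP := frame_exec ω (projectCmd 4 31 3) v
    refine ⟨P.1, ?_, ?_⟩
    · rw [FP.pos (by simp [projectCmd, mapRow, addProj, accum, Cmd.Draws]), D.2.2.1]
      ring
    · have h1 := D.2.2.2
      have h2 := P.2.2
      omega
  set s1 := dirCmd.exec ω st
  clear_value s1
  obtain ⟨hw, hpos1, ht1⟩ := hdir
  have n1 : ∀ a, a ≠ 25 → a ≠ 27 → s1.nat a = st.nat a := fun a ha hb => FD.nat a (by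
    simp [dirCmd, projectCmd, mapRow, addProj, accum, drawRow, Cmd.WritesNat, ha, hb])
  have r1 : ∀ a, a ≠ 3 → a ≠ 4 → a ≠ 8 → s1.real a = st.real a := fun a ha hb hc => FD.real a (by
    simp [dirCmd, projectCmd, mapRow, addProj, accum, drawRow, Cmd.WritesReal, ha, hb, hc])
  have hL1 : Loaded A k s t e s1 := hL.of_eq (n1 _ (by simp) (by simp)) (n1 _ (by simp) (by simp))
    (n1 _ (by simp) (by simp)) (n1 _ (by simp) (by simp)) (r1 _ (by simp) (by simp) (by simp))
  -- the values
  have V := valuesCmd_spec ω hL1 (by rw [n1 32 (by simp) (by simp), h32])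
  rw [hw] at V
  have FV := frame_exec ω valuesCmd s1
  set s2 := valuesCmd.exec ω s1
  clear_value s2
  have n2 : ∀ a, a ≠ 25 → a ≠ 27 → s2.nat a = st.nat a := fun a ha hb => by
    rw [FV.nat a (by simp [valuesCmd, mulT, scatter, mapRow, Cmd.WritesNat, ha]), n1 a ha hb]
  have r2 : ∀ a, a ≠ 3 → a ≠ 4 → a ≠ 5 → a ≠ 8 → s2.real a = st.real a :=
    fun a ha hb hc hd => by
      rw [FV.real a (by simp [valuesCmd, mulT, scatter, mapRow, Cmd.WritesReal, hc]),
        r1 a ha hb hd]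
  have p2 : s2.pos = (k + (m + 1)) * d := by
    rw [FV.pos (by simp [valuesCmd, mulT, scatter, mapRow, Cmd.Draws]), hpos1]
  have hL2 : Loaded A k s t e s2 := hL.of_eq (n2 _ (by simp) (by simp)) (n2 _ (by simp) (by simp))
    (n2 _ (by simp) (by simp)) (n2 _ (by simp) (by simp))
    (r2 _ (by simp) (by simp) (by simp) (by simp))
  -- the choice of the set
  obtain ⟨C, hCs, hCbest, hCout, hClt, hCold, ht3⟩ := pickCmd_spec ω hL2 hn hs
    (by unfold HalfOk; rwa [n2 11 (by simp) (by simp), n2 16 (by simp) (by simp)]) _ V.1 V.2.1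
  have FP := frame_exec ω pickCmd s2
  set s3 := pickCmd.exec ω s2
  clear_value s3
  have n3 : ∀ a, a = 0 ∨ a = 1 ∨ a = 2 ∨ a = 11 ∨ a = 16 ∨ a = 28 ∨ a = 31 ∨ a = 32 →
      s3.nat a = st.nat a := by
    intro a ha
    rw [FP.nat a (by rcases ha with rfl | rfl | rfl | rfl | rfl | rfl | rfl | rfl <;>
      simp [pickCmd, selectTop, buildTree, replayCmd, accum, extract, climb, Cmd.WritesNat]),
      n2 a (by omega) (by omega)]
  have r3 : ∀ a, a = 0 ∨ a = 2 ∨ a = 7 → s3.real a = st.real a := by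
    intro a ha
    rw [FP.real a (by rcases ha with rfl | rfl | rfl <;>
      simp [pickCmd, selectTop, buildTree, replayCmd, accum, extract, climb, Cmd.WritesReal]),
      r2 a (by omega) (by omega) (by omega) (by omega)]
  have p3 : s3.pos = (k + (m + 1)) * d := by
    rw [FP.pos (by simp [pickCmd, selectTop, buildTree, replayCmd, accum, extract, climb,
      Cmd.Draws]), p2]
  have hL3 : Loaded A k s t e s3 := hL.of_eq (n3 _ (by simp)) (n3 _ (by simp)) (n3 _ (by simp))
    (n3 _ (by simp)) (r3 _ (by simp))
  rw [n2 28 (by simp) (by simp), h28] at hCout hCold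
  -- the new basis vector
  have Rm := removeCmd_spec ω hL3 hs C hCs hs0 (by rw [n3 28 (by simp), h28]; exact hCout)
    (by rw [n3 28 (by simp), h28]; exact hm.le) (U := U) (by
      intro x
      rw [r3 2 (by simp), r3 7 (by simp), n3 28 (by simp), h28, hr]
      exact hU x)
  have FR := frame_exec ω removeCmd s3
  set s4 := removeCmd.exec ω s3
  clear_value s4
  rw [n3 28 (by simp), h28, r3 7 (by simp), hr] at Rm
  have n4 : ∀ a, a ≠ 25 → a ≠ 27 → s4.nat a = s3.nat a := fun a ha hb => FR.nat a (by
    simp [removeCmd, mulN, scatter, projectCmd, mapRow, addProj, accum, Cmd.WritesNat, ha, hb])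
  have r4 : ∀ a, a = 0 ∨ a = 2 → s4.real a = st.real a := by
    intro a ha
    rw [FR.real a (by rcases ha with rfl | rfl <;>
      simp [removeCmd, mulN, scatter, projectCmd, mapRow, addProj, accum, Cmd.WritesReal]),
      r3 a (by omega)]
  have p4 : s4.pos = (k + (m + 1)) * d := by
    rw [FR.pos (by simp [removeCmd, mulN, scatter, projectCmd, mapRow, addProj, accum,
      Cmd.Draws]), p3]
  have n4' : ∀ a, a = 0 ∨ a = 1 ∨ a = 2 ∨ a = 11 ∨ a = 16 ∨ a = 31 ∨ a = 32 →
      s4.nat a = st.nat a := by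
    intro a ha
    rw [n4 a (by omega) (by omega), n3 a (by omega)]
  -- the invariant
  set R' : Fin k → Finset (Fin n) := Function.update R ⟨m, hm⟩ C with hR'
  have hRm : R' ⟨m, hm⟩ = C := Function.update_self _ _ _
  have hRlt : ∀ i : Fin k, (i : ℕ) < m → R' i = R i := fun i hi =>
    Function.update_of_ne (fun h => by rw [h] at hi; simp at hi) _ _
  have hstep : ∀ i ≤ m, stepSpace A t ω R' i = stepSpace A t ω R i := fun i hi =>
    stepSpace_congr A t (fun _ => rfl) fun j hj => hRlt j (by omega)
  have hdirR : ∀ i : Fin k, (i : ℕ) ≤ m → roundDir A t ω R' i = roundDir A t ω R i := fun i hi =>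
    roundDir_congr fun j hj => hRlt j (by have := Fin.lt_def.mp hj; omega)
  refine ⟨⟨R', ?_, ?_, ?_, ?_, p4, ?_, ?_, ?_, ?_, ?_⟩, ?_⟩
  · exact hL.of_eq (n4' _ (by simp)) (n4' _ (by simp)) (n4' _ (by simp)) (n4' _ (by simp))
      (r4 _ (by simp))
  · unfold HalfOk; rwa [n4' 11 (by simp), n4' 16 (by simp)]
  · rw [n4' 16 (by simp), h16]
  · rw [n4' 32 (by simp), h32]
  · intro x
    rw [hstep 0 (by omega), r4 2 (by simp), hr]
    exact h.basis x
  · intro i hi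
    rcases Nat.lt_succ_iff_lt_or_eq.mp hi with hi | hi
    · rw [hRlt i hi]; exact h.card i hi
    · obtain rfl : i = ⟨m, hm⟩ := Fin.ext hi
      rw [hRm, hCs]
  · intro i hi S hS
    rcases Nat.lt_succ_iff_lt_or_eq.mp hi with hi | hi
    · rw [hRlt i hi, hdirR i hi.le]; exact h.best i hi S hS
    · obtain rfl : i = ⟨m, hm⟩ := Fin.ext hi
      rw [hRm, hdirR _ le_rfl, inner_roundDir_avg S hS, inner_roundDir_avg C hCs]
      exact mul_le_mul_of_nonneg_left (hCbest S hS) (by positivity)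
  · intro i hi j
    rcases Nat.lt_succ_iff_lt_or_eq.mp hi with hi | hi
    · rw [hRlt i hi, n4 3 (by simp) (by simp), hCold i hi.ne, n2 3 (by simp) (by simp), h3]
      exact h.out i hi j
    · obtain rfl : i = ⟨m, hm⟩ := Fin.ext hi
      rw [hRm, n4 3 (by simp) (by simp)]
      exact hCout j
  · intro i hi
    rcases Nat.lt_succ_iff_lt_or_eq.mp hi with hi | hi
    · rw [hRlt i hi, Rm.2.1 i hi.ne, hstep i hi.le]
      exact h.removed i hi
    · obtain rfl : i = ⟨m, hm⟩ := Fin.ext hi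
      rw [hRm, hstep _ le_rfl]
      exact Rm.1
  · have t2 := V.2.2
    have t4 := Rm.2.2
    rw [n2 16 (by simp) (by simp), h16] at ht3
    have e1 : n * (450 + 120 * lg) = 450 * n + 120 * (n * lg) := by ring
    omega

theorem lksCmd_spec (ω : ℕ → ℝ) (hn : 1 ≤ n) (hs0 : s ≠ 0) (hs : s ≤ n) :
    ∃ R : Fin k → Finset (Fin n),
      Outputs (lksCmd.exec ω (input A k s t e)) s R ∧ IsLKSRun A s t ω R ∧
      ∃ lg, 2 ^ lg ≤ 4 * n ∧ (lksCmd.exec ω (input A k s t e)).time ≤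
        (200 + 130 * n) + k * (400 + 700 * (n + d + nnz A) + t * (21 + 40 * (n + d + 2 * nnz A)) +
          5 * (k * (23 + 92 * d)) + 120 * (n * lg)) := by
  rw [lksCmd, Cmd.exec, Cmd.exec, Cmd.exec, Cmd.exec, Cmd.exec]
  set st := input A k s t e with hst
  have hL : Loaded A k s t e st := loaded_input
  have hp : st.pos = 0 := rfl
  have ht : st.time = 0 := rfl
  clear_value st
  set s0 := Cmd.exec ω (.setNat 32 _ _ _) st with hs0'
  have a0 : ∀ a, a ≠ 32 → s0.nat a = st.nat a := by
    intro a ha; funext i j; simp [hs0', Cmd.exec, ha]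
  have hL0 : Loaded A k s t e s0 := hL.of_eq (a0 _ (by simp)) (a0 _ (by simp)) (a0 _ (by simp))
    (a0 _ (by simp)) rfl
  have one0 : s0.nat 32 0 0 = 1 := by simp [hs0', Cmd.exec, NExp.eval]
  have p0 : s0.pos = 0 := hp
  have t0 : s0.time = 4 := by simp [hs0', Cmd.exec, NExp.cost, ht]
  clear_value s0
  have H := halfTable_spec ω s0 (by rw [hL0.n_eq]; exact hn)
  rw [hL0.n_eq] at H
  have FH := frame_exec ω halfTable s0
  set s1 := halfTable.exec ω s0
  clear_value s1
  have hL1 : Loaded A k s t e s1 := hL0.of_frame FH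
    (by rintro a (rfl | rfl | rfl | rfl) <;> simp [halfTable, Cmd.WritesNat])
    (by simp [halfTable, Cmd.WritesReal])
  have one1 : s1.nat 32 0 0 = 1 := by rw [FH.nat 32 (by simp [halfTable, Cmd.WritesNat]), one0]
  have p1 : s1.pos = 0 := by rw [FH.pos (by simp [halfTable, Cmd.Draws]), p0]
  have D := drawAll_spec ω hL1 p1
  have FD := frame_exec ω drawAll s1
  set s2 := drawAll.exec ω s1
  clear_value s2
  have hL2 : Loaded A k s t e s2 := hL1.of_frame FD
    (by rintro a (rfl | rfl | rfl | rfl) <;> simp [drawAll, drawRow, Cmd.WritesNat])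
    (by simp [drawAll, drawRow, Cmd.WritesReal])
  have a2 : ∀ a, a = 11 ∨ a = 16 ∨ a = 32 → s2.nat a = s1.nat a := by
    rintro a (rfl | rfl | rfl) <;> exact FD.nat _ (by simp [drawAll, drawRow, Cmd.WritesNat])
  have Pw := powerAll_spec ω hL2
  have FPw := frame_exec ω powerAll s2
  set s3 := powerAll.exec ω s2
  clear_value s3
  have hL3 : Loaded A k s t e s3 := hL2.of_frame FPw
    (by rintro a (rfl | rfl | rfl | rfl) <;>
      simp [powerAll, powerStep, mulT, mulN, scatter, mapRow, Cmd.WritesNat])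
    (by simp [powerAll, powerStep, mulT, mulN, scatter, mapRow, Cmd.WritesReal])
  have a3 : ∀ a, a = 11 ∨ a = 16 ∨ a = 32 → s3.nat a = s1.nat a := by
    intro a ha
    rw [← a2 a ha]
    rcases ha with rfl | rfl | rfl <;>
      exact FPw.nat _ (by simp [powerAll, powerStep, mulT, mulN, scatter, mapRow, Cmd.WritesNat])
  have O := orthAll_spec ω hL3
  have FO := frame_exec ω orthAll s3
  set s4 := orthAll.exec ω s3
  clear_value s4
  have hL4 : Loaded A k s t e s4 := hL3.of_frame FO
    (by rintro a (rfl | rfl | rfl | rfl) <;>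
      simp [orthAll, addProj, accum, mapRow, Cmd.WritesNat])
    (by simp [orthAll, addProj, accum, mapRow, Cmd.WritesReal])
  have a4 : ∀ a, a = 11 ∨ a = 16 ∨ a = 32 → s4.nat a = s1.nat a := by
    intro a ha
    rw [← a3 a ha]
    rcases ha with rfl | rfl | rfl <;>
      exact FO.nat _ (by simp [orthAll, addProj, accum, mapRow, Cmd.WritesNat])
  have p4 : s4.pos = k * d := by
    rw [FO.pos (by simp [orthAll, addProj, accum, mapRow, Cmd.Draws]),
      FPw.pos (by simp [powerAll, powerStep, mulT, mulN, scatter, mapRow, Cmd.Draws]), D.2.1]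
  have hspan : ∀ R : Fin k → Finset (Fin n), stepSpace A t ω R 0 =
      Submodule.span ℝ ((fun j => vec d (s3.real 1 j)) '' {i | i < k}) := by
    intro R
    rw [stepSpace_zero, span_subspacePower]
    congr 1
    ext v
    simp only [Set.mem_range, Set.mem_image, Set.mem_ofPred_eq]
    constructor
    · rintro ⟨j, rfl⟩
      exact ⟨j, j.2, by rw [Pw.1 j j.2, D.1 j j.2]⟩
    · rintro ⟨j, hj, rfl⟩
      exact ⟨⟨j, hj⟩, by rw [Pw.1 j hj, D.1 j hj]⟩
  have Lp := loop_rule (ω := ω) (x := 28) (e := inp 2) (c := roundCmd) (st := s4)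
    (fun m st' => ∃ R, RoundInv A k s t e ω (s1.nat 16 0 0) m st' R)
    (301 + 600 * (n + d + nnz A) + 4 * (k * (23 + 92 * d)) + 120 * (n * s1.nat 16 0 0))
    (by
      refine ⟨fun _ => ∅, ⟨hL4.of_eq rfl rfl rfl rfl rfl, ?_, ?_, ?_, ?_, ?_, ?_, ?_, ?_, ?_⟩⟩
      · have := H.1
        unfold HalfOk at this ⊢
        rwa [State.tick_nat, a4 11 (by simp), a4 16 (by simp)]
      · rw [State.tick_nat, a4 16 (by simp)]
      · rw [State.tick_nat, a4 32 (by simp), one1]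
      · simp [p4]
      · intro x
        rw [hspan]
        exact O.1 x
      all_goals simp) (by
      intro m hm st' hF ⟨R, hR⟩
      rw [eval_inp, hL4.k_eq] at hm
      have := roundCmd_spec ω hR rfl hm hn hs0 hs
      refine ⟨this.1, this.2.trans ?_⟩
      simp only [State.tick_time, State.putNat_time]
      omega)
  rw [eval_inp, hL4.k_eq] at Lp
  set s5 := Cmd.exec ω (.loop 28 (inp 2) roundCmd) s4
  clear_value s5
  obtain ⟨⟨R, hR⟩, hT⟩ := Lp
  refine ⟨R, fun l j => hR.out l l.2 j, fun r => ⟨hR.card r r.2, hR.best r r.2⟩,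
    s1.nat 16 0 0, H.1.2.2, ?_⟩
  have t1 := H.2
  have t2 := D.2.2
  have t3 := Pw.2
  have t4 := O.2
  have k1 : k * (5 + 8 * d) + k * (5 + t * (21 + 40 * (n + d + 2 * nnz A))) +
      k * (9 + 15 * d + k * (23 + 92 * d)) +
      k * (301 + 600 * (n + d + nnz A) + 4 * (k * (23 + 92 * d)) + 120 * (n * s1.nat 16 0 0)) ≤
      k * (400 + 700 * (n + d + nnz A) + t * (21 + 40 * (n + d + 2 * nnz A)) +
          5 * (k * (23 + 92 * d)) + 120 * (n * s1.nat 16 0 0)) := by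
    rw [← Nat.mul_add, ← Nat.mul_add, ← Nat.mul_add]
    refine Nat.mul_le_mul_left _ ?_
    omega
  simp only [cost_inp] at hT
  omega

end

end RealRAM

/-! ### Consequences of the model assumptions -/

namespace LatentSimplex

open scoped Matrix.Norms.L2Operator

section

variable {d n k s : ℕ} {A P : Matrix (Fin d) (Fin n) ℝ} {M : Matrix (Fin d) (Fin k) ℝ} {α δ : ℝ}

/-- The assumptions on the model. -/
structure Model (A P : Matrix (Fin d) (Fin n) ℝ) (M : Matrix (Fin d) (Fin k) ℝ) (α δ : ℝ)
    (s : ℕ) : Prop where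
  two_le : 2 ≤ k
  n_pos : 0 < n
  δ_pos : 0 < δ
  s_eq : (s : ℝ) = δ * n
  α_pos : 0 < α
  α_lt : α < 1
  indep : LinearIndependent ℝ (col M)
  latent : LatentPoints M P
  separated : WellSeparated M α
  proximate : ProximateLatentPoints A P M δ s
  bounded : SpectrallyBounded A P M α δ

/-- The perturbation of averages over sets of cardinality `δ n`. -/
noncomputable def err (A P : Matrix (Fin d) (Fin n) ℝ) (δ : ℝ) : ℝ := sigma A P / √δ

/-- The length of the longest vertex. -/
noncomputable def size (M : Matrix (Fin d) (Fin k) ℝ) : ℝ := ⨆ l, ‖col M l‖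

lemma norm_col_le_size (M : Matrix (Fin d) (Fin k) ℝ) (l : Fin k) : ‖col M l‖ ≤ size M :=
  le_ciSup (Set.finite_range fun l => ‖col M l‖).bddAbove l

lemma toLp_mulVec_eq_sum (B : Matrix (Fin d) (Fin n) ℝ) (x : Fin n → ℝ) :
    (WithLp.toLp 2 (B.mulVec x) : EuclideanSpace ℝ (Fin d)) = ∑ j, x j • col B j := by
  ext i
  simp [Matrix.mulVec, dotProduct, col, mul_comm]

lemma norm_mulVec_le (B : Matrix (Fin d) (Fin n) ℝ) (x : EuclideanSpace ℝ (Fin n)) :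
    ‖(WithLp.toLp 2 (B.mulVec x) : EuclideanSpace ℝ (Fin d))‖ ≤ ‖B‖ * ‖x‖ :=
  Matrix.l2_opNorm_mulVec B x

lemma norm_mulVec_transpose_le (B : Matrix (Fin d) (Fin n) ℝ) (x : EuclideanSpace ℝ (Fin d)) :
    ‖(WithLp.toLp 2 (B.transpose.mulVec x) : EuclideanSpace ℝ (Fin n))‖ ≤ ‖B‖ * ‖x‖ := by
  have h := norm_mulVec_le B.transpose x
  rwa [← Matrix.conjTranspose_eq_transpose_of_trivial, Matrix.l2_opNorm_conjTranspose] at h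

/-- The coefficient vector of an average. -/
noncomputable def indic (n : ℕ) (S : Finset (Fin n)) : EuclideanSpace ℝ (Fin n) :=
  WithLp.toLp 2 fun j => if j ∈ S then (S.card : ℝ)⁻¹ else 0

lemma avg_eq_mulVec (B : Matrix (Fin d) (Fin n) ℝ) (S : Finset (Fin n)) :
    avg B S = WithLp.toLp 2 (B.mulVec (indic n S)) := by
  rw [toLp_mulVec_eq_sum, avg, Finset.smul_sum]
  simp [indic, ite_smul, Finset.sum_ite_mem]

lemma norm_indic (S : Finset (Fin n)) : ‖indic n S‖ = (√(S.card : ℝ))⁻¹ := by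
  rw [EuclideanSpace.norm_eq]
  simp only [indic, Real.norm_eq_abs, sq_abs, ite_pow, Finset.sum_ite_mem, Finset.univ_inter,
    ne_eq, OfNat.ofNat_ne_zero, not_false_eq_true, zero_pow, Finset.sum_const, nsmul_eq_mul]
  rw [← Real.sqrt_inv]
  congr 1
  rcases eq_or_ne (S.card : ℝ) 0 with h | h
  · simp [h]
  · field_simp

lemma avg_sub (A P : Matrix (Fin d) (Fin n) ℝ) (S : Finset (Fin n)) :
    avg A S - avg P S = avg (A - P) S := by
  simp only [avg_eq_mulVec, Matrix.sub_mulVec]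
  rfl

lemma norm_avg_sub_avg_le (A P : Matrix (Fin d) (Fin n) ℝ) (S : Finset (Fin n)) :
    ‖avg A S - avg P S‖ ≤ ‖A - P‖ / √(S.card : ℝ) := by
  rw [avg_sub, avg_eq_mulVec, div_eq_mul_inv, ← norm_indic]
  exact norm_mulVec_le _ _

lemma norm_avg_sub_le (B : Matrix (Fin d) (Fin n) ℝ) {S : Finset (Fin n)} (hS : S.Nonempty)
    (x : EuclideanSpace ℝ (Fin d)) {r : ℝ} (h : ∀ j ∈ S, ‖x - col B j‖ ≤ r) :
    ‖avg B S - x‖ ≤ r := by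
  have hc : (0 : ℝ) < S.card := by exact_mod_cast hS.card_pos
  have : avg B S - x = (S.card : ℝ)⁻¹ • ∑ j ∈ S, (col B j - x) := by
    rw [Finset.sum_sub_distrib, smul_sub, avg, Finset.sum_const, ← Nat.cast_smul_eq_nsmul ℝ,
      smul_smul, inv_mul_cancel₀ hc.ne', one_smul]
  rw [this, norm_smul, norm_inv, Real.norm_natCast, inv_mul_le_iff₀ hc]
  calc ‖∑ j ∈ S, (col B j - x)‖ ≤ ∑ j ∈ S, r := norm_sum_le_of_le _ fun j hj => by
        rw [norm_sub_rev]; exact h j hj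
    _ = S.card * r := by simp

/-- A convex combination of the vertices. -/
lemma exists_avg_eq (h : LatentPoints M P) {S : Finset (Fin n)} (hS : S.Nonempty) :
    ∃ w : Fin k → ℝ, (∀ l, 0 ≤ w l) ∧ ∑ l, w l = 1 ∧ avg P S = ∑ l, w l • col M l := by
  have hc : (0 : ℝ) < S.card := by exact_mod_cast hS.card_pos
  have h1 : avg P S ∈ convexHull ℝ (Set.range (col M)) := by
    rw [avg, Finset.smul_sum]
    refine (convex_convexHull ℝ _).sum_mem (fun _ _ => by positivity) ?_ fun j _ => h j
    simp [hc.ne']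
  have h2 : convexHull ℝ (Set.range (col M)) ⊆
      Fintype.linearCombination ℝ (col M) '' stdSimplex ℝ (Fin k) := by
    refine convexHull_min ?_ ((convex_stdSimplex ℝ _).linear_image _)
    rintro _ ⟨l, rfl⟩
    exact ⟨Pi.single l 1, single_mem_stdSimplex ℝ l, by simp⟩
  obtain ⟨w, ⟨hw, hw1⟩, hx⟩ := h2 h1
  exact ⟨w, hw, hw1, by rw [← hx, Fintype.linearCombination_apply]⟩

namespace Model

lemma k_pos (h : Model A P M α δ s) : 0 < k := by have := h.two_le; omega

lemma k_cast (h : Model A P M α δ s) : (2 : ℝ) ≤ k := by exact_mod_cast h.two_le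

lemma s_pos (h : Model A P M α δ s) : 0 < s := by
  have h1 : (0 : ℝ) < s := by
    rw [h.s_eq]
    exact mul_pos h.δ_pos (by exact_mod_cast h.n_pos)
  exact_mod_cast h1

lemma s_cast_pos (h : Model A P M α δ s) : (0 : ℝ) < s := by exact_mod_cast h.s_pos

lemma s_le (h : Model A P M α δ s) : s ≤ n := by
  obtain ⟨S, hS, -⟩ := h.proximate ⟨0, h.k_pos⟩
  rw [← hS]
  simpa using S.card_le_univ

lemma δ_le_one (h : Model A P M α δ s) : δ ≤ 1 := by
  have h1 : (s : ℝ) ≤ n := by exact_mod_cast h.s_le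
  have h2 : (0 : ℝ) < n := by exact_mod_cast h.n_pos
  rw [h.s_eq] at h1
  nlinarith

lemma k_le_d (h : Model A P M α δ s) : k ≤ d := by
  simpa using h.indep.fintype_card_le_finrank

lemma err_nonneg (_ : Model A P M α δ s) : 0 ≤ err A P δ := by
  unfold err sigma; positivity

lemma norm_sub_div_sqrt (h : Model A P M α δ s) : ‖A - P‖ / √(s : ℝ) = err A P δ := by
  rw [h.s_eq, err, sigma, Real.sqrt_mul h.δ_pos.le, div_div, mul_comm]

lemma norm_sub_eq (h : Model A P M α δ s) : ‖A - P‖ = err A P δ * √(s : ℝ) := by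
  rw [← h.norm_sub_div_sqrt, div_mul_cancel₀ _ (Real.sqrt_pos.mpr h.s_cast_pos).ne']

lemma norm_avg_sub_avg_le (h : Model A P M α δ s) {S : Finset (Fin n)} (hS : S.card = s) :
    ‖avg A S - avg P S‖ ≤ err A P δ := by
  rw [← h.norm_sub_div_sqrt, ← hS]
  exact LatentSimplex.norm_avg_sub_avg_le A P S

/-- Sets of latent points near the vertices. -/
lemma exists_near (h : Model A P M α δ s) : ∃ S : Fin k → Finset (Fin n), ∀ l, (S l).card = s ∧
    ∀ T ⊆ S l, T.Nonempty → ‖avg P T - col M l‖ ≤ 4 * err A P δ := by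
  choose S hS using h.proximate
  refine ⟨S, fun l => ⟨(hS l).1, fun T hT hT0 => norm_avg_sub_le P hT0 _ fun j hj => ?_⟩⟩
  rw [err, ← mul_div_assoc]
  exact (hS l).2 j (hT hj)

lemma exists_norm_col_eq_size (h : Model A P M α δ s) : ∃ l, ‖col M l‖ = size M := by
  have : Nonempty (Fin k) := ⟨⟨0, h.k_pos⟩⟩
  exact exists_eq_ciSup_of_finite

lemma size_pos (h : Model A P M α δ s) : 0 < size M :=
  lt_of_lt_of_le (norm_pos_iff.mpr (h.indep.ne_zero ⟨0, h.k_pos⟩)) (norm_col_le_size M _)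

lemma le_norm_sum (h : Model A P M α δ s) (c : Fin k → ℝ) (l : Fin k) :
    |c l| * (α * size M) ≤ ‖∑ i, c i • col M i‖ := by
  obtain ⟨l', hl'⟩ := h.exists_norm_col_eq_size
  set U := Submodule.span ℝ (col M '' {m | m ≠ l})
  have h1 : Uᗮ.starProjection (∑ i, c i • col M i) = c l • Uᗮ.starProjection (col M l) := by
    rw [map_sum, Finset.sum_eq_single l]
    · simp
    · intro i _ hi
      have : col M i ∈ Uᗮᗮ := Submodule.le_orthogonal_orthogonal _
        (Submodule.subset_span ⟨i, hi, rfl⟩)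
      rw [map_smul, (Submodule.starProjection_apply_eq_zero_iff _).mpr this, smul_zero]
    · simp
  calc |c l| * (α * size M) ≤ |c l| * ‖Uᗮ.starProjection (col M l)‖ := by
        rw [← hl']
        exact mul_le_mul_of_nonneg_left (h.separated l l') (abs_nonneg _)
    _ = ‖Uᗮ.starProjection (∑ i, c i • col M i)‖ := by rw [h1, norm_smul, Real.norm_eq_abs]
    _ ≤ _ := Submodule.norm_starProjection_apply_le _ _

lemma err_le (h : Model A P M α δ s) (l : Fin k) :
    err A P δ ≤ α ^ 3 * ‖col M l‖ / (4500 * (k : ℝ) ^ 9) := h.bounded l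

lemma err_le_size (h : Model A P M α δ s) :
    err A P δ ≤ α ^ 3 * size M / (4500 * (k : ℝ) ^ 9) := by
  obtain ⟨l, hl⟩ := h.exists_norm_col_eq_size
  rw [← hl]; exact h.err_le l

/-- At least half of the columns near a vertex are nonzero. -/
lemma s_le_nnz (h : Model A P M α δ s) : s ≤ 2 * nnz A := by
  classical
  obtain ⟨S, hS⟩ := h.exists_near
  let l : Fin k := ⟨0, h.k_pos⟩
  obtain ⟨hc, hT⟩ := hS l
  set Z := (S l).filter fun j => col A j = 0
  set N := (S l).filter fun j => ¬ col A j = 0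
  have hZN : Z.card + N.card = s := by rw [← hc]; exact Finset.card_filter_add_card_filter_not _
  have hN : N.card ≤ nnz A := by
    have hex : ∀ j : N, ∃ i, A i j ≠ 0 := by
      rintro ⟨j, hj⟩
      by_contra hcon
      push Not at hcon
      refine (Finset.mem_filter.mp hj).2 ?_
      ext i
      simpa [col] using hcon i
    choose f hf using hex
    rw [nnz, ← Nat.card_eq_finsetCard]
    refine Nat.card_le_card_of_injective
      (fun j : N => (⟨(f j, j), hf j⟩ : {q : Fin d × Fin n // A q.1 q.2 ≠ 0})) ?_
    intro j j' hjj
    simp only [Subtype.mk.injEq, Prod.mk.injEq] at hjj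
    exact Subtype.ext hjj.2
  by_contra hlt
  have hZs : s < 2 * Z.card := by omega
  have hZ0 : Z.Nonempty := by rw [← Finset.card_pos]; omega
  have hA : avg A Z = 0 := by
    rw [avg, Finset.sum_eq_zero (fun j hj => (Finset.mem_filter.mp hj).2), smul_zero]
  have h1 := LatentSimplex.norm_avg_sub_avg_le A P Z
  have h2 := hT Z (Finset.filter_subset _ _) hZ0
  have hZs' : (s : ℝ) ≤ 4 * Z.card := by exact_mod_cast (by omega : s ≤ 4 * Z.card)
  have hZp : 0 < √(Z.card : ℝ) := Real.sqrt_pos.mpr (by exact_mod_cast hZ0.card_pos)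
  have h3 : ‖A - P‖ / √(Z.card : ℝ) ≤ 2 * err A P δ := by
    rw [div_le_iff₀ hZp, h.norm_sub_eq]
    have : √(s : ℝ) ≤ 2 * √(Z.card : ℝ) := by
      refine (Real.sqrt_le_sqrt hZs').trans_eq ?_
      rw [Real.sqrt_mul (by norm_num), show (4 : ℝ) = 2 ^ 2 by norm_num,
        Real.sqrt_sq (by norm_num)]
    nlinarith [h.err_nonneg]
  have h4 : ‖col M l‖ ≤ 6 * err A P δ := by
    rw [hA, zero_sub, norm_neg] at h1
    calc ‖col M l‖ = ‖avg P Z - (avg P Z - col M l)‖ := by congr 1; abel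
      _ ≤ ‖avg P Z‖ + ‖avg P Z - col M l‖ := norm_sub_le _ _
      _ ≤ 6 * err A P δ := by linarith
  have h5 := h.err_le l
  have hM : 0 < ‖col M l‖ := norm_pos_iff.mpr (h.indep.ne_zero l)
  have h6 : α ^ 3 * ‖col M l‖ / (4500 * (k : ℝ) ^ 9) ≤ ‖col M l‖ / 4500 := by
    have : α ^ 3 ≤ 1 := pow_le_one₀ h.α_pos.le h.α_lt.le
    have hk : (1 : ℝ) ≤ (k : ℝ) ^ 9 := one_le_pow₀ (by linarith [h.k_cast])
    rw [div_le_div_iff₀ (by positivity) (by norm_num)]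
    nlinarith [mul_le_mul this hk (by norm_num) (by norm_num)]
  linarith

end Model

end

end LatentSimplex

/-! ### Subspace power iteration -/

namespace LatentSimplex

section

variable {E ι : Type*} [NormedAddCommGroup E] [InnerProductSpace ℝ E]
  [Fintype ι] (b : OrthonormalBasis ι ℝ E)

lemma norm_sq_eq_sum_coords (x : E) : ‖x‖ ^ 2 = ∑ i, inner ℝ (b i) x ^ 2 := by
  rw [← b.sum_sq_norm_inner_right x]
  simp

lemma norm_le_of_coords {x y : E} {C : ℝ} (hC : 0 ≤ C)
    (h : ∀ i, |inner ℝ (b i) x| ≤ C * |inner ℝ (b i) y|) : ‖x‖ ≤ C * ‖y‖ := by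
  refine le_of_sq_le_sq ?_ (by positivity)
  rw [mul_pow, norm_sq_eq_sum_coords b, norm_sq_eq_sum_coords b, Finset.mul_sum]
  refine Finset.sum_le_sum fun i _ => ?_
  rw [← sq_abs, ← sq_abs (inner ℝ (b i) y), ← mul_pow]
  exact pow_le_pow_left₀ (abs_nonneg _) (h i) 2

lemma inner_sum_coords [DecidableEq ι] (H : Finset ι) (f : ι → ℝ) (i : ι) :
    inner ℝ (b i) (∑ j ∈ H, f j • b j) = if i ∈ H then f i else 0 := by
  simp [inner_sum, inner_smul_right, b.inner_eq_ite]

lemma inner_starProjection_coords [FiniteDimensional ℝ E] [DecidableEq ι] (H : Finset ι) (x : E) (i : ι) :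
    inner ℝ (b i) ((Submodule.span ℝ (b '' H)).starProjection x) =
      if i ∈ H then inner ℝ (b i) x else 0 := by
  have : (Submodule.span ℝ (b '' H)).starProjection x = ∑ j ∈ H, inner ℝ (b j) x • b j := by
    refine Submodule.eq_starProjection_of_mem_orthogonal ?_ ?_
    · exact Submodule.sum_mem _ fun j hj => Submodule.smul_mem _ _
        (Submodule.subset_span ⟨j, hj, rfl⟩)
    · rw [Submodule.mem_orthogonal]
      intro u hu
      induction hu using Submodule.span_induction with
      | mem u hu =>
        obtain ⟨j, hj, rfl⟩ := hu
        have hj' : j ∈ H := hj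
        rw [inner_sub_right, inner_sum_coords, if_pos hj', sub_self]
      | zero => simp
      | add u v _ _ hu hv => rw [inner_add_left, hu, hv, add_zero]
      | smul c u _ hu => rw [inner_smul_left, hu, mul_zero]
  rw [this, inner_sum_coords]

lemma finrank_span_coords (H : Finset ι) :
    Module.finrank ℝ (Submodule.span ℝ (b '' H)) = H.card := by
  classical
  have hl : LinearIndependent ℝ fun i : H => b i :=
    b.orthonormal.linearIndependent.comp _ Subtype.val_injective
  have hr : Set.range (fun i : H => b i) = b '' H := by
    ext x; simp
  rw [← hr, finrank_span_eq_card hl, Fintype.card_coe]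

lemma inner_pow_apply {B : E →ₗ[ℝ] E} {v : ι → ℝ}
    (hB : ∀ i x, inner ℝ (b i) (B x) = v i * inner ℝ (b i) x) (t : ℕ) (i : ι) (x : E) :
    inner ℝ (b i) ((B ^ t) x) = v i ^ t * inner ℝ (b i) x := by
  induction t with
  | zero => simp
  | succ t ih => rw [pow_succ', Module.End.mul_apply, hB, ih, pow_succ']; ring

/-- Convergence of subspace power iteration in the presence of a spectral gap. -/
theorem exists_mem_span_pow_near [FiniteDimensional ℝ E] {k : ℕ} {B : E →ₗ[ℝ] E} {v : ι → ℝ}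
    (hB : ∀ i x, inner ℝ (b i) (B x) = v i * inner ℝ (b i) x) (H : Finset ι) (hH : H.card = k)
    {L θ ε G : ℝ} (hL : 0 < L) (hθ : 0 ≤ θ) (hε : 0 < ε) (hvL : ∀ i ∈ H, L ≤ v i)
    (hv0 : ∀ i ∉ H, 0 ≤ v i) (hvθ : ∀ i ∉ H, v i ≤ θ) (g : Fin k → E)
    (hg : ∀ (c : Fin k → ℝ) (j : Fin k),
      |c j| * ε ≤ ‖∑ i, c i • (Submodule.span ℝ (b '' H)).starProjection (g i)‖)
    (hG : ∀ j, ‖g j‖ ≤ G) (t : ℕ) (y : E) :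
    ∃ x ∈ Submodule.span ℝ (Set.range fun j => (B ^ t) (g j)),
      ‖y - x‖ ≤ ‖y - (Submodule.span ℝ (b '' H)).starProjection y‖ +
        (θ / L) ^ t * (k * G / ε) * ‖y‖ := by
  classical
  set W := Submodule.span ℝ (b '' H) with hW
  let T : (Fin k → ℝ) →ₗ[ℝ] W :=
    Fintype.linearCombination ℝ fun i => ⟨W.starProjection (g i), W.starProjection_apply_mem _⟩
  have hT : ∀ c, ((T c : W) : E) = ∑ i, c i • W.starProjection (g i) := fun c => by
    simp [T, Fintype.linearCombination_apply]
  have hinj : Function.Injective T := by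
    rw [← LinearMap.ker_eq_bot, LinearMap.ker_eq_bot']
    intro c hc
    ext j
    have h1 := hg c j
    rw [← hT, hc] at h1
    simp only [ZeroMemClass.coe_zero, norm_zero] at h1
    have h2 : |c j| ≤ 0 := nonpos_of_mul_nonpos_left h1 hε
    simpa using h2
  have hsurj : Function.Surjective T :=
    (LinearMap.injective_iff_surjective_of_finrank_eq_finrank (by
      rw [Module.finrank_fin_fun, hW, finrank_span_coords, hH])).mp hinj
  set z := ∑ i ∈ H, ((v i ^ t)⁻¹ * inner ℝ (b i) y) • b i with hz
  have hzW : z ∈ W := Submodule.sum_mem _ fun j hj => Submodule.smul_mem _ _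
    (Submodule.subset_span ⟨j, hj, rfl⟩)
  obtain ⟨c, hc⟩ := hsurj ⟨z, hzW⟩
  have hcz : ∑ i, c i • W.starProjection (g i) = z := by rw [← hT, hc]
  have hvp : ∀ i ∈ H, 0 < v i := fun i hi => hL.trans_le (hvL i hi)
  have hzn : ‖z‖ ≤ (L ^ t)⁻¹ * ‖y‖ := by
    refine norm_le_of_coords b (by positivity) fun i => ?_
    rw [hz, inner_sum_coords]
    split_ifs with hi
    · rw [abs_mul, abs_of_pos (inv_pos.mpr (pow_pos (hvp i hi) t))]
      gcongr
      exact hvL i hi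
    · simp only [abs_zero]; positivity
  have hcj : ∀ j, |c j| ≤ (L ^ t)⁻¹ * ‖y‖ / ε := fun j => by
    rw [le_div_iff₀ hε]
    exact (hg c j).trans (hcz ▸ hzn)
  refine ⟨∑ j, c j • (B ^ t) (g j), Submodule.sum_mem _ fun j _ => Submodule.smul_mem _ _
    (Submodule.subset_span ⟨j, rfl⟩), ?_⟩
  set x := ∑ j, c j • (B ^ t) (g j) with hx
  have hxi : ∀ i, inner ℝ (b i) x = v i ^ t * ∑ j, c j * inner ℝ (b i) (g j) := fun i => by
    rw [hx, inner_sum, Finset.mul_sum]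
    refine Finset.sum_congr rfl fun j _ => ?_
    rw [inner_smul_right, inner_pow_apply b hB]; ring
  have hWx : W.starProjection x = W.starProjection y := by
    refine InnerProductSpace.ext_inner_left_basis b.toBasis fun i => ?_
    rw [OrthonormalBasis.coe_toBasis, inner_starProjection_coords, inner_starProjection_coords]
    split_ifs with hi
    · have h1 : ∑ j, c j * inner ℝ (b i) (g j) = (v i ^ t)⁻¹ * inner ℝ (b i) y := by
        have h2 := congrArg (inner ℝ (b i)) hcz
        rw [hz, inner_sum_coords, if_pos hi, inner_sum] at h2
        rw [← h2]
        refine Finset.sum_congr rfl fun j _ => ?_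
        rw [inner_smul_right, inner_starProjection_coords, if_pos hi]
      rw [hxi, h1, mul_inv_cancel_left₀ (pow_pos (hvp i hi) t).ne']
    · rfl
  have hres : ∀ j, ‖(B ^ t) (g j) - W.starProjection ((B ^ t) (g j))‖ ≤ θ ^ t * ‖g j‖ := fun j => by
    refine norm_le_of_coords b (by positivity) fun i => ?_
    rw [inner_sub_right, inner_starProjection_coords]
    split_ifs with hi
    · simp only [sub_self, abs_zero]; positivity
    · rw [sub_zero, inner_pow_apply b hB, abs_mul, abs_of_nonneg (pow_nonneg (hv0 i hi) t)]
      gcongr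
      · exact hv0 i hi
      · exact hvθ i hi
  have hxr : ‖x - W.starProjection x‖ ≤ (θ / L) ^ t * (k * G / ε) * ‖y‖ := by
    have h1 : x - W.starProjection x =
        ∑ j, c j • ((B ^ t) (g j) - W.starProjection ((B ^ t) (g j))) := by
      simp only [hx, map_sum, map_smul, smul_sub, Finset.sum_sub_distrib]
    rw [h1]
    calc _ ≤ ∑ j : Fin k, (L ^ t)⁻¹ * ‖y‖ / ε * (θ ^ t * G) := norm_sum_le_of_le _ fun j _ => by
          rw [norm_smul, Real.norm_eq_abs]
          refine mul_le_mul (hcj j) ((hres j).trans ?_) (norm_nonneg _) (by positivity)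
          exact mul_le_mul_of_nonneg_left (hG j) (by positivity)
      _ = _ := by
          rw [Finset.sum_const, Finset.card_univ, Fintype.card_fin, nsmul_eq_mul, div_pow]
          ring
  calc ‖y - x‖ = ‖(y - W.starProjection y) - (x - W.starProjection x)‖ := by
        rw [hWx]; congr 1; abel
    _ ≤ _ := (norm_sub_le _ _).trans (add_le_add_right hxr _)

end

section

variable {d n k s : ℕ} {A P : Matrix (Fin d) (Fin n) ℝ} {M : Matrix (Fin d) (Fin k) ℝ} {α δ : ℝ}

lemma inner_toLp_mulVec (A : Matrix (Fin d) (Fin n) ℝ) (x : EuclideanSpace ℝ (Fin d))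
    (z : EuclideanSpace ℝ (Fin n)) :
    inner ℝ x (WithLp.toLp 2 (A.mulVec z)) =
      inner ℝ (WithLp.toLp 2 (A.transpose.mulVec x)) z := by
  simp only [EuclideanSpace.inner_eq_star_dotProduct, star_trivial]
  rw [dotProduct_comm, Matrix.mulVec_transpose, Matrix.dotProduct_mulVec, dotProduct_comm]

lemma inner_gramMap (A : Matrix (Fin d) (Fin n) ℝ) (x y : EuclideanSpace ℝ (Fin d)) :
    inner ℝ x (gramMap A y) = inner ℝ (WithLp.toLp 2 (A.transpose.mulVec x))
      (WithLp.toLp 2 (A.transpose.mulVec y) : EuclideanSpace ℝ (Fin n)) := by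
  rw [gramMap_apply, ← inner_toLp_mulVec]

/-- An orthonormal basis of eigenvectors of the Gram matrix. -/
lemma exists_gram_eigenbasis (A : Matrix (Fin d) (Fin n) ℝ) :
    ∃ (b : OrthonormalBasis (Fin d) ℝ (EuclideanSpace ℝ (Fin d))) (v : Fin d → ℝ),
      (∀ i x, inner ℝ (b i) (gramMap A x) = v i * inner ℝ (b i) x) ∧ ∀ i, 0 ≤ v i := by
  have hs : (gramMap A).IsSymmetric := fun x y => by
    rw [inner_gramMap, real_inner_comm, inner_gramMap, real_inner_comm]
  have hd : Module.finrank ℝ (EuclideanSpace ℝ (Fin d)) = d := by simp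
  refine ⟨hs.eigenvectorBasis hd, hs.eigenvalues hd, ?_, ?_⟩
  · intro i x
    rw [← hs, hs.apply_eigenvectorBasis, inner_smul_left]
    simp
  · intro i
    have h1 : inner ℝ (hs.eigenvectorBasis hd i) (gramMap A (hs.eigenvectorBasis hd i)) =
        hs.eigenvalues hd i := by
      rw [hs.apply_eigenvectorBasis, inner_smul_right]
      simp
    rw [← h1, inner_gramMap]
    exact real_inner_self_nonneg

end

end LatentSimplex

/-! ### The span of the power iteration is near the vertices -/

namespace LatentSimplex

open scoped Matrix.Norms.L2Operator

namespace Model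

variable {d n k s : ℕ} {A P : Matrix (Fin d) (Fin n) ℝ} {M : Matrix (Fin d) (Fin k) ℝ} {α δ : ℝ}

lemma err_le_mul (h : Model A P M α δ s) :
    4500 * (k : ℝ) ^ 9 * err A P δ ≤ α ^ 3 * size M := by
  have h1 := h.err_le_size
  have hk : (0 : ℝ) < k := by linarith [h.k_cast]
  rw [le_div_iff₀ (by positivity)] at h1
  linarith

/-- A crude form of the bound on the perturbation. -/
lemma k_mul_err_le (h : Model A P M α δ s) :
    4500 * 256 * (k * err A P δ) ≤ α * size M := by
  have h1 := h.err_le_mul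
  have hk := h.k_cast
  have h2 : (256 : ℝ) * k ≤ (k : ℝ) ^ 9 := by
    have : (2 : ℝ) ^ 8 ≤ (k : ℝ) ^ 8 := pow_le_pow_left₀ (by norm_num) hk 8
    calc (256 : ℝ) * k = 2 ^ 8 * k := by norm_num
      _ ≤ (k : ℝ) ^ 8 * k := by gcongr
      _ = _ := by ring
  have h3 : α ^ 3 ≤ α := by
    have h4 := h.α_pos; have h5 := h.α_lt
    calc α ^ 3 = α * α ^ 2 := by ring
      _ ≤ α * 1 := by gcongr; exact pow_le_one₀ h4.le h5.le
      _ = α := mul_one α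
  have h6 := h.err_nonneg
  have h7 := h.size_pos
  calc 4500 * 256 * (k * err A P δ) = 4500 * (256 * k) * err A P δ := by ring
    _ ≤ 4500 * (k : ℝ) ^ 9 * err A P δ := by gcongr
    _ ≤ α ^ 3 * size M := h1
    _ ≤ _ := by gcongr

/-- Averages of columns near the vertices. -/
lemma exists_near_avg (h : Model A P M α δ s) : ∃ S : Fin k → Finset (Fin n), ∀ l,
    (S l).card = s ∧ ‖avg A (S l) - col M l‖ ≤ 5 * err A P δ := by
  obtain ⟨S, hS⟩ := h.exists_near
  refine ⟨S, fun l => ⟨(hS l).1, ?_⟩⟩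
  have h1 := (hS l).2 _ subset_rfl (by rw [← Finset.card_pos, (hS l).1]; exact h.s_pos)
  have h2 := h.norm_avg_sub_avg_le (hS l).1
  calc _ = ‖(avg A (S l) - avg P (S l)) + (avg P (S l) - col M l)‖ := by congr 1; abel
    _ ≤ _ := norm_add_le_of_le h2 h1
    _ = _ := by ring

lemma col_mem_span (h : Model A P M α δ s) (j : Fin n) :
    col P j ∈ Submodule.span ℝ (Set.range (col M)) :=
  convexHull_min Submodule.subset_span (Submodule.convex _) (h.latent j)

/-- Vectors orthogonal to the vertices are short after multiplication by `Aᵀ`. -/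
lemma norm_transpose_le_of_orthogonal (h : Model A P M α δ s) {x : EuclideanSpace ℝ (Fin d)}
    (hx : ∀ l, inner ℝ (col M l) x = 0) :
    ‖(WithLp.toLp 2 (A.transpose.mulVec x) : EuclideanSpace ℝ (Fin n))‖ ≤ ‖A - P‖ * ‖x‖ := by
  have h1 : P.transpose.mulVec x = 0 := by
    funext j
    have h2 : ∀ y ∈ Submodule.span ℝ (Set.range (col M)), inner ℝ y x = 0 := fun y hy => by
      induction hy using Submodule.span_induction with
      | mem u hu => obtain ⟨l, rfl⟩ := hu; exact hx l
      | zero => simp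
      | add u v _ _ hu hv => rw [inner_add_left, hu, hv, add_zero]
      | smul c u _ hu => rw [inner_smul_left, hu, mul_zero]
    have h3 := h2 _ (h.col_mem_span j)
    rw [EuclideanSpace.inner_eq_star_dotProduct, star_trivial, dotProduct_comm] at h3
    exact h3
  have h4 : A.transpose.mulVec x = (A - P).transpose.mulVec x := by
    rw [Matrix.transpose_sub, Matrix.sub_mulVec, h1, sub_zero]
  rw [h4]
  exact norm_mulVec_transpose_le _ _

/-- The number of large eigenvalues. -/
lemma card_large_le (h : Model A P M α δ s)
    (b : OrthonormalBasis (Fin d) ℝ (EuclideanSpace ℝ (Fin d))) {v : Fin d → ℝ}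
    (hb : ∀ i x, inner ℝ (b i) (gramMap A x) = v i * inner ℝ (b i) x) (H : Finset (Fin d))
    (hH : ∀ i ∈ H, ‖A - P‖ ^ 2 < v i) : H.card ≤ k := by
  by_contra hlt
  push Not at hlt
  let W := Submodule.span ℝ (b '' H)
  let T : W →ₗ[ℝ] (Fin k → ℝ) :=
    LinearMap.pi fun l => (innerₗ _ (col M l)).comp W.subtype
  have hker : LinearMap.ker T ≠ ⊥ := LinearMap.ker_ne_bot_of_finrank_lt (by
    rw [finrank_span_coords, Module.finrank_fin_fun]; exact hlt)
  obtain ⟨⟨x, hxW⟩, hx, hx0⟩ := Submodule.exists_mem_ne_zero_of_ne_bot hker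
  have hx0' : x ≠ 0 := fun h0 => hx0 (Subtype.ext h0)
  have h1 := h.norm_transpose_le_of_orthogonal (x := x) fun l => congrFun hx l
  have h2 : ‖(WithLp.toLp 2 (A.transpose.mulVec x) : EuclideanSpace ℝ (Fin n))‖ ^ 2 =
      ∑ i, v i * inner ℝ (b i) x ^ 2 := by
    rw [← real_inner_self_eq_norm_sq, ← inner_gramMap, ← b.sum_inner_mul_inner]
    refine Finset.sum_congr rfl fun i _ => ?_
    rw [hb, real_inner_comm]; ring
  have hxc : ∀ i ∉ H, inner ℝ (b i) x = 0 := fun i hi => by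
    have h3 := inner_starProjection_coords b H x i
    rwa [Submodule.starProjection_eq_self_iff.mpr hxW, if_neg hi] at h3
  have h3 : ‖A - P‖ ^ 2 * ‖x‖ ^ 2 < ∑ i, v i * inner ℝ (b i) x ^ 2 := by
    rw [norm_sq_eq_sum_coords b, Finset.mul_sum]
    have hle : ∀ i, ‖A - P‖ ^ 2 * inner ℝ (b i) x ^ 2 ≤ v i * inner ℝ (b i) x ^ 2 := fun i => by
      by_cases hi : i ∈ H
      · exact mul_le_mul_of_nonneg_right (hH i hi).le (sq_nonneg _)
      · rw [hxc i hi]; simp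
    obtain ⟨i, hi⟩ : ∃ i, inner ℝ (b i) x ≠ 0 := by
      by_contra hcon
      push Not at hcon
      exact hx0' (norm_eq_zero.mp (pow_eq_zero_iff two_ne_zero |>.mp (by
        rw [norm_sq_eq_sum_coords b]; simp [hcon])))
    refine Finset.sum_lt_sum (fun i _ => hle i) ⟨i, Finset.mem_univ i, ?_⟩
    have hiH : i ∈ H := by by_contra hiH; exact hi (hxc i hiH)
    exact mul_lt_mul_of_pos_right (hH i hiH) (by positivity)
  rw [← h2, ← mul_pow] at h3
  exact absurd (pow_le_pow_left₀ (norm_nonneg _) h1 2) (not_le.mpr h3)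

/-- There are at least `k` eigenvalues of the order of the square of the vertices. -/
lemma le_card_large (h : Model A P M α δ s)
    (b : OrthonormalBasis (Fin d) ℝ (EuclideanSpace ℝ (Fin d))) {v : Fin d → ℝ}
    (hb : ∀ i x, inner ℝ (b i) (gramMap A x) = v i * inner ℝ (b i) x) (H : Finset (Fin d))
    (hH : ∀ i ∉ H, v i ≤ (α * size M / (2 * k)) ^ 2 * s) : k ≤ H.card := by
  by_contra hlt
  push Not at hlt
  obtain ⟨S, hS⟩ := h.exists_near_avg
  have hk := h.k_cast
  have hm := h.size_pos
  have hα := h.α_pos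
  let T : (Fin k → ℝ) →ₗ[ℝ] (H → ℝ) := LinearMap.pi fun i =>
    (innerₗ _ (b i)).comp (Fintype.linearCombination ℝ fun l => avg A (S l))
  have hker : LinearMap.ker T ≠ ⊥ := LinearMap.ker_ne_bot_of_finrank_lt (by simpa using hlt)
  obtain ⟨c, hc, hc0⟩ := Submodule.exists_mem_ne_zero_of_ne_bot hker
  have hcn : 0 < ‖c‖ := norm_pos_iff.mpr hc0
  set y := ∑ l, c l • avg A (S l) with hy
  have hyH : ∀ i ∈ H, inner ℝ (b i) y = 0 := fun i hi => by
    have := congrFun hc ⟨i, hi⟩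
    rw [hy, inner_sum]
    simpa [T, Fintype.linearCombination_apply, inner_sum, inner_smul_right] using this
  set z := ∑ l, c l • indic n (S l) with hz
  have hyz : y = WithLp.toLp 2 (A.mulVec z) := by
    rw [hy, hz]
    simp only [avg_eq_mulVec, WithLp.ofLp_sum, WithLp.ofLp_smul, Matrix.mulVec_sum,
      Matrix.mulVec_smul, WithLp.toLp_sum, WithLp.toLp_smul]
  have hcl : ∀ l, |c l| ≤ ‖c‖ := fun l => norm_le_pi_norm c l
  have hzn : ‖z‖ ≤ k * ‖c‖ / √(s : ℝ) := by
    calc ‖z‖ ≤ ∑ l : Fin k, ‖c‖ * (√(s : ℝ))⁻¹ := norm_sum_le_of_le _ fun l _ => by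
          rw [norm_smul, norm_indic, (hS l).1, Real.norm_eq_abs]
          exact mul_le_mul_of_nonneg_right (hcl l) (by positivity)
      _ = _ := by simp; ring
  have hyn : ‖c‖ * (α * size M / 2) < ‖y‖ := by
    have hne : Nonempty (Fin k) := ⟨⟨0, h.k_pos⟩⟩
    obtain ⟨l, hl⟩ := Finite.exists_max fun l => |c l|
    have hcl' : ‖c‖ ≤ |c l| := (pi_norm_le_iff_of_nonneg (abs_nonneg _)).mpr hl
    have h1 := h.le_norm_sum c l
    have h2 : ‖y - ∑ i, c i • col M i‖ ≤ k * ‖c‖ * (5 * err A P δ) := by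
      rw [hy, ← Finset.sum_sub_distrib]
      calc _ ≤ ∑ l : Fin k, ‖c‖ * (5 * err A P δ) := norm_sum_le_of_le _ fun l _ => by
            rw [← smul_sub, norm_smul, Real.norm_eq_abs]
            exact mul_le_mul (hcl l) (hS l).2 (norm_nonneg _) (norm_nonneg _)
        _ = _ := by simp; ring
    have h3 : ‖∑ i, c i • col M i‖ ≤ ‖y‖ + ‖y - ∑ i, c i • col M i‖ := by
      calc _ = ‖y - (y - ∑ i, c i • col M i)‖ := by congr 1; abel
        _ ≤ _ := norm_sub_le _ _
    have h4 := h.k_mul_err_le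
    have h5 : ‖c‖ * (α * size M) ≤ |c l| * (α * size M) := by gcongr
    have h6 : 0 < α * size M := by positivity
    have h7 : k * ‖c‖ * (5 * err A P δ) < ‖c‖ * (α * size M / 2) := by
      have : 5 * (k * err A P δ) < α * size M / 2 := by linarith
      calc _ = ‖c‖ * (5 * (k * err A P δ)) := by ring
        _ < _ := by gcongr
    linarith
  set L := (α * size M / (2 * k)) ^ 2 * s with hL
  have h1 : ‖(WithLp.toLp 2 (A.transpose.mulVec y) : EuclideanSpace ℝ (Fin n))‖ ^ 2 ≤
      L * ‖y‖ ^ 2 := by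
    rw [← real_inner_self_eq_norm_sq, ← inner_gramMap, ← b.sum_inner_mul_inner,
      norm_sq_eq_sum_coords b, Finset.mul_sum]
    refine Finset.sum_le_sum fun i _ => ?_
    rw [hb, real_inner_comm]
    by_cases hi : i ∈ H
    · rw [hyH i hi]; simp
    · nlinarith [mul_le_mul_of_nonneg_right (hH i hi) (sq_nonneg (inner ℝ (b i) y))]
  have h2 : ‖y‖ ^ 2 ≤ ‖(WithLp.toLp 2 (A.transpose.mulVec y) : EuclideanSpace ℝ (Fin n))‖ * ‖z‖ := by
    rw [← real_inner_self_eq_norm_sq]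
    nth_rw 2 [hyz]
    rw [inner_toLp_mulVec]
    exact real_inner_le_norm _ _
  have hy0 : 0 < ‖y‖ := lt_of_le_of_lt (by positivity) hyn
  have hs := h.s_cast_pos
  have hss : 0 < √(s : ℝ) := Real.sqrt_pos.mpr hs
  have h3 : ‖(WithLp.toLp 2 (A.transpose.mulVec y) : EuclideanSpace ℝ (Fin n))‖ ≤
      α * size M / (2 * k) * √(s : ℝ) * ‖y‖ := by
    refine le_of_sq_le_sq (h1.trans_eq ?_) (by positivity)
    rw [hL, mul_pow, mul_pow, Real.sq_sqrt hs.le]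
  have h4 : ‖y‖ ^ 2 ≤ α * size M / (2 * k) * √(s : ℝ) * ‖y‖ * (k * ‖c‖ / √(s : ℝ)) :=
    h2.trans (mul_le_mul h3 hzn (norm_nonneg _) (by positivity))
  have h5 : α * size M / (2 * k) * √(s : ℝ) * ‖y‖ * (k * ‖c‖ / √(s : ℝ)) =
      ‖c‖ * (α * size M / 2) * ‖y‖ := by
    field_simp
  rw [h5, pow_two] at h4
  exact absurd (le_of_mul_le_mul_right h4 hy0) (not_le.mpr hyn)

/-- The power of the spectral gap. -/
lemma ratio_pow_le (h : Model A P M α δ s) {t : ℕ} (ht : 1 ≤ t) (hlog : Real.log d ≤ t) :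
    (‖A - P‖ ^ 2 / ((α * size M / (2 * k)) ^ 2 * s)) ^ t ≤ α / (1000 * k ^ 5 * d) := by
  have hk := h.k_cast
  have hk0 : (0 : ℝ) < k := by linarith
  have hm := h.size_pos
  have hα := h.α_pos
  have hs := h.s_cast_pos
  have he := h.err_nonneg
  have hd : (2 : ℝ) ≤ d := hk.trans (by exact_mod_cast h.k_le_d)
  have hθ : ‖A - P‖ ^ 2 = err A P δ ^ 2 * s := by
    rw [h.norm_sub_eq, mul_pow, Real.sq_sqrt hs.le]
  set ρ := ‖A - P‖ ^ 2 / ((α * size M / (2 * k)) ^ 2 * s) with hρ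
  have hρ0 : 0 ≤ ρ := by positivity
  have hρ1 : ρ ≤ α / (1000 * k ^ 5) * (1 / 3) := by
    have h1 := h.err_le_mul
    have hk5 : (1 : ℝ) ≤ (k : ℝ) ^ 11 := one_le_pow₀ (by linarith)
    have h2 : ρ * (4500 * (k : ℝ) ^ 9 / (2 * k)) ^ 2 ≤ α ^ 4 := by
      have h3 : ρ = (2 * k * err A P δ / (α * size M)) ^ 2 := by
        rw [hρ, hθ]; field_simp
      rw [h3, ← mul_pow, show α ^ 4 = (α ^ 2) ^ 2 by ring]
      refine pow_le_pow_left₀ (by positivity) ?_ 2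
      calc _ = 4500 * (k : ℝ) ^ 9 * err A P δ / (α * size M) := by field_simp
        _ ≤ α ^ 3 * size M / (α * size M) := by gcongr
        _ = α ^ 2 := by field_simp
    have h4 : α ^ 4 ≤ α := by
      calc α ^ 4 = α * α ^ 3 := by ring
        _ ≤ α * 1 := by gcongr; exact pow_le_one₀ hα.le h.α_lt.le
        _ = α := mul_one α
    have h5 : (4500 * (k : ℝ) ^ 9 / (2 * k)) ^ 2 = 5062500 * k ^ 5 * k ^ 11 := by
      field_simp; ring
    rw [h5] at h2
    rw [div_mul_div_comm, mul_one, le_div_iff₀ (by positivity)]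
    calc ρ * (1000 * k ^ 5 * 3) ≤ ρ * (5062500 * k ^ 5 * k ^ 11) := by
          gcongr ρ * ?_
          nlinarith [mul_le_mul_of_nonneg_left hk5 (by positivity : (0 : ℝ) ≤ (k : ℝ) ^ 5)]
      _ ≤ _ := h2.trans h4
  have hA : α / (1000 * (k : ℝ) ^ 5) ≤ 1 := by
    rw [div_le_one (by positivity)]
    have : (1 : ℝ) ≤ (k : ℝ) ^ 5 := one_le_pow₀ (by linarith)
    linarith [h.α_lt]
  have he3 : (1 / 3 : ℝ) ^ t ≤ 1 / d := by
    have h1 : (1 / 3 : ℝ) ≤ Real.exp (-1) := by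
      rw [Real.exp_neg, ← one_div]
      exact one_div_le_one_div_of_le (Real.exp_pos 1) (by linarith [Real.exp_one_lt_d9])
    calc (1 / 3 : ℝ) ^ t ≤ Real.exp (-1) ^ t := by gcongr
      _ = Real.exp (-t) := by rw [← Real.exp_nat_mul]; simp
      _ ≤ Real.exp (-Real.log d) := Real.exp_le_exp.mpr (by linarith)
      _ = _ := by rw [Real.exp_neg, Real.exp_log (by linarith), one_div]
  calc ρ ^ t ≤ (α / (1000 * k ^ 5) * (1 / 3)) ^ t := by gcongr
    _ = (α / (1000 * k ^ 5)) ^ t * (1 / 3) ^ t := mul_pow _ _ _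
    _ ≤ α / (1000 * k ^ 5) * (1 / d) := by
        gcongr
        exact pow_le_of_le_one (by positivity) hA (by omega)
    _ = _ := by field_simp

/-- With a suitable start, the span of the power iteration comes near every vertex. -/
theorem exists_start_subspace (h : Model A P M α δ s) :
    ∃ W : Submodule ℝ (EuclideanSpace ℝ (Fin d)), Module.finrank ℝ W = k ∧
      ∀ g : Fin k → EuclideanSpace ℝ (Fin d),
        (∀ (c : Fin k → ℝ) (j : Fin k),
          |c j| * (1 / (k : ℝ) ^ 2) ≤ ‖∑ i, c i • W.starProjection (g i)‖) →
        (∀ j, ‖g j‖ ≤ k * √(d : ℝ)) → ∀ t : ℕ, 1 ≤ t → Real.log d ≤ t →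
        ∀ l, ∃ x ∈ Submodule.span ℝ (Set.range fun j => (gramMap A ^ t) (g j)),
          ‖col M l - x‖ ≤ α * size M / (100 * k) := by
  obtain ⟨b, v, hb, hv⟩ := exists_gram_eigenbasis A
  classical
  set H := Finset.univ.filter fun i => ‖A - P‖ ^ 2 < v i with hH
  set K := Finset.univ.filter fun i => (α * size M / (2 * k)) ^ 2 * s < v i with hK
  have hk := h.k_cast
  have hk0 : (0 : ℝ) < k := by linarith
  have hm := h.size_pos
  have hα := h.α_pos
  have hs := h.s_cast_pos
  have he := h.err_nonneg
  have hθ : ‖A - P‖ ^ 2 = err A P δ ^ 2 * s := by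
    rw [h.norm_sub_eq, mul_pow, Real.sq_sqrt hs.le]
  have hke := h.k_mul_err_le
  have hKH : K ⊆ H := by
    refine Finset.monotone_filter_right _ fun i _ hi => lt_of_le_of_lt ?_ hi
    rw [hθ]
    gcongr
    rw [le_div_iff₀ (by positivity)]
    linarith [mul_nonneg hk0.le he]
  have hH1 : H.card ≤ k := h.card_large_le b hb H fun i hi => (Finset.mem_filter.mp hi).2
  have hK1 : k ≤ K.card := h.le_card_large b hb K fun i hi => by
    simpa [hK] using hi
  have hKHe : K = H := Finset.eq_of_subset_of_card_le hKH (hH1.trans hK1)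
  have hHk : H.card = k := le_antisymm hH1 (hKHe ▸ hK1)
  refine ⟨Submodule.span ℝ (b '' H), by rw [finrank_span_coords, hHk], ?_⟩
  intro g hg hG t ht hlog l
  set W := Submodule.span ℝ (b '' H) with hW
  obtain ⟨S, hS⟩ := h.exists_near_avg
  have hL : 0 < (α * size M / (2 * k)) ^ 2 * s := by positivity
  obtain ⟨x, hx, hxn⟩ := exists_mem_span_pow_near b hb H hHk (L := (α * size M / (2 * k)) ^ 2 * s)
    (θ := ‖A - P‖ ^ 2) hL (by positivity) (by positivity : (0 : ℝ) < 1 / (k : ℝ) ^ 2)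
    (fun i hi => by rw [← hKHe, hK, Finset.mem_filter] at hi; exact hi.2.le) (fun i _ => hv i)
    (fun i hi => by simpa [hH] using hi) g hg hG t (avg A (S l))
  refine ⟨x, hx, ?_⟩
  have hyn : ‖avg A (S l)‖ ≤ 2 * size M := by
    have h1 := (hS l).2
    have h2 := norm_col_le_size M l
    have h3 : ‖avg A (S l)‖ ≤ ‖avg A (S l) - col M l‖ + ‖col M l‖ := by
      simpa using norm_add_le (avg A (S l) - col M l) (col M l)
    have h4 : α * size M ≤ size M := by nlinarith [h.α_lt]
    nlinarith [mul_le_mul_of_nonneg_right hk he]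
  have hres : ‖avg A (S l) - W.starProjection (avg A (S l))‖ ≤ err A P δ := by
    set u := avg A (S l) - W.starProjection (avg A (S l)) with hu
    have hui : ∀ i, inner ℝ (b i) u = if i ∈ H then 0 else inner ℝ (b i) (avg A (S l)) :=
      fun i => by
        rw [hu, inner_sub_right, inner_starProjection_coords]
        split_ifs <;> simp
    have h1 : ‖u‖ ^ 2 = inner ℝ u (avg A (S l)) := by
      rw [← b.sum_inner_mul_inner, norm_sq_eq_sum_coords b]
      refine Finset.sum_congr rfl fun i _ => ?_
      rw [real_inner_comm (b i) u, hui]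
      split_ifs
      · simp
      · ring
    have h2 : ‖(WithLp.toLp 2 (A.transpose.mulVec u) : EuclideanSpace ℝ (Fin n))‖ ≤
        ‖A - P‖ * ‖u‖ := by
      refine le_of_sq_le_sq ?_ (by positivity)
      rw [← real_inner_self_eq_norm_sq, ← inner_gramMap, ← b.sum_inner_mul_inner,
        mul_pow, norm_sq_eq_sum_coords b, Finset.mul_sum]
      refine Finset.sum_le_sum fun i _ => ?_
      rw [hb, real_inner_comm, hui]
      split_ifs with hi
      · simp
      · have : v i ≤ ‖A - P‖ ^ 2 := by simpa [hH] using hi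
        nlinarith [mul_le_mul_of_nonneg_right this (sq_nonneg (inner ℝ (b i) (avg A (S l))))]
    have h3 : ‖u‖ ^ 2 ≤ ‖A - P‖ * ‖u‖ * (√(s : ℝ))⁻¹ := by
      rw [h1, avg_eq_mulVec, inner_toLp_mulVec]
      refine (real_inner_le_norm _ _).trans ?_
      rw [norm_indic, (hS l).1]
      gcongr
    rw [← h.norm_sub_div_sqrt, div_eq_mul_inv]
    rcases (norm_nonneg u).eq_or_lt with h0 | h0
    · rw [← h0]; positivity
    · refine le_of_mul_le_mul_right ?_ h0
      nlinarith
  have hd : (2 : ℝ) ≤ d := hk.trans (by exact_mod_cast h.k_le_d)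
  have hratio := h.ratio_pow_le ht hlog
  have h2 : (‖A - P‖ ^ 2 / ((α * size M / (2 * k)) ^ 2 * s)) ^ t *
      (k * (k * √(d : ℝ)) / (1 / (k : ℝ) ^ 2)) * ‖avg A (S l)‖ ≤ α * size M / (500 * k) := by
    have hsd : √(d : ℝ) ≤ d := by
      rw [Real.sqrt_le_left (by linarith)]; nlinarith
    calc _ ≤ α / (1000 * k ^ 5 * d) * (k * (k * d) / (1 / (k : ℝ) ^ 2)) * (2 * size M) := by
          gcongr
      _ = _ := by field_simp; ring
  have h3 := (hS l).2
  have h4 : ‖col M l - x‖ ≤ ‖avg A (S l) - col M l‖ + ‖avg A (S l) - x‖ := by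
    rw [norm_sub_rev (avg A (S l)) (col M l)]
    calc _ = ‖(col M l - avg A (S l)) + (avg A (S l) - x)‖ := by congr 1; abel
      _ ≤ _ := norm_add_le _ _
  have h5 : 6 * err A P δ ≤ α * size M / (1000 * k) := by
    rw [le_div_iff₀ (by positivity)]; nlinarith [mul_nonneg hk0.le he]
  have h6 : α * size M / (500 * k) + α * size M / (1000 * k) ≤ α * size M / (100 * k) := by
    have : 0 < α * size M / k := by positivity
    calc _ = α * size M / k * (1 / 500 + 1 / 1000) := by field_simp
      _ ≤ α * size M / k * (1 / 100) := by gcongr; norm_num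
      _ = _ := by field_simp
  linarith

end Model

end LatentSimplex

/-! ### One round of the algorithm -/

namespace LatentSimplex

lemma exists_starProjection_inf_orthogonal {E : Type*} [NormedAddCommGroup E]
    [InnerProductSpace ℝ E] [FiniteDimensional ℝ E] (V N : Submodule ℝ E) (x : E) :
    ∃ y ∈ N, (V ⊓ Nᗮ).starProjection x = V.starProjection (x - y) := by
  have h1 : (V ⊓ Nᗮ)ᗮ = Vᗮ ⊔ N := by
    rw [← Submodule.orthogonal_orthogonal (Vᗮ ⊔ N), ← Submodule.inf_orthogonal,
      Submodule.orthogonal_orthogonal]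
  have h2 := (V ⊓ Nᗮ).sub_starProjection_mem_orthogonal x
  rw [h1] at h2
  obtain ⟨v, hv, y, hy, hvy⟩ := Submodule.mem_sup.mp h2
  refine ⟨y, hy, ?_⟩
  have h3 : (V ⊓ Nᗮ).starProjection x ∈ V := ((V ⊓ Nᗮ).starProjection_apply_mem x).1
  have h4 : x - y = (V ⊓ Nᗮ).starProjection x + v := by
    have : x = v + y + (V ⊓ Nᗮ).starProjection x := by rw [hvy]; abel
    rw [sub_eq_iff_eq_add]
    nth_rw 1 [this]
    abel
  rw [h4, map_add, Submodule.starProjection_eq_self_iff.mpr h3,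
    (Submodule.starProjection_apply_eq_zero_iff _).mpr hv, add_zero]

lemma norm_sub_starProjection_le {E : Type*} [NormedAddCommGroup E]
    [InnerProductSpace ℝ E] [FiniteDimensional ℝ E] {V : Submodule ℝ E} {v : E} (hv : v ∈ V)
    (x : E) : ‖x - V.starProjection x‖ ≤ ‖x - v‖ := by
  have : x - V.starProjection x = Vᗮ.starProjection (x - v) := by
    have h1 : V.starProjection (x - v) = V.starProjection x - v := by
      rw [map_sub, Submodule.starProjection_eq_self_iff.mpr hv]
    rw [Submodule.starProjection_orthogonal_val, h1]
    abel
  rw [this]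
  exact Submodule.norm_starProjection_apply_le _ _

/-- The vectors against which the directions are tested: sums and differences of vertices. -/
noncomputable def testVec {d k : ℕ} (M : Matrix (Fin d) (Fin k) ℝ) (q : Fin k × Fin k × Fin 3) :
    EuclideanSpace ℝ (Fin d) :=
  col M q.1 + ((q.2.2 : ℕ) - 1 : ℝ) • col M q.2.1

namespace Model

variable {d n k s : ℕ} {A P : Matrix (Fin d) (Fin n) ℝ} {M : Matrix (Fin d) (Fin k) ℝ} {α δ : ℝ}

/-- The accuracy of the recovered vertices. -/
noncomputable def accuracy (k : ℕ) (A P : Matrix (Fin d) (Fin n) ℝ) (α δ : ℝ) : ℝ :=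
  150 * (k : ℝ) ^ 4 / α * err A P δ

lemma accuracy_mul_le (h : Model A P M α δ s) :
    30 * (k : ℝ) ^ 5 * accuracy k A P α δ ≤ α ^ 2 * size M := by
  have h1 := h.err_le_mul
  have hα := h.α_pos
  refine le_of_mul_le_mul_right ?_ hα
  calc _ = 4500 * (k : ℝ) ^ 9 * err A P δ := by rw [accuracy]; field_simp; ring
    _ ≤ _ := h1.trans_eq (by ring)

lemma accuracy_nonneg (h : Model A P M α δ s) : 0 ≤ accuracy k A P α δ := by
  have := h.err_nonneg
  have := h.α_pos
  unfold accuracy; positivity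

/-- Combinations of the vertices that are still to be found have a large component in the
space of the round. -/
lemma le_norm_starProjection_sum (h : Model A P M α δ s)
    {V : Submodule ℝ (EuclideanSpace ℝ (Fin d))}
    (hV : ∀ l, ∃ x ∈ V, ‖col M l - x‖ ≤ α * size M / (100 * k))
    (π : Equiv.Perm (Fin k)) {r : ℕ} {R : Fin k → Finset (Fin n)}
    (hR : ∀ i : Fin k, (i : ℕ) < r → ‖avg A (R i) - col M (π i)‖ ≤ accuracy k A P α δ)
    (c : Fin k → ℝ) (hc : ∀ i : Fin k, (i : ℕ) < r → c (π i) = 0) (l : Fin k) :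
    |c l| * (α * size M / 2) ≤
      ‖(V ⊓ (Submodule.span ℝ ((fun i => avg A (R i)) '' {i | (i : ℕ) < r}))ᗮ).starProjection
        (∑ i, c i • col M i)‖ := by
  classical
  set x := ∑ i, c i • col M i with hx
  obtain ⟨y, hy, hxy⟩ := exists_starProjection_inf_orthogonal V
    (Submodule.span ℝ ((fun i => avg A (R i)) '' {i | (i : ℕ) < r})) x
  rw [hxy]
  have hrange : (fun i => avg A (R i)) '' {i : Fin k | (i : ℕ) < r} =
      Set.range fun i : {i : Fin k // (i : ℕ) < r} => avg A (R i) := by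
    ext v; simp
  rw [hrange, Submodule.mem_span_range_iff_exists_fun] at hy
  obtain ⟨β', hβ'⟩ := hy
  set β : Fin k → ℝ := fun i => if hi : (i : ℕ) < r then β' ⟨i, hi⟩ else 0 with hβ
  have hβ0 : ∀ i : Fin k, ¬ (i : ℕ) < r → β i = 0 := fun i hi => by simp [hβ, hi]
  have hyβ : y = ∑ i, β i • avg A (R i) := by
    rw [← hβ', ← Finset.sum_subset (Finset.subset_univ (Finset.univ.filter fun i : Fin k => (i : ℕ) < r))
      (fun i _ hi => by rw [hβ0 i (by simpa using hi), zero_smul]),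
      ← Finset.sum_subtype_eq_sum_filter]
    refine Finset.sum_bij (fun i _ => ⟨i, i.2⟩) ?_ ?_ ?_ ?_
    · simp
    · intro a _ b _ hab; simpa [Subtype.ext_iff] using hab
    · intro b _; exact ⟨b, by simp⟩
    · intro a _; simp [hβ, a.2]
  set c' : Fin k → ℝ := fun l => c l - β (π.symm l) with hc'
  set z := ∑ l, c' l • col M l with hz
  have hcB : ∀ l, |c' l| ≤ ‖c'‖ := fun l => norm_le_pi_norm c' l
  have hβB : ∀ i, |β i| ≤ ‖c'‖ := fun i => by
    by_cases hi : (i : ℕ) < r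
    · have h1 := hcB (π i)
      simpa only [hc', hc i hi, Equiv.symm_apply_apply, zero_sub, abs_neg] using h1
    · rw [hβ0 i hi, abs_zero]; exact norm_nonneg _
  have hcl : |c l| ≤ ‖c'‖ := by
    by_cases hi : ((π.symm l : Fin k) : ℕ) < r
    · have h1 := hc _ hi
      rw [Equiv.apply_symm_apply] at h1
      rw [h1, abs_zero]; exact norm_nonneg _
    · have h1 := hcB l
      simpa only [hc', hβ0 _ hi, sub_zero] using h1
  have hk := h.k_cast
  have hk0 : (0 : ℝ) < k := by linarith
  have hm := h.size_pos
  have hα := h.α_pos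
  have hη := h.accuracy_nonneg
  have hzn : ‖c'‖ * (α * size M) ≤ ‖z‖ := by
    have hne : Nonempty (Fin k) := ⟨⟨0, h.k_pos⟩⟩
    obtain ⟨l', hl'⟩ := Finite.exists_max fun l => |c' l|
    have h1 : ‖c'‖ ≤ |c' l'| := (pi_norm_le_iff_of_nonneg (abs_nonneg _)).mpr hl'
    exact (mul_le_mul_of_nonneg_right h1 (by positivity)).trans (h.le_norm_sum c' l')
  have hzx : x - y = z - ∑ i, β i • (avg A (R i) - col M (π i)) := by
    have h1 : ∑ l, β (π.symm l) • col M l = ∑ i, β i • col M (π i) := by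
      rw [← Equiv.sum_comp π]; simp
    rw [hz, hc', hyβ]
    simp only [sub_smul, smul_sub, Finset.sum_sub_distrib, h1, ← hx]
    abel
  have h1 : ‖∑ i, β i • (avg A (R i) - col M (π i))‖ ≤ k * (‖c'‖ * accuracy k A P α δ) := by
    calc _ ≤ ∑ i : Fin k, ‖c'‖ * accuracy k A P α δ := norm_sum_le_of_le _ fun i _ => by
          rw [norm_smul, Real.norm_eq_abs]
          by_cases hi : (i : ℕ) < r
          · exact mul_le_mul (hβB i) (hR i hi) (norm_nonneg _) (norm_nonneg _)
          · rw [hβ0 i hi, abs_zero, zero_mul]; positivity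
      _ = _ := by simp
  have h2 : ‖z - V.starProjection z‖ ≤ k * (‖c'‖ * (α * size M / (100 * k))) := by
    have : z - V.starProjection z = ∑ l, c' l • (col M l - V.starProjection (col M l)) := by
      simp only [hz, map_sum, map_smul, smul_sub, Finset.sum_sub_distrib]
    rw [this]
    calc _ ≤ ∑ i : Fin k, ‖c'‖ * (α * size M / (100 * k)) := norm_sum_le_of_le _ fun i _ => by
          rw [norm_smul, Real.norm_eq_abs]
          obtain ⟨v, hv, hvn⟩ := hV i
          exact mul_le_mul (hcB i) ((norm_sub_starProjection_le hv _).trans hvn) (norm_nonneg _)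
            (norm_nonneg _)
      _ = _ := by simp
  have h3 : k * accuracy k A P α δ ≤ α * size M / 100 := by
    have h4 := h.accuracy_mul_le
    have h5 : (16 : ℝ) ≤ (k : ℝ) ^ 4 := by
      calc (16 : ℝ) = 2 ^ 4 := by norm_num
        _ ≤ _ := pow_le_pow_left₀ (by norm_num) hk 4
    have h6 : α ^ 2 * size M ≤ α * size M := by
      gcongr
      rw [pow_two]; nlinarith [h.α_lt]
    have h7 : 100 * (k * accuracy k A P α δ) ≤ 30 * (k : ℝ) ^ 5 * accuracy k A P α δ := by
      calc _ = 100 * k * accuracy k A P α δ := by ring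
        _ ≤ 30 * (k : ℝ) ^ 5 * accuracy k A P α δ := by
            gcongr ?_ * _
            calc 100 * (k : ℝ) ≤ 30 * (16 * k) := by linarith
              _ ≤ 30 * ((k : ℝ) ^ 4 * k) := by gcongr
              _ = _ := by ring
    linarith
  have h4 : ‖z‖ ≤ ‖V.starProjection (x - y)‖ + ‖V.starProjection (∑ i, β i • (avg A (R i) - col M (π i)))‖
      + ‖z - V.starProjection z‖ := by
    have : z = V.starProjection (x - y) +
        V.starProjection (∑ i, β i • (avg A (R i) - col M (π i))) + (z - V.starProjection z) := by
      rw [← map_add, hzx]; simp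
    nth_rw 1 [this]
    exact norm_add₃_le
  have h5 := V.norm_starProjection_apply_le (∑ i, β i • (avg A (R i) - col M (π i)))
  have hB := norm_nonneg c'
  have h6 : k * (‖c'‖ * accuracy k A P α δ) ≤ ‖c'‖ * (α * size M / 100) := by
    calc _ = ‖c'‖ * (k * accuracy k A P α δ) := by ring
      _ ≤ _ := by gcongr
  have h7 : k * (‖c'‖ * (α * size M / (100 * k))) = ‖c'‖ * (α * size M / 100) := by
    field_simp
  have h8 : |c l| * (α * size M / 2) ≤ ‖c'‖ * (α * size M / 2) := by gcongr
  have h9 : 0 ≤ ‖c'‖ * (α * size M) := by positivity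
  linarith

end Model

end LatentSimplex

/-! ### Recovery of the vertices from good directions -/

namespace LatentSimplex

/-- A direction is generic if it is not nearly orthogonal to a test vector. -/
def Generic {d k : ℕ} (M : Matrix (Fin d) (Fin k) ℝ) (U : Submodule ℝ (EuclideanSpace ℝ (Fin d)))
    (w : EuclideanSpace ℝ (Fin d)) : Prop :=
  ∀ q, 1 / ((k : ℝ) ^ 3 * √(k : ℝ)) * ‖U.starProjection (testVec M q)‖ ≤
    |inner ℝ w (testVec M q)|

lemma testVec_add {d k : ℕ} (M : Matrix (Fin d) (Fin k) ℝ) (l l' : Fin k) :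
    testVec M (l, l', 2) = col M l + col M l' := by
  simp only [testVec]; norm_num

lemma testVec_self {d k : ℕ} (M : Matrix (Fin d) (Fin k) ℝ) (l : Fin k) :
    testVec M (l, l, 1) = col M l := by
  simp [testVec]

lemma testVec_sub {d k : ℕ} (M : Matrix (Fin d) (Fin k) ℝ) (l l' : Fin k) :
    testVec M (l, l', 0) = col M l - col M l' := by
  simp [testVec, sub_eq_add_neg]

namespace Model

variable {d n k s : ℕ} {A P : Matrix (Fin d) (Fin n) ℝ} {M : Matrix (Fin d) (Fin k) ℝ} {α δ : ℝ}

/-- Lower bounds for a generic direction on the vertices still to be found. -/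
lemma Generic.bounds (h : Model A P M α δ s)
    {V : Submodule ℝ (EuclideanSpace ℝ (Fin d))}
    (hV : ∀ l, ∃ x ∈ V, ‖col M l - x‖ ≤ α * size M / (100 * k))
    (π : Equiv.Perm (Fin k)) {r : ℕ} {R : Fin k → Finset (Fin n)}
    (hR : ∀ i : Fin k, (i : ℕ) < r → ‖avg A (R i) - col M (π i)‖ ≤ accuracy k A P α δ)
    {w : EuclideanSpace ℝ (Fin d)}
    (hw : Generic M (V ⊓ (Submodule.span ℝ ((fun i => avg A (R i)) '' {i | (i : ℕ) < r}))ᗮ) w)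
    {l : Fin k} (hl : ¬ (π.symm l : ℕ) < r) :
    1 / ((k : ℝ) ^ 3 * √(k : ℝ)) * (α * size M / 2) ≤ |inner ℝ w (col M l)| ∧
    ∀ l', l ≠ l' → ¬ (π.symm l' : ℕ) < r →
      1 / ((k : ℝ) ^ 3 * √(k : ℝ)) * (α * size M / 2) ≤ |inner ℝ w (col M l + col M l')| ∧
      1 / ((k : ℝ) ^ 3 * √(k : ℝ)) * (α * size M / 2) ≤ |inner ℝ w (col M l - col M l')| := by
  have h0 : ∀ {l'}, ¬ (π.symm l' : ℕ) < r → ∀ i : Fin k, (i : ℕ) < r → π i ≠ l' := by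
    rintro l' hl' i hi rfl
    exact hl' (by simpa using hi)
  refine ⟨?_, fun l' hne hl' => ⟨?_, ?_⟩⟩
  · have h1 := h.le_norm_starProjection_sum hV π hR (Pi.single l 1)
      (fun i hi => by rw [Pi.single_apply, if_neg (h0 hl i hi)]) l
    have h2 : ∑ i, (Pi.single l (1 : ℝ) : Fin k → ℝ) i • col M i = testVec M (l, l, 1) := by
      simp [testVec_self]
    rw [h2, Pi.single_eq_same, abs_one, one_mul] at h1
    have h3 := hw (l, l, 1)
    rw [testVec_self] at h1 h3
    exact (mul_le_mul_of_nonneg_left h1 (by positivity)).trans h3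
  · have h1 := h.le_norm_starProjection_sum hV π hR (Pi.single l 1 + Pi.single l' 1)
      (fun i hi => by
        rw [Pi.add_apply, Pi.single_apply, if_neg (h0 hl i hi), Pi.single_apply,
          if_neg (h0 hl' i hi), add_zero]) l
    have h2 : ∑ i, (Pi.single l (1 : ℝ) + Pi.single l' 1 : Fin k → ℝ) i • col M i =
        testVec M (l, l', 2) := by
      simp [testVec_add, add_smul, Finset.sum_add_distrib]
    rw [h2, Pi.add_apply, Pi.single_eq_same, Pi.single_eq_of_ne hne, add_zero, abs_one,
      one_mul] at h1
    have h3 := hw (l, l', 2)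
    rw [testVec_add] at h1 h3
    exact (mul_le_mul_of_nonneg_left h1 (by positivity)).trans h3
  · have h1 := h.le_norm_starProjection_sum hV π hR (Pi.single l 1 - Pi.single l' 1)
      (fun i hi => by
        rw [Pi.sub_apply, Pi.single_apply, if_neg (h0 hl i hi), Pi.single_apply,
          if_neg (h0 hl' i hi), sub_zero]) l
    have h2 : ∑ i, (Pi.single l (1 : ℝ) - Pi.single l' 1 : Fin k → ℝ) i • col M i =
        testVec M (l, l', 0) := by
      simp [testVec_sub, sub_smul, Finset.sum_sub_distrib]
    rw [h2, Pi.sub_apply, Pi.single_eq_same, Pi.single_eq_of_ne hne, sub_zero, abs_one,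
      one_mul] at h1
    have h3 := hw (l, l', 0)
    rw [testVec_sub] at h1 h3
    exact (mul_le_mul_of_nonneg_left h1 (by positivity)).trans h3

lemma two_mul_sqrt_mul_accuracy_le (h : Model A P M α δ s) :
    2 * √(k : ℝ) * accuracy k A P α δ ≤
      1 / ((k : ℝ) ^ 3 * √(k : ℝ)) * (α * size M / 10) := by
  have h4 := h.accuracy_mul_le
  have hk := h.k_cast
  have hk0 : (0 : ℝ) < k := by linarith
  have hsk : 0 < √(k : ℝ) := Real.sqrt_pos.mpr hk0
  have hη := h.accuracy_nonneg
  have h6 : α ^ 2 * size M ≤ α * size M := by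
    have hm := h.size_pos
    have hα := h.α_pos
    gcongr
    rw [pow_two]; nlinarith [h.α_lt]
  rw [one_div, ← div_eq_inv_mul, le_div_iff₀ (by positivity)]
  calc _ = 2 * (k : ℝ) ^ 3 * accuracy k A P α δ * (√(k : ℝ) * √(k : ℝ)) := by ring
    _ = 2 * (k : ℝ) ^ 4 * accuracy k A P α δ := by rw [Real.mul_self_sqrt hk0.le]; ring
    _ ≤ 3 * (k : ℝ) ^ 5 * accuracy k A P α δ := by
        gcongr ?_ * _
        nlinarith [pow_pos hk0 4, pow_succ (k : ℝ) 4]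
    _ ≤ _ := by linarith

/-- The set found with a generic direction is near a new vertex. -/
theorem exists_new_vertex (h : Model A P M α δ s)
    {V : Submodule ℝ (EuclideanSpace ℝ (Fin d))}
    (hV : ∀ l, ∃ x ∈ V, ‖col M l - x‖ ≤ α * size M / (100 * k))
    (π : Equiv.Perm (Fin k)) {r : Fin k} {R : Fin k → Finset (Fin n)}
    (hR : ∀ i : Fin k, (i : ℕ) < r → ‖avg A (R i) - col M (π i)‖ ≤ accuracy k A P α δ)
    {w : EuclideanSpace ℝ (Fin d)}
    (hwU : w ∈ V ⊓ (Submodule.span ℝ ((fun i => avg A (R i)) '' {i | (i : ℕ) < r}))ᗮ)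
    (hw : Generic M (V ⊓ (Submodule.span ℝ ((fun i => avg A (R i)) '' {i | (i : ℕ) < r}))ᗮ) w)
    (hwn : ‖w‖ ≤ 2 * √(k : ℝ)) {T : Finset (Fin n)} (hT : T.card = s)
    (hmax : ∀ S : Finset (Fin n), S.card = s →
      |inner ℝ w (avg A S)| ≤ |inner ℝ w (avg A T)|) :
    ∃ l, ¬ (π.symm l : ℕ) < r ∧ ‖avg A T - col M l‖ ≤ accuracy k A P α δ := by
  have hk := h.k_cast
  have hk0 : (0 : ℝ) < k := by linarith
  have hsk : 0 < √(k : ℝ) := Real.sqrt_pos.mpr hk0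
  have hm := h.size_pos
  have hα := h.α_pos
  have hη := h.accuracy_nonneg
  have he := h.err_nonneg
  set ε := 1 / ((k : ℝ) ^ 3 * √(k : ℝ)) with hε
  have hε0 : 0 < ε := by positivity
  have hX : 0 < ε * (α * size M) := by positivity
  set f : Fin k → ℝ := fun l => inner ℝ w (col M l) with hf
  have hfound : ∀ l, (π.symm l : ℕ) < r → |f l| ≤ ε * (α * size M / 10) := fun l hl => by
    have h1 : inner ℝ w (avg A (R (π.symm l))) = 0 :=
      Submodule.inner_left_of_mem_orthogonal (Submodule.subset_span
        (Set.mem_image_of_mem (fun i => avg A (R i))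
          (show π.symm l ∈ {i : Fin k | (i : ℕ) < r} from hl))) hwU.2
    have h2 : f l = - inner ℝ w (avg A (R (π.symm l)) - col M l) := by
      rw [inner_sub_right, h1]; simp [hf]
    rw [h2, abs_neg]
    have h3 := hR _ hl
    rw [Equiv.apply_symm_apply] at h3
    calc _ ≤ ‖w‖ * ‖avg A (R (π.symm l)) - col M l‖ := abs_real_inner_le_norm _ _
      _ ≤ 2 * √(k : ℝ) * accuracy k A P α δ := by gcongr
      _ ≤ _ := h.two_mul_sqrt_mul_accuracy_le
  have hne : Nonempty (Fin k) := ⟨r⟩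
  obtain ⟨l₀, hl₀⟩ := Finite.exists_max fun l => |f l|
  have hrun : ¬ (π.symm (π r) : ℕ) < r := by simp
  have hl₀u : ¬ (π.symm l₀ : ℕ) < r := fun hlt => by
    have h1 := (Generic.bounds h hV π hR hw hrun).1
    have h2 := hfound l₀ hlt
    have h3 := hl₀ (π r)
    simp only [hf] at h3 h2
    linarith
  have hgap : ∀ l, l ≠ l₀ → |f l| ≤ |f l₀| - ε * (α * size M * (2 / 5)) := fun l hl => by
    by_cases hlr : (π.symm l : ℕ) < r
    · have h1 := (Generic.bounds h hV π hR hw hl₀u).1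
      have h2 := hfound l hlr
      simp only [hf] at h2 ⊢
      linarith
    · obtain ⟨h1, h2⟩ := (Generic.bounds h hV π hR hw hl₀u).2 l hl.symm hlr
      rw [inner_add_right] at h1
      rw [inner_sub_right] at h2
      have h3 := hl₀ l
      simp only [hf] at h3 ⊢
      set x := inner ℝ w (col M l₀)
      set y := inner ℝ w (col M l)
      rw [← hε] at h1 h2
      clear_value x y
      rcases abs_cases x with ⟨hx, _⟩ | ⟨hx, _⟩ <;> rcases abs_cases y with ⟨hy, _⟩ | ⟨hy, _⟩ <;>
        rcases abs_cases (x + y) with ⟨hxy, _⟩ | ⟨hxy, _⟩ <;>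
        rcases abs_cases (x - y) with ⟨hxy', _⟩ | ⟨hxy', _⟩ <;> linarith
  refine ⟨l₀, hl₀u, ?_⟩
  obtain ⟨S, hS⟩ := h.exists_near_avg
  have hT0 : T.Nonempty := by rw [← Finset.card_pos, hT]; exact h.s_pos
  obtain ⟨v, hv0, hv1, hv⟩ := exists_avg_eq h.latent hT0
  have hAP := h.norm_avg_sub_avg_le hT
  have hinner : ∀ x y : EuclideanSpace ℝ (Fin d), |inner ℝ w x| ≤ |inner ℝ w y| + ‖w‖ * ‖x - y‖ :=
    fun x y => by
      have h1 : inner ℝ w x = inner ℝ w y + inner ℝ w (x - y) := by rw [inner_sub_right]; ring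
      rw [h1]
      exact (abs_add_le _ _).trans (add_le_add_right (abs_real_inner_le_norm _ _) _)
  have hlow : |f l₀| ≤ |inner ℝ w (avg A T)| + ‖w‖ * (5 * err A P δ) := by
    refine (hinner (col M l₀) (avg A (S l₀))).trans (add_le_add (hmax _ (hS l₀).1) ?_)
    rw [norm_sub_rev]
    exact mul_le_mul_of_nonneg_left (hS l₀).2 (norm_nonneg _)
  have hup : |inner ℝ w (avg A T)| ≤ |f l₀| - (1 - v l₀) * (ε * (α * size M * (2 / 5))) +
      ‖w‖ * err A P δ := by
    refine (hinner _ (avg P T)).trans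
      (add_le_add ?_ (mul_le_mul_of_nonneg_left hAP (norm_nonneg _)))
    rw [hv, inner_sum]
    calc |∑ l, inner ℝ w (v l • col M l)| ≤ ∑ l, v l * |f l| := by
          refine (Finset.abs_sum_le_sum_abs _ _).trans_eq (Finset.sum_congr rfl fun l _ => ?_)
          rw [inner_smul_right, abs_mul, abs_of_nonneg (hv0 l)]
      _ ≤ ∑ l, (v l * (|f l₀| - ε * (α * size M * (2 / 5))) +
            if l = l₀ then v l₀ * (ε * (α * size M * (2 / 5))) else 0) := by
          refine Finset.sum_le_sum fun l _ => ?_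
          split_ifs with hl
          · rw [hl]; exact le_of_eq (by ring)
          · rw [add_zero]; exact mul_le_mul_of_nonneg_left (hgap l hl) (hv0 l)
      _ = _ := by
          rw [Finset.sum_add_distrib, ← Finset.sum_mul, hv1]
          simp
          ring
  have hv2 : 1 - v l₀ ≤ 30 * ((k : ℝ) ^ 4) * err A P δ / (α * size M) := by
    have h1 : (1 - v l₀) * (ε * (α * size M * (2 / 5))) ≤ 2 * √(k : ℝ) * (6 * err A P δ) := by
      have : ‖w‖ * (6 * err A P δ) ≤ 2 * √(k : ℝ) * (6 * err A P δ) := by gcongr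
      linarith
    rw [le_div_iff₀ (by positivity)]
    have h2 : (1 - v l₀) * (α * size M) =
        (1 - v l₀) * (ε * (α * size M * (2 / 5))) * (5 / 2 * ((k : ℝ) ^ 3 * √(k : ℝ))) := by
      rw [hε]; field_simp
    rw [h2]
    calc _ ≤ 2 * √(k : ℝ) * (6 * err A P δ) * (5 / 2 * ((k : ℝ) ^ 3 * √(k : ℝ))) := by gcongr
      _ = 30 * (k : ℝ) ^ 3 * err A P δ * (√(k : ℝ) * √(k : ℝ)) := by ring
      _ = _ := by rw [Real.mul_self_sqrt hk0.le]; ring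
  have hPM : ‖avg P T - col M l₀‖ ≤ (1 - v l₀) * (2 * size M) := by
    have h1 : avg P T - col M l₀ = ∑ l, v l • (col M l - col M l₀) := by
      simp only [smul_sub, Finset.sum_sub_distrib, ← Finset.sum_smul, hv1, one_smul, hv]
    rw [h1]
    calc _ ≤ ∑ l, (v l - if l = l₀ then v l₀ else 0) * (2 * size M) := by
          refine norm_sum_le_of_le _ fun l _ => ?_
          split_ifs with hl
          · rw [hl]; simp
          · rw [norm_smul, Real.norm_of_nonneg (hv0 l), sub_zero]
            refine mul_le_mul_of_nonneg_left ((norm_sub_le _ _).trans ?_) (hv0 l)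
            linarith [norm_col_le_size M l, norm_col_le_size M l₀]
      _ = _ := by rw [← Finset.sum_mul, Finset.sum_sub_distrib, hv1]; simp
  have hfin : (1 - v l₀) * (2 * size M) ≤ 60 * (k : ℝ) ^ 4 / α * err A P δ := by
    calc _ ≤ 30 * ((k : ℝ) ^ 4) * err A P δ / (α * size M) * (2 * size M) := by gcongr
      _ = _ := by field_simp; ring
  have hone : err A P δ ≤ (k : ℝ) ^ 4 / α * err A P δ := by
    refine le_mul_of_one_le_left he ?_
    rw [one_le_div hα]
    exact h.α_lt.le.trans (one_le_pow₀ (by linarith))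
  calc ‖avg A T - col M l₀‖ = ‖(avg A T - avg P T) + (avg P T - col M l₀)‖ := by congr 1; abel
    _ ≤ err A P δ + 60 * (k : ℝ) ^ 4 / α * err A P δ := norm_add_le_of_le hAP (hPM.trans hfin)
    _ ≤ (k : ℝ) ^ 4 / α * err A P δ + 60 * (k : ℝ) ^ 4 / α * err A P δ := by gcongr
    _ = 61 * ((k : ℝ) ^ 4 / α * err A P δ) := by ring
    _ ≤ 150 * ((k : ℝ) ^ 4 / α * err A P δ) := by gcongr; norm_num
    _ = _ := by rw [accuracy]; ring

/-- A run in which the power iteration and all directions are good recovers the vertices. -/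
theorem recovers_of_generic (h : Model A P M α δ s)
    {V : Submodule ℝ (EuclideanSpace ℝ (Fin d))}
    (hV : ∀ l, ∃ x ∈ V, ‖col M l - x‖ ≤ α * size M / (100 * k))
    {R : Fin k → Finset (Fin n)} {w : Fin k → EuclideanSpace ℝ (Fin d)}
    (hw : ∀ r : Fin k,
      w r ∈ V ⊓ (Submodule.span ℝ ((fun i => avg A (R i)) '' {i | (i : ℕ) < r}))ᗮ ∧
      Generic M (V ⊓ (Submodule.span ℝ ((fun i => avg A (R i)) '' {i | (i : ℕ) < r}))ᗮ) (w r) ∧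
      ‖w r‖ ≤ 2 * √(k : ℝ) ∧ (R r).card = s ∧ ∀ S : Finset (Fin n), S.card = s →
        |inner ℝ (w r) (avg A S)| ≤ |inner ℝ (w r) (avg A (R r))|) :
    Recovers A P M α δ R := by
  have key : ∀ r ≤ k, ∃ π : Equiv.Perm (Fin k), ∀ i : Fin k, (i : ℕ) < r →
      ‖avg A (R i) - col M (π i)‖ ≤ accuracy k A P α δ := by
    intro r
    induction r with
    | zero => exact fun _ => ⟨1, fun i hi => absurd hi (by omega)⟩
    | succ r ih =>
      intro hr
      obtain ⟨π, hπ⟩ := ih (by omega)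
      obtain ⟨h1, h2, h3, h4, h5⟩ := hw ⟨r, hr⟩
      obtain ⟨l, hl, hln⟩ := h.exists_new_vertex hV π (r := ⟨r, hr⟩) hπ h1 h2 h3 h4 h5
      refine ⟨(Equiv.swap ⟨r, hr⟩ (π.symm l)).trans π, fun i hi => ?_⟩
      rcases Nat.lt_succ_iff_lt_or_eq.mp hi with hi | hi
      · have hi1 : i ≠ ⟨r, hr⟩ := fun h0 => by rw [h0] at hi; simp at hi
        have hi2 : i ≠ π.symm l := fun h0 => hl (by rw [← h0]; exact hi)
        rw [Equiv.trans_apply, Equiv.swap_apply_of_ne_of_ne hi1 hi2]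
        exact hπ i hi
      · have : i = ⟨r, hr⟩ := Fin.ext hi
        rw [this, Equiv.trans_apply, Equiv.swap_apply_left, Equiv.apply_symm_apply]
        exact hln
  obtain ⟨π, hπ⟩ := key k le_rfl
  exact ⟨π, fun l => hπ l l.2⟩

end Model

end LatentSimplex

/-! ### The running time -/

namespace LatentSimplex

namespace Model

variable {d n k s : ℕ} {A P : Matrix (Fin d) (Fin n) ℝ} {M : Matrix (Fin d) (Fin k) ℝ} {α δ : ℝ}

lemma time_le (h : Model A P M α δ s) {t lg : ℕ} (ht : (t : ℝ) ≤ Real.log d + 1)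
    (hlg : 2 ^ lg ≤ 4 * n) :
    (((200 + 130 * n) + k * (400 + 700 * (n + d + nnz A) + t * (21 + 40 * (n + d + 2 * nnz A)) +
      5 * (k * (23 + 92 * d)) + 120 * (n * lg)) : ℕ) : ℝ) ≤
    10000 * Real.log (n * k * d) ^ 1 / (δ * α) ^ 1 * (k * (nnz A + k * d)) := by
  have hk := h.k_cast
  have hdk : (k : ℝ) ≤ d := by exact_mod_cast h.k_le_d
  have hn : (1 : ℝ) ≤ n := by exact_mod_cast h.n_pos
  have hδ := h.δ_pos
  have hδ1 := h.δ_le_one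
  have hα := h.α_pos
  set N : ℝ := (nnz A : ℝ) with hN
  have hN0 : 0 ≤ N := Nat.cast_nonneg _
  have hsN : δ * n ≤ 2 * N := by
    rw [← h.s_eq, hN]; exact_mod_cast h.s_le_nnz
  set W : ℝ := (N + k * d) / δ with hW
  have hkd : (d : ℝ) ≤ k * d := le_mul_of_one_le_left (by linarith) (by linarith)
  have hNW : N + k * d ≤ W := by
    rw [hW, le_div_iff₀ hδ]
    exact mul_le_of_le_one_right (by positivity) hδ1
  have hnW : (n : ℝ) ≤ 2 * W := by
    rw [hW, ← mul_div_assoc, le_div_iff₀ hδ]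
    nlinarith
  have hdW : (d : ℝ) ≤ W := by linarith
  have hNW' : N ≤ W := by nlinarith
  have hkdW : (k : ℝ) * d ≤ W := by linarith
  have hkW : (k : ℝ) ≤ W := by linarith
  have hW1 : 1 ≤ W := by linarith
  have h4 : (4 : ℝ) ≤ k * d := by nlinarith
  have hnkd : (n : ℝ) * 4 ≤ n * k * d := by nlinarith
  set Λ := Real.log (n * k * d) with hΛ
  have hdle : (d : ℝ) ≤ n * k * d := by nlinarith
  have hlogd : Real.log d ≤ Λ := Real.log_le_log (by linarith) hdle
  have hΛ4 : Real.log 4 ≤ Λ := Real.log_le_log (by norm_num) (by linarith)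
  have hlog4 : Real.log 4 = 2 * Real.log 2 := by
    rw [show (4 : ℝ) = 2 ^ 2 by norm_num, Real.log_pow]; norm_num
  have hl2 := Real.log_two_gt_d9
  have hΛ1 : 1 ≤ Λ := by linarith
  have htΛ : (t : ℝ) ≤ 2 * Λ := by linarith
  have hlgΛ : (lg : ℝ) ≤ 2 * Λ := by
    have h1 : (2 : ℝ) ^ lg ≤ 4 * n := by exact_mod_cast hlg
    have h2 := Real.log_le_log (by positivity) (h1.trans (by linarith : 4 * (n : ℝ) ≤ n * k * d))
    rw [Real.log_pow] at h2
    nlinarith [Nat.cast_nonneg (α := ℝ) lg]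
  have hWΛ : W ≤ W * Λ := le_mul_of_one_le_right (by linarith) hΛ1
  have e1 : (t : ℝ) * (21 + 40 * (n + d + 2 * N)) ≤ 2 * Λ * (221 * W) := by
    apply mul_le_mul htΛ (by linarith) (by positivity) (by linarith)
  have e2 : (n : ℝ) * lg ≤ 2 * W * (2 * Λ) :=
    mul_le_mul hnW hlgΛ (by positivity) (by linarith)
  have e3 : (k : ℝ) * (23 + 92 * d) ≤ 115 * W := by nlinarith
  have e4 : 400 + 700 * (n + d + N) + t * (21 + 40 * (n + d + 2 * N)) +
      5 * (k * (23 + 92 * d)) + 120 * (n * lg) ≤ 5000 * (W * Λ) := by nlinarith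
  have e5 : 200 + 130 * (n : ℝ) ≤ k * (230 * (W * Λ)) := by nlinarith
  have e6 : (k : ℝ) * (400 + 700 * (n + d + N) + t * (21 + 40 * (n + d + 2 * N)) +
      5 * (k * (23 + 92 * d)) + 120 * (n * lg)) ≤ k * (5000 * (W * Λ)) := by gcongr
  have hWα : W ≤ (N + k * d) / (δ * α) := by
    rw [hW]
    gcongr
    exact mul_le_of_le_one_right hδ.le h.α_lt.le
  calc _ ≤ (k : ℝ) * (230 * (W * Λ)) + k * (5000 * (W * Λ)) := by
        push_cast
        exact add_le_add e5 e6
    _ ≤ 10000 * (k * Λ) * W := by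
        have : 0 ≤ (k : ℝ) * (W * Λ) := by positivity
        linarith
    _ ≤ 10000 * (k * Λ) * ((N + k * d) / (δ * α)) := by gcongr
    _ = _ := by ring

end Model

end LatentSimplex

/-! ### Estimates for Gaussian vectors -/

namespace LatentSimplex

open MeasureTheory ProbabilityTheory

lemma gaussianReal_abs_lt_le {v : NNReal} (hv : v ≠ 0) (ε : ℝ) :
    gaussianReal 0 v {x | |x| < ε * √(v : ℝ)} ≤ ENNReal.ofReal ε := by
  have hv0 : (0 : ℝ) < v := by positivity
  have hs : 0 < √(v : ℝ) := Real.sqrt_pos.mpr hv0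
  have hset : {x : ℝ | |x| < ε * √(v : ℝ)} = Set.Ioo (-(ε * √(v : ℝ))) (ε * √(v : ℝ)) := by
    ext x; simp [abs_lt]
  have hpdf : ∀ x, gaussianPDF 0 v x ≤ ENNReal.ofReal (1 / (2 * √(v : ℝ))) := fun x => by
    rw [gaussianPDF, gaussianPDFReal]
    refine ENNReal.ofReal_le_ofReal ?_
    have h1 : Real.exp (-(x - 0) ^ 2 / (2 * v)) ≤ 1 := by
      rw [Real.exp_le_one_iff]
      exact div_nonpos_of_nonpos_of_nonneg (by nlinarith [sq_nonneg (x - 0)]) (by positivity)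
    have h2 : 2 * √(v : ℝ) ≤ √(2 * Real.pi * v) := by
      rw [Real.sqrt_mul (by positivity)]
      gcongr
      refine Real.le_sqrt_of_sq_le ?_
      linarith [Real.pi_gt_three]
    calc _ ≤ (√(2 * Real.pi * v))⁻¹ * 1 := by gcongr
      _ ≤ _ := by rw [mul_one, one_div]; exact inv_anti₀ (by positivity) h2
  rw [gaussianReal_apply _ hv, hset]
  calc _ ≤ ∫⁻ _ in Set.Ioo (-(ε * √(v : ℝ))) (ε * √(v : ℝ)),
        ENNReal.ofReal (1 / (2 * √(v : ℝ))) := lintegral_mono fun x => hpdf x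
    _ = ENNReal.ofReal ε := by
      rw [setLIntegral_const, Real.volume_Ioo, ← ENNReal.ofReal_mul (by positivity)]
      congr 1
      field_simp
      ring

lemma exists_orthonormalBasis_span {E : Type*} [NormedAddCommGroup E]
    [InnerProductSpace ℝ E] [FiniteDimensional ℝ E] (U : Submodule ℝ E) :
    ∃ (b : OrthonormalBasis (Fin (Module.finrank ℝ E)) ℝ E) (H : Finset (Fin (Module.finrank ℝ E))),
      H.card = Module.finrank ℝ U ∧ Submodule.span ℝ (b '' H) = U := by
  classical
  have hle : Module.finrank ℝ U ≤ Module.finrank ℝ E := U.finrank_le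
  let f := fun i : Fin (Module.finrank ℝ U) => ((stdOrthonormalBasis ℝ U i : U) : E)
  let v : Fin (Module.finrank ℝ E) → E := fun i =>
    if hi : (i : ℕ) < Module.finrank ℝ U then f ⟨i, hi⟩ else 0
  let s : Set (Fin (Module.finrank ℝ E)) := {i | (i : ℕ) < Module.finrank ℝ U}
  have hf : Orthonormal ℝ f :=
    (stdOrthonormalBasis ℝ U).orthonormal.comp_linearIsometry U.subtypeₗᵢ
  have hv : Orthonormal ℝ (s.domRestrict v) := by
    have : s.domRestrict v = f ∘ fun i : s => (⟨((i : Fin (Module.finrank ℝ E)) : ℕ), i.2⟩ : Fin (Module.finrank ℝ U)) := by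
      funext i
      have hi : ((i : Fin (Module.finrank ℝ E)) : ℕ) < Module.finrank ℝ U := i.2
      simp [v, hi]
    rw [this]
    exact hf.comp _ fun i j hij => by
      simpa [Subtype.ext_iff, Fin.ext_iff] using hij
  obtain ⟨b, hb⟩ := Orthonormal.exists_orthonormalBasis_extension_of_card_eq
    (by simp) hv
  let H : Finset (Fin (Module.finrank ℝ E)) := Finset.univ.map (Fin.castLEEmb hle)
  have hH : H.card = Module.finrank ℝ U := by simp [H]
  refine ⟨b, H, hH, Submodule.eq_of_le_of_finrank_eq ?_ (by rw [finrank_span_coords, hH])⟩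
  rw [Submodule.span_le]
  rintro _ ⟨i, hi, rfl⟩
  obtain ⟨j, -, rfl⟩ := Finset.mem_map.mp hi
  have hj : ((Fin.castLEEmb hle j : Fin _) : ℕ) < Module.finrank ℝ U := j.2
  rw [hb _ hj]
  simp only [v, hj, dif_pos]
  exact Subtype.coe_prop _

section

variable {E : Type*} [NormedAddCommGroup E] [InnerProductSpace ℝ E] [FiniteDimensional ℝ E]
  [MeasurableSpace E] [BorelSpace E]

/-- A Gaussian vector is rarely nearly orthogonal to a given vector. -/
lemma stdGaussian_abs_inner_lt_le (y : E) (ε : ℝ) :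
    stdGaussian E {x | |inner ℝ x y| < ε * ‖y‖} ≤ ENNReal.ofReal ε := by
  rcases eq_or_ne y 0 with rfl | hy
  · simp
  have hyn : 0 < ‖y‖ := norm_pos_iff.mpr hy
  have h1 := IsGaussian.map_eq_gaussianReal (μ := stdGaussian E) (innerSL ℝ y)
  rw [integral_strongDual_stdGaussian, variance_dual_stdGaussian, innerSL_apply_norm] at h1
  have hv : (‖y‖ ^ 2).toNNReal ≠ 0 := by simpa using hyn.ne'
  have h2 := gaussianReal_abs_lt_le hv ε
  rw [← h1, Measure.map_apply (by fun_prop) (measurableSet_lt (by fun_prop) (by fun_prop)),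
    Real.coe_toNNReal _ (by positivity), Real.sqrt_sq hyn.le] at h2
  refine le_trans (measure_mono fun x hx => ?_) h2
  simpa [real_inner_comm] using hx

lemma integral_exp_sq_gaussianReal :
    ∫ x, Real.exp (x ^ 2 / 4) ∂(gaussianReal 0 1) = √2 := by
  rw [integral_gaussianReal_eq_integral_smul one_ne_zero]
  have h1 : ∀ x : ℝ, gaussianPDFReal 0 1 x • Real.exp (x ^ 2 / 4) =
      (√(2 * Real.pi))⁻¹ * Real.exp (-(1 / 4) * x ^ 2) := fun x => by
    rw [gaussianPDFReal, smul_eq_mul, mul_assoc, ← Real.exp_add]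
    simp only [NNReal.coe_one, mul_one]
    congr 2
    ring
  simp_rw [h1]
  rw [integral_const_mul, integral_gaussian, ← Real.sqrt_inv, ← Real.sqrt_mul (by positivity)]
  congr 1
  have := Real.pi_pos
  field_simp
  norm_num

/-- The length of the projection of a Gaussian vector on a subspace of small dimension. -/
lemma stdGaussian_norm_starProjection_ge_le (U : Submodule ℝ E) {D : ℕ}
    (hD : Module.finrank ℝ U ≤ D) (a : ℝ) :
    stdGaussian E {x | a ≤ ‖U.starProjection x‖ ^ 2} ≤
      ENNReal.ofReal (√2 ^ D * Real.exp (-a / 4)) := by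
  classical
  obtain ⟨b, H, hH, rfl⟩ := exists_orthonormalBasis_span U
  have hmeas : MeasurableSet {x : E | a ≤ ‖(Submodule.span ℝ (b '' H)).starProjection x‖ ^ 2} :=
    measurableSet_le (by fun_prop) (by fun_prop)
  rw [stdGaussian_eq_map_pi_orthonormalBasis b, Measure.map_apply (by fun_prop) hmeas]
  let f : (i : Fin (Module.finrank ℝ E)) → ℝ → ℝ := fun i x =>
    if i ∈ H then Real.exp (x ^ 2 / 4) else 1
  have hint : ∫ x : Fin (Module.finrank ℝ E) → ℝ, ∏ i, f i (x i)
      ∂(Measure.pi fun _ => gaussianReal 0 1) = √2 ^ H.card := by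
    rw [integral_fintype_prod_eq_prod]
    have : ∀ i, ∫ x, f i x ∂(gaussianReal 0 1) = if i ∈ H then √2 else 1 := fun i => by
      simp only [f]
      split_ifs
      · exact integral_exp_sq_gaussianReal
      · simp
    simp_rw [this]
    rw [Finset.prod_ite_mem, Finset.univ_inter, Finset.prod_const]
  have hI : Integrable (fun x : Fin (Module.finrank ℝ E) → ℝ => ∏ i, f i (x i))
      (Measure.pi fun _ => gaussianReal 0 1) := by
    by_contra hcon
    rw [integral_undef hcon] at hint
    exact absurd hint (by positivity)
  have hf : ∀ x : Fin (Module.finrank ℝ E) → ℝ, ∏ i, f i (x i) =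
      Real.exp (‖(Submodule.span ℝ (b '' H)).starProjection (∑ i, x i • b i)‖ ^ 2 / 4) := fun x => by
    rw [norm_sq_eq_sum_coords b, Finset.sum_div, Real.exp_sum]
    refine Finset.prod_congr rfl fun i _ => ?_
    rw [inner_starProjection_coords, inner_sum_coords]
    simp only [f]
    split_ifs <;> simp_all
  have hM := mul_meas_ge_le_integral_of_nonneg
    (Filter.Eventually.of_forall fun x => by rw [hf]; positivity) hI (Real.exp (a / 4))
  rw [hint] at hM
  have hset : (fun x : Fin (Module.finrank ℝ E) → ℝ => ∑ i, x i • b i) ⁻¹'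
      {x : E | a ≤ ‖(Submodule.span ℝ (b '' H)).starProjection x‖ ^ 2} ⊆
      {x | Real.exp (a / 4) ≤ ∏ i, f i (x i)} := fun x hx => by
    have hx' : a ≤ ‖(Submodule.span ℝ (b '' H)).starProjection (∑ i, x i • b i)‖ ^ 2 := hx
    rw [Set.mem_ofPred_eq, hf]
    exact Real.exp_le_exp.mpr (by linarith)
  refine (measure_mono hset).trans ?_
  rw [← ofReal_measureReal]
  refine ENNReal.ofReal_le_ofReal ?_
  rw [neg_div, Real.exp_neg, ← div_eq_mul_inv, le_div_iff₀ (Real.exp_pos _), mul_comm]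
  refine hM.trans (pow_le_pow_right₀ ?_ (hH ▸ hD))
  rw [Real.one_le_sqrt]; norm_num

end

lemma sqrt_two_pow_mul_exp_le {D : ℕ} {x : ℝ} (hx : 0 < x) (hD : D ≤ x) :
    √2 ^ D * Real.exp (-x) ≤ 8 / x ^ 2 := by
  have h1 : √2 ≤ Real.exp (1 / 2) := by
    rw [Real.sqrt_le_left (by positivity), ← Real.exp_nat_mul]
    have := Real.add_one_le_exp (1 : ℝ)
    norm_num at this ⊢
    linarith
  have h2 : x ^ 2 / 8 ≤ Real.exp (x / 2) := by
    have := Real.quadratic_le_exp_of_nonneg (by positivity : 0 ≤ x / 2)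
    nlinarith
  calc _ ≤ Real.exp (1 / 2) ^ D * Real.exp (-x) := by gcongr
    _ = Real.exp (D * (1 / 2) + -x) := by rw [← Real.exp_nat_mul, Real.exp_add]
    _ ≤ Real.exp (-(x / 2)) := Real.exp_le_exp.mpr (by linarith)
    _ = (Real.exp (x / 2))⁻¹ := Real.exp_neg _
    _ ≤ (x ^ 2 / 8)⁻¹ := inv_anti₀ (by positivity) h2
    _ = _ := by rw [inv_div]

end LatentSimplex

/-! ### Resampling one Gaussian vector -/

namespace LatentSimplex

open MeasureTheory ProbabilityTheory

variable {d : ℕ}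

/-- The sequence `ω` with its `m`-th block replaced by `x`. -/
noncomputable def splice (m : ℕ) (ω : ℕ → ℝ) (x : EuclideanSpace ℝ (Fin d)) : ℕ → ℝ := fun q =>
  if hq : m * d ≤ q ∧ q - m * d < d then x ⟨q - m * d, hq.2⟩ else ω q

lemma gaussVec_splice_self (m : ℕ) (ω : ℕ → ℝ) (x : EuclideanSpace ℝ (Fin d)) :
    gaussVec (splice m ω x) d m = x := by
  ext i
  simp [gaussVec, splice]

lemma gaussVec_splice_of_ne {m m' : ℕ} (h : m' ≠ m) (ω : ℕ → ℝ) (x : EuclideanSpace ℝ (Fin d)) :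
    gaussVec (splice m ω x) d m' = gaussVec ω d m' := by
  ext i
  simp only [gaussVec, splice]
  rw [dif_neg]
  rintro ⟨h1, h2⟩
  have hi := i.2
  rcases Nat.lt_or_gt_of_ne h with h | h
  · have := Nat.mul_le_mul_right d (Nat.succ_le_of_lt h)
    rw [Nat.succ_mul] at this
    omega
  · have := Nat.mul_le_mul_right d (Nat.succ_le_of_lt h)
    rw [Nat.succ_mul] at this
    omega

lemma measurable_splice (m : ℕ) : Measurable fun z : (ℕ → ℝ) × EuclideanSpace ℝ (Fin d) =>
    splice m z.1 z.2 := by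
  refine measurable_pi_lambda _ fun q => ?_
  simp only [splice]
  split_ifs <;> fun_prop

lemma measurable_gaussVec (m : ℕ) : Measurable fun ω : ℕ → ℝ => gaussVec ω d m := by
  unfold gaussVec
  fun_prop

instance : IsProbabilityMeasure tapeLaw := by unfold tapeLaw; infer_instance

lemma map_splice (m : ℕ) :
    (tapeLaw.prod (stdGaussian (EuclideanSpace ℝ (Fin d)))).map (fun z => splice m z.1 z.2) =
      tapeLaw := by
  classical
  refine Measure.eq_infinitePi _ fun I t ht => ?_
  have htI : MeasurableSet (Set.pi (I : Set ℕ) t) := .pi I.countable_toSet fun i _ => ht i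
  rw [Measure.map_apply (measurable_splice m) htI]
  set B := I.filter fun q => m * d ≤ q ∧ q - m * d < d with hB
  set O := I.filter fun q => ¬ (m * d ≤ q ∧ q - m * d < d) with hO
  let u : Fin d → Set ℝ := fun i => if m * d + i ∈ I then t (m * d + i) else Set.univ
  have hu : ∀ i, MeasurableSet (u i) := fun i => by
    simp only [u]; split_ifs
    · exact ht _
    · exact .univ
  have hpre : (fun z : (ℕ → ℝ) × EuclideanSpace ℝ (Fin d) => splice m z.1 z.2) ⁻¹'
      (Set.pi (I : Set ℕ) t) = (Set.pi (O : Set ℕ) t) ×ˢ {x | ∀ i, x i ∈ u i} := by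
    ext ⟨ω, x⟩
    simp only [Set.mem_preimage, Set.mem_pi, Finset.mem_coe, Set.mem_prod, Set.mem_ofPred_eq]
    constructor
    · intro h
      refine ⟨fun q hq => ?_, fun i => ?_⟩
      · obtain ⟨hq1, hq2⟩ := Finset.mem_filter.mp hq
        have := h q hq1
        rwa [splice, dif_neg hq2] at this
      · simp only [u]
        split_ifs with hi
        · have := h _ hi
          rw [splice, dif_pos ⟨Nat.le_add_right _ _, by simp⟩] at this
          simpa using this
        · trivial
    · rintro ⟨h1, h2⟩ q hq
      rw [splice]
      split_ifs with hc
      · have := h2 ⟨q - m * d, hc.2⟩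
        simp only [u, Nat.add_sub_cancel' hc.1, hq, if_true] at this
        exact this
      · exact h1 q (Finset.mem_filter.mpr ⟨hq, hc⟩)
  have hset : {x : EuclideanSpace ℝ (Fin d) | ∀ i, x i ∈ u i} =
      (MeasurableEquiv.toLp 2 (Fin d → ℝ)).symm ⁻¹' (Set.pi Set.univ u) := by
    ext x; simp
  have hgauss : stdGaussian (EuclideanSpace ℝ (Fin d)) {x | ∀ i, x i ∈ u i} =
      ∏ q ∈ B, gaussianReal 0 1 (t q) := by
    rw [← map_pi_eq_stdGaussian, Measure.map_apply (by fun_prop) (by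
      rw [hset]; exact (MeasurableEquiv.measurable _) (.univ_pi hu))]
    have : (WithLp.toLp 2) ⁻¹' {x : EuclideanSpace ℝ (Fin d) | ∀ i, x i ∈ u i} =
        Set.pi Set.univ u := by ext x; simp
    rw [this, Measure.pi_pi]
    have h1 : ∀ i, gaussianReal 0 1 (u i) =
        if m * d + i ∈ I then gaussianReal 0 1 (t (m * d + i)) else 1 := fun i => by
      simp only [u]; split_ifs <;> simp
    simp_rw [h1]
    rw [← Finset.prod_filter]
    refine Finset.prod_bij (fun i _ => m * d + i) ?_ ?_ ?_ ?_
    · intro i hi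
      simp only [hB, Finset.mem_filter] at hi ⊢
      exact ⟨hi.2, by omega, by have := i.2; omega⟩
    · intro i _ j _ hij; exact Fin.ext (by omega)
    · intro q hq
      obtain ⟨h1, h2, h3⟩ := Finset.mem_filter.mp hq
      exact ⟨⟨q - m * d, h3⟩, by simp [Nat.add_sub_cancel' h2, h1], by simp; omega⟩
    · simp
  rw [hpre, Measure.prod_prod, hgauss, tapeLaw, Measure.infinitePi_pi _ fun i _ => ht i, mul_comm]
  exact Finset.prod_filter_mul_prod_filter_not _ _ _

/-- An event is unlikely if it is unlikely conditionally on all but one Gaussian vector. -/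
lemma tapeLaw_le_of_splice (m : ℕ) {S : Set (ℕ → ℝ)} (hS : MeasurableSet S) {ε : ENNReal}
    (h : ∀ ω, stdGaussian (EuclideanSpace ℝ (Fin d)) {x | splice m ω x ∈ S} ≤ ε) :
    tapeLaw S ≤ ε := by
  rw [← map_splice (d := d) m, Measure.map_apply (measurable_splice m) hS,
    Measure.prod_apply (measurable_splice m hS)]
  calc _ ≤ ∫⁻ _, ε ∂tapeLaw := lintegral_mono fun ω => h ω
    _ = ε := by simp

/-- Families of subspaces on which projections depend measurably on the parameter. -/
def MeasurableProj {Ω : Type*} [MeasurableSpace Ω] (U : Ω → Submodule ℝ (EuclideanSpace ℝ (Fin d))) :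
    Prop :=
  ∀ f : Ω → EuclideanSpace ℝ (Fin d), Measurable f → Measurable fun ω => (U ω).starProjection (f ω)

section

variable {Ω : Type*} [MeasurableSpace Ω] {U : Ω → Submodule ℝ (EuclideanSpace ℝ (Fin d))}

lemma measurable_lineProj {f g : Ω → EuclideanSpace ℝ (Fin d)} (hf : Measurable f)
    (hg : Measurable g) : Measurable fun ω => lineProj (f ω) (g ω) := by
  unfold lineProj
  exact ((Measurable.inner (𝕜 := ℝ) hf hg).div (Measurable.inner (𝕜 := ℝ) hf hf)).smul hf

lemma MeasurableProj.sup (hU : MeasurableProj U) {a : Ω → EuclideanSpace ℝ (Fin d)}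
    (ha : Measurable a) : MeasurableProj fun ω => U ω ⊔ Submodule.span ℝ {a ω} := fun f hf => by
  simp only [starProjection_sup_singleton]
  exact (hU f hf).add (measurable_lineProj (ha.sub (hU a ha)) hf)

lemma MeasurableProj.inf (hU : MeasurableProj U) {a : Ω → EuclideanSpace ℝ (Fin d)}
    (ha : Measurable a) : MeasurableProj fun ω => U ω ⊓ (Submodule.span ℝ {a ω})ᗮ := fun f hf => by
  simp only [starProjection_inf_orthogonal_singleton]
  exact (hU f hf).sub (measurable_lineProj (hU a ha) hf)

lemma measurableProj_span {ι : Type*} (I : Finset ι) {a : ι → Ω → EuclideanSpace ℝ (Fin d)}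
    (ha : ∀ i, Measurable (a i)) :
    MeasurableProj fun ω => Submodule.span ℝ ((fun i => a i ω) '' I) := by
  classical
  induction I using Finset.induction_on with
  | empty => intro f _; simp
  | insert i I _ ih =>
    have : ∀ ω, Submodule.span ℝ ((fun i => a i ω) '' (insert i I : Finset ι)) =
        Submodule.span ℝ ((fun i => a i ω) '' I) ⊔ Submodule.span ℝ {a i ω} := fun ω => by
      rw [Finset.coe_insert, Set.image_insert_eq, Submodule.span_insert, sup_comm]
    simp only [this]
    exact ih.sup (ha i)

end

lemma measurableProj_stepSpace {n k : ℕ} (A : Matrix (Fin d) (Fin n) ℝ) (t : ℕ)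
    (R : Fin k → Finset (Fin n)) {r : ℕ} (hr : r ≤ k) :
    MeasurableProj fun ω => stepSpace A t ω R r := by
  induction r with
  | zero =>
    simp only [stepSpace_zero, span_subspacePower]
    have := measurableProj_span (Finset.univ : Finset (Fin k))
      (a := fun m ω => (gramMap A ^ t) (gaussVec ω d m)) fun m =>
        ((gramMap A ^ t).toContinuousLinearMap.continuous.measurable).comp (measurable_gaussVec _)
    simpa using this
  | succ r ih =>
    have h := stepSpace_succ A t (R := R) (r := ⟨r, hr⟩)
    simp only at h
    simp only [h]
    exact (ih (by omega)).inf measurable_const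

end LatentSimplex

/-! ### Probability of failure -/

namespace LatentSimplex

open MeasureTheory ProbabilityTheory

section

variable {d n k : ℕ}

/-! #### The start of the power iteration -/

lemma exists_unit_orthogonal (W : Submodule ℝ (EuclideanSpace ℝ (Fin d)))
    (hW : Module.finrank ℝ W = k) (j : Fin k) (g : Fin k → EuclideanSpace ℝ (Fin d)) :
    ∃ b ∈ W, ‖b‖ = 1 ∧ ∀ i, i ≠ j → inner ℝ b (g i) = 0 := by
  let T : W →ₗ[ℝ] ({i : Fin k // i ≠ j} → ℝ) :=
    LinearMap.pi fun i => (innerₗ _ (g i)).comp W.subtype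
  have hker : LinearMap.ker T ≠ ⊥ := LinearMap.ker_ne_bot_of_finrank_lt (by
    have hj := j.2
    rw [hW, Module.finrank_fintype_fun_eq_card, Fintype.card_subtype_compl]
    simp
    omega)
  obtain ⟨⟨x, hxW⟩, hx, hx0⟩ := Submodule.exists_mem_ne_zero_of_ne_bot hker
  have hx0' : x ≠ 0 := fun h0 => hx0 (Subtype.ext h0)
  refine ⟨‖x‖⁻¹ • x, W.smul_mem _ hxW, norm_smul_inv_norm hx0', fun i hi => ?_⟩
  have : inner ℝ (g i) x = 0 := congrFun hx ⟨i, hi⟩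
  rw [inner_smul_left, real_inner_comm, this, mul_zero]

/-- The event that the `j`-th start vector is nearly dependent on the others. -/
def nearlyDependent (k : ℕ) (W : Submodule ℝ (EuclideanSpace ℝ (Fin d))) (ε : ℝ) (j : Fin k) :
    Set (ℕ → ℝ) :=
  {ω | ∃ c : Fin k → ℝ, ‖∑ i, c i • W.starProjection (gaussVec ω d i)‖ < |c j| * ε}

lemma continuous_gaussVec (m : ℕ) : Continuous fun ω : ℕ → ℝ => gaussVec ω d m := by
  unfold gaussVec
  fun_prop

lemma tapeLaw_nearlyDependent_le (W : Submodule ℝ (EuclideanSpace ℝ (Fin d)))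
    (hW : Module.finrank ℝ W = k) (ε : ℝ) (j : Fin k) :
    tapeLaw (nearlyDependent k W ε j) ≤ ENNReal.ofReal ε := by
  have hopen : IsOpen (nearlyDependent k W ε j) := by
    have : nearlyDependent k W ε j = ⋃ c : Fin k → ℝ,
        {ω | ‖∑ i, c i • W.starProjection (gaussVec ω d i)‖ < |c j| * ε} := by
      ext ω; simp [nearlyDependent]
    rw [this]
    refine isOpen_iUnion fun c => isOpen_lt ?_ continuous_const
    refine (continuous_finsetSum _ fun i _ => ?_).norm
    have h := W.starProjection.continuous.comp (continuous_gaussVec (d := d) i)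
    exact h.const_smul (c i)
  refine tapeLaw_le_of_splice (d := d) j hopen.measurableSet fun ω => ?_
  obtain ⟨b, hbW, hb1, hb⟩ := exists_unit_orthogonal W hW j fun i => gaussVec ω d i
  refine le_trans (measure_mono fun x hx => ?_) (stdGaussian_abs_inner_lt_le b ε)
  obtain ⟨c, hc⟩ := hx
  have hbp : ∀ y, inner ℝ b (W.starProjection y) = inner ℝ b y := fun y => by
    rw [← Submodule.inner_starProjection_left_eq_right, Submodule.starProjection_eq_self_iff.mpr hbW]
  have h1 : inner ℝ b (∑ i, c i • W.starProjection (gaussVec (splice j ω x) d i)) =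
      c j * inner ℝ b x := by
    rw [inner_sum, Finset.sum_eq_single j]
    · rw [inner_smul_right, hbp, gaussVec_splice_self]
    · intro i _ hi
      rw [inner_smul_right, hbp, gaussVec_splice_of_ne (by simpa [Fin.ext_iff] using hi), hb i hi,
        mul_zero]
    · simp
  have h2 := abs_real_inner_le_norm b
    (∑ i, c i • W.starProjection (gaussVec (splice j ω x) d i))
  rw [h1, hb1, one_mul, abs_mul] at h2
  have h3 := h2.trans_lt hc
  have h4 : |inner ℝ b x| < ε := lt_of_mul_lt_mul_left h3 (abs_nonneg _)
  rw [Set.mem_ofPred_eq, hb1, mul_one, real_inner_comm]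
  exact h4

lemma tapeLaw_norm_gaussVec_ge_le (hd : 0 < d) (hk : 2 ≤ k) (m : ℕ) :
    tapeLaw {ω | ((k : ℝ) * √(d : ℝ)) ≤ ‖gaussVec ω d m‖} ≤ ENNReal.ofReal (128 / (k : ℝ) ^ 2) := by
  have hk' : (2 : ℝ) ≤ k := by exact_mod_cast hk
  have hd' : (1 : ℝ) ≤ d := by exact_mod_cast hd
  refine tapeLaw_le_of_splice (d := d) m
    (measurableSet_le measurable_const (measurable_gaussVec m).norm) fun ω => ?_
  have h1 := stdGaussian_norm_starProjection_ge_le (⊤ : Submodule ℝ (EuclideanSpace ℝ (Fin d)))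
    (D := d) (by simp) ((k : ℝ) ^ 2 * d)
  refine le_trans (measure_mono fun x hx => ?_) (h1.trans (ENNReal.ofReal_le_ofReal ?_))
  · rw [Set.mem_ofPred_eq, Set.mem_ofPred_eq, gaussVec_splice_self] at hx
    rw [Set.mem_ofPred_eq, Submodule.starProjection_top, ContinuousLinearMap.id_apply]
    calc (k : ℝ) ^ 2 * d = (k * √(d : ℝ)) ^ 2 := by rw [mul_pow, Real.sq_sqrt (by linarith)]
      _ ≤ _ := pow_le_pow_left₀ (by positivity) hx 2
  · rw [neg_div]
    refine (sqrt_two_pow_mul_exp_le (by positivity) (by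
      have : (2 : ℝ) ^ 2 ≤ (k : ℝ) ^ 2 := pow_le_pow_left₀ (by norm_num) hk' 2
      nlinarith)).trans ?_
    rw [div_le_div_iff₀ (by positivity) (by positivity)]
    have h2 : (k : ℝ) ^ 2 ≤ ((k : ℝ) ^ 2 * d) ^ 2 := by
      have h3 : (k : ℝ) ^ 2 ≤ (k : ℝ) ^ 2 * d := le_mul_of_one_le_right (by positivity) hd'
      have h4 : (1 : ℝ) ≤ (k : ℝ) ^ 2 * d := by nlinarith
      nlinarith
    linarith

/-! #### The rounds -/

variable (A : Matrix (Fin d) (Fin n) ℝ) (s t : ℕ)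

/-- The sets `R i` with `i < r` are possible choices in the first `r` rounds. -/
def IsRunUpTo (ω : ℕ → ℝ) (r : ℕ) (R : Fin k → Finset (Fin n)) : Prop :=
  ∀ i : Fin k, (i : ℕ) < r → (R i).card = s ∧ ∀ S : Finset (Fin n), S.card = s →
    |inner ℝ (roundDir A t ω R i) (avg A S)| ≤ |inner ℝ (roundDir A t ω R i) (avg A (R i))|

/-- The event of an accidental tie in the rounds before round `r`. -/
def ties (k r : ℕ) : Set (ℕ → ℝ) :=
  {ω | ∃ (R : Fin k → Finset (Fin n)) (i : Fin k) (S S' : Finset (Fin n)) (b : Bool), (i : ℕ) < r ∧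
    (roundSpace A t ω R i).starProjection (avg A S + (if b then 1 else -1 : ℝ) • avg A S') ≠ 0 ∧
    inner ℝ ((roundSpace A t ω R i).starProjection (gaussVec ω d (k + i)))
      (avg A S + (if b then 1 else -1 : ℝ) • avg A S') = 0}

variable {A s t}

lemma measurable_starProjection_roundSpace (R : Fin k → Finset (Fin n)) (i : Fin k)
    {f : (ℕ → ℝ) → EuclideanSpace ℝ (Fin d)} (hf : Measurable f) :
    Measurable fun ω => (roundSpace A t ω R i).starProjection (f ω) := by
  simp only [roundSpace_eq]
  exact measurableProj_stepSpace A t R i.2.le f hf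

lemma measurable_roundDir (R : Fin k → Finset (Fin n)) (i : Fin k) :
    Measurable fun ω => roundDir A t ω R i := by
  unfold roundDir
  have := measurable_starProjection_roundSpace (A := A) (t := t) R i (measurable_gaussVec (k + i))
  exact this.norm.inv.smul this

lemma measurableSet_isRunUpTo (r : ℕ) (R : Fin k → Finset (Fin n)) :
    MeasurableSet {ω | IsRunUpTo A s t ω r R} := by
  have : {ω | IsRunUpTo A s t ω r R} = ⋂ i : Fin k, ⋂ _ : (i : ℕ) < r, {ω | (R i).card = s ∧
      ∀ S : Finset (Fin n), S.card = s → |inner ℝ (roundDir A t ω R i) (avg A S)| ≤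
        |inner ℝ (roundDir A t ω R i) (avg A (R i))|} := by
    ext ω; simp [IsRunUpTo]
  rw [this]
  refine MeasurableSet.iInter fun i => MeasurableSet.iInter fun _ => ?_
  refine (MeasurableSet.const _).inter ?_
  have : {ω | ∀ S : Finset (Fin n), S.card = s → |inner ℝ (roundDir A t ω R i) (avg A S)| ≤
        |inner ℝ (roundDir A t ω R i) (avg A (R i))|} = ⋂ S : Finset (Fin n), ⋂ _ : S.card = s,
      {ω | |inner ℝ (roundDir A t ω R i) (avg A S)| ≤
        |inner ℝ (roundDir A t ω R i) (avg A (R i))|} := by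
    ext ω; simp
  change MeasurableSet {ω | ∀ S : Finset (Fin n), S.card = s → _}
  rw [this]
  refine MeasurableSet.iInter fun S => MeasurableSet.iInter fun _ => ?_
  have h := measurable_roundDir (A := A) (t := t) R i
  exact measurableSet_le (Measurable.inner (𝕜 := ℝ) h measurable_const).abs
    (Measurable.inner (𝕜 := ℝ) h measurable_const).abs

lemma roundSpace_splice (R : Fin k → Finset (Fin n)) (i : Fin k) (j : Fin k) (ω : ℕ → ℝ)
    (x : EuclideanSpace ℝ (Fin d)) :
    roundSpace A t (splice (k + j) ω x) R i = roundSpace A t ω R i :=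
  stepSpace_congr A t (fun m => gaussVec_splice_of_ne (by have := m.2; omega) _ _) fun _ _ => rfl

lemma roundDir_splice (R : Fin k → Finset (Fin n)) {i j : Fin k} (hij : (i : ℕ) < j) (ω : ℕ → ℝ)
    (x : EuclideanSpace ℝ (Fin d)) :
    roundDir A t (splice (k + j) ω x) R i = roundDir A t ω R i := by
  unfold roundDir
  rw [gaussVec_splice_of_ne (by omega)]
  simp only [roundSpace_splice]

lemma inner_starProjection_comm (U : Submodule ℝ (EuclideanSpace ℝ (Fin d)))
    (x y : EuclideanSpace ℝ (Fin d)) :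
    inner ℝ (U.starProjection x) y = inner ℝ x (U.starProjection y) :=
  Submodule.inner_starProjection_left_eq_right U x y

lemma ties_eq (r : ℕ) : ties (n := n) A t k r =
    ⋃ (R : Fin k → Finset (Fin n)) (i : Fin k) (S : Finset (Fin n)) (S' : Finset (Fin n)) (b : Bool)
      (_ : (i : ℕ) < r), {ω | (roundSpace A t ω R i).starProjection
        (avg A S + (if b then 1 else -1 : ℝ) • avg A S') ≠ 0 ∧
      inner ℝ ((roundSpace A t ω R i).starProjection (gaussVec ω d (k + i)))
        (avg A S + (if b then 1 else -1 : ℝ) • avg A S') = 0} := by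
  ext ω
  simp only [ties, Set.mem_iUnion, Set.mem_ofPred_eq, exists_prop]

lemma measurableSet_tie (R : Fin k → Finset (Fin n)) (i : Fin k) (y : EuclideanSpace ℝ (Fin d)) :
    MeasurableSet {ω | (roundSpace A t ω R i).starProjection y ≠ 0 ∧
      inner ℝ ((roundSpace A t ω R i).starProjection (gaussVec ω d (k + i))) y = 0} := by
  have h1 := measurable_starProjection_roundSpace (A := A) (t := t) R i
    (measurable_const (a := y))
  have h2 := measurable_starProjection_roundSpace (A := A) (t := t) R i
    (measurable_gaussVec (k + i))
  exact (measurableSet_eq_fun h1 measurable_const).compl.inter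
    (measurableSet_eq_fun (Measurable.inner (𝕜 := ℝ) h2 measurable_const) measurable_const)

lemma measurableSet_ties (r : ℕ) : MeasurableSet (ties (n := n) A t k r) := by
  rw [ties_eq]
  refine .iUnion fun R => .iUnion fun i => .iUnion fun S => .iUnion fun S' => .iUnion fun b =>
    .iUnion fun _ => measurableSet_tie R i _

lemma tapeLaw_ties (r : ℕ) : tapeLaw (ties (n := n) A t k r) = 0 := by
  rw [ties_eq]
  simp only [measure_iUnion_null_iff]
  intro R i S S' b _
  set y := avg A S + (if b then 1 else -1 : ℝ) • avg A S'
  refine le_antisymm (tapeLaw_le_of_splice (d := d) (k + i) (measurableSet_tie R i y)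
    fun ω => ?_) zero_le
  simp only [Set.mem_ofPred_eq, roundSpace_splice, gaussVec_splice_self]
  set z := (roundSpace A t ω R i).starProjection y with hz
  refine ENNReal.le_of_forall_pos_le_add fun ε hε _ => ?_
  rw [zero_add]
  refine le_trans (measure_mono fun x hx => ?_)
    ((stdGaussian_abs_inner_lt_le z (ε : ℝ)).trans_eq (ENNReal.ofReal_coe_nnreal))
  obtain ⟨h1, h2⟩ := hx
  rw [inner_starProjection_comm] at h2
  rw [Set.mem_ofPred_eq, hz, h2, abs_zero]
  exact mul_pos (by exact_mod_cast hε) (norm_pos_iff.mpr h1)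

lemma inner_roundDir (ω : ℕ → ℝ) (R : Fin k → Finset (Fin n)) (i : Fin k)
    (y : EuclideanSpace ℝ (Fin d)) :
    inner ℝ (roundDir A t ω R i) y =
      ‖(roundSpace A t ω R i).starProjection (gaussVec ω d (k + i))‖⁻¹ *
        inner ℝ ((roundSpace A t ω R i).starProjection (gaussVec ω d (k + i))) y := by
  rw [roundDir, inner_smul_left]
  rfl

lemma abs_inner_le_of_roundDir {ω : ℕ → ℝ} {R : Fin k → Finset (Fin n)} {i : Fin k}
    {x y : EuclideanSpace ℝ (Fin d)}
    (h : |inner ℝ (roundDir A t ω R i) x| ≤ |inner ℝ (roundDir A t ω R i) y|) :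
    |inner ℝ ((roundSpace A t ω R i).starProjection (gaussVec ω d (k + i))) x| ≤
      |inner ℝ ((roundSpace A t ω R i).starProjection (gaussVec ω d (k + i))) y| := by
  rw [inner_roundDir, inner_roundDir, abs_mul, abs_mul] at h
  rcases eq_or_ne ((roundSpace A t ω R i).starProjection (gaussVec ω d (k + i))) 0 with h0 | h0
  · simp only [h0, inner_zero_left, abs_zero, le_refl]
  · exact le_of_mul_le_mul_left h (by positivity)

/-- Without accidental ties, all runs have the same spaces. -/
lemma stepSpace_eq_of_isRunUpTo {ω : ℕ → ℝ} {r : ℕ} (hr : r ≤ k) (hω : ω ∉ ties (n := n) A t k r)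
    {R R' : Fin k → Finset (Fin n)} (hR : IsRunUpTo A s t ω r R) (hR' : IsRunUpTo A s t ω r R') :
    stepSpace A t ω R r = stepSpace A t ω R' r := by
  induction r with
  | zero => simp [stepSpace_zero]
  | succ r ih =>
    have ih' := ih (by omega)
      (fun ⟨R, i, S, S', b, hi, h⟩ => hω ⟨R, i, S, S', b, by omega, h⟩)
      (fun i hi => hR i (by omega)) (fun i hi => hR' i (by omega))
    have e := stepSpace_succ A t ω R ⟨r, hr⟩
    have e' := stepSpace_succ A t ω R' ⟨r, hr⟩
    simp only at e e'
    rw [e, e', ← ih']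
    have hU : roundSpace A t ω R ⟨r, hr⟩ = roundSpace A t ω R' ⟨r, hr⟩ := ih'
    have hdir : roundDir A t ω R ⟨r, hr⟩ = roundDir A t ω R' ⟨r, hr⟩ := by
      unfold roundDir
      simp only [hU]
    obtain ⟨hc, hm⟩ := hR ⟨r, hr⟩ (Nat.lt_succ_self r)
    obtain ⟨hc', hm'⟩ := hR' ⟨r, hr⟩ (Nat.lt_succ_self r)
    have h1 := abs_inner_le_of_roundDir (hm _ hc')
    rw [hdir] at hm
    have h2 := hm' _ hc
    rw [← hdir] at h2
    have h3 := le_antisymm h1 (abs_inner_le_of_roundDir h2)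
    set a := avg A (R ⟨r, hr⟩)
    set a' := avg A (R' ⟨r, hr⟩)
    set U := stepSpace A t ω R r with hUdef
    have hpm : ∃ c : ℝ, c ≠ 0 ∧ U.starProjection (a' - c • a) = 0 := by
      rcases abs_eq_abs.mp h3 with h4 | h4
      · refine ⟨1, one_ne_zero, ?_⟩
        by_contra hne
        refine hω ⟨R, ⟨r, hr⟩, R' ⟨r, hr⟩, R ⟨r, hr⟩, false, Nat.lt_succ_self r, fun h0 => hne ?_, ?_⟩
        · change U.starProjection (a' + (if false then 1 else -1 : ℝ) • a) = 0 at h0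
          simpa [sub_eq_add_neg] using h0
        · simp only [Bool.false_eq_true, if_false, inner_add_right, inner_smul_right]
          rw [h4]; ring
      · refine ⟨-1, by norm_num, ?_⟩
        by_contra hne
        refine hω ⟨R, ⟨r, hr⟩, R' ⟨r, hr⟩, R ⟨r, hr⟩, true, Nat.lt_succ_self r, fun h0 => hne ?_, ?_⟩
        · change U.starProjection (a' + (if true then 1 else -1 : ℝ) • a) = 0 at h0
          simpa using h0
        · simp only [if_true, inner_add_right, inner_smul_right]
          rw [h4]; ring
    obtain ⟨c, hc0, hcz⟩ := hpm
    ext u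
    simp only [Submodule.mem_inf, Submodule.mem_orthogonal_singleton_iff_inner_left]
    refine and_congr_right fun hu => ?_
    have h5 : inner ℝ u (a' - c • a) = 0 := by
      rw [← Submodule.starProjection_eq_self_iff.mpr hu, inner_starProjection_comm, hcz,
        inner_zero_right]
    rw [inner_sub_right, inner_smul_right, sub_eq_zero] at h5
    rw [h5]
    simp [hc0]

end

end LatentSimplex

/-! ### The success probability -/

namespace LatentSimplex

open MeasureTheory ProbabilityTheory

section

variable {d n k : ℕ}

/-- The Gaussian vector `x` is unsuitable for choosing a direction in `U`. -/
def BadDir (M : Matrix (Fin d) (Fin k) ℝ) (U : Submodule ℝ (EuclideanSpace ℝ (Fin d)))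
    (x : EuclideanSpace ℝ (Fin d)) : Prop :=
  (∃ q, |inner ℝ x (U.starProjection (testVec M q))| <
    1 / ((k : ℝ) ^ 3 * √(k : ℝ)) * ‖U.starProjection (testVec M q)‖) ∨
  4 * (k : ℝ) ≤ ‖U.starProjection x‖ ^ 2

lemma generic_of_not_badDir {M : Matrix (Fin d) (Fin k) ℝ}
    {U : Submodule ℝ (EuclideanSpace ℝ (Fin d))} {x : EuclideanSpace ℝ (Fin d)}
    (h : ¬ BadDir M U x) :
    Generic M U (U.starProjection x) ∧ ‖U.starProjection x‖ ≤ 2 * √(k : ℝ) := by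
  simp only [BadDir, not_or, not_exists, not_lt, not_le] at h
  refine ⟨fun q => by rw [inner_starProjection_comm]; exact h.1 q, ?_⟩
  refine le_of_sq_le_sq ?_ (by positivity)
  rw [mul_pow, Real.sq_sqrt (Nat.cast_nonneg k)]
  linarith [h.2]

lemma stdGaussian_badDir_le (hk : 2 ≤ k) (M : Matrix (Fin d) (Fin k) ℝ)
    (U : Submodule ℝ (EuclideanSpace ℝ (Fin d))) (hU : Module.finrank ℝ U ≤ k) :
    stdGaussian (EuclideanSpace ℝ (Fin d)) {x | BadDir M U x} ≤
      ENNReal.ofReal (11 / (k * √(k : ℝ))) := by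
  have hk' : (2 : ℝ) ≤ k := by exact_mod_cast hk
  have hk0 : (0 : ℝ) < k := by linarith
  have hsk : 0 < √(k : ℝ) := Real.sqrt_pos.mpr hk0
  have hset : {x | BadDir M U x} =
      (⋃ q, {x | |inner ℝ x (U.starProjection (testVec M q))| <
        1 / ((k : ℝ) ^ 3 * √(k : ℝ)) * ‖U.starProjection (testVec M q)‖}) ∪
      {x | 4 * (k : ℝ) ≤ ‖U.starProjection x‖ ^ 2} := by
    ext x; simp [BadDir]
  have h2 := (stdGaussian_norm_starProjection_ge_le U hU (4 * (k : ℝ))).trans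
    (ENNReal.ofReal_le_ofReal (q := 8 / (k : ℝ) ^ 2) (by
      rw [show -(4 * (k : ℝ)) / 4 = -k by ring]
      exact sqrt_two_pow_mul_exp_le hk0 le_rfl))
  have h1 : stdGaussian (EuclideanSpace ℝ (Fin d))
      (⋃ q, {x | |inner ℝ x (U.starProjection (testVec M q))| <
        1 / ((k : ℝ) ^ 3 * √(k : ℝ)) * ‖U.starProjection (testVec M q)‖}) ≤
      ENNReal.ofReal (3 / (k * √(k : ℝ))) := by
    refine (measure_iUnion_fintype_le _ _).trans ?_
    refine (Finset.sum_le_sum fun q _ => stdGaussian_abs_inner_lt_le _ _).trans_eq ?_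
    rw [Finset.sum_const, nsmul_eq_mul, ← ENNReal.ofReal_natCast, ← ENNReal.ofReal_mul (by positivity)]
    congr 1
    simp only [Finset.card_univ, Fintype.card_prod, Fintype.card_fin]
    push_cast
    field_simp
  rw [hset]
  refine (measure_union_le _ _).trans ((add_le_add h1 h2).trans ?_)
  rw [← ENNReal.ofReal_add (by positivity) (by positivity)]
  refine ENNReal.ofReal_le_ofReal ?_
  have h3 : 8 / (k : ℝ) ^ 2 ≤ 8 / (k * √(k : ℝ)) := by
    rw [pow_two]
    have : √(k : ℝ) ≤ k := by rw [Real.sqrt_le_left hk0.le]; nlinarith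
    gcongr
  calc _ ≤ 3 / (k * √(k : ℝ)) + 8 / (k * √(k : ℝ)) := by gcongr
    _ = _ := by ring

variable (A : Matrix (Fin d) (Fin n) ℝ) (M : Matrix (Fin d) (Fin k) ℝ) (s t : ℕ)

/-- The event that the direction of round `r` is bad. -/
def badRound (r : Fin k) : Set (ℕ → ℝ) :=
  {ω | ω ∉ ties (n := n) A t k r ∧ ∃ R : Fin k → Finset (Fin n), IsRunUpTo A s t ω r R ∧
    BadDir M (roundSpace A t ω R r) (gaussVec ω d (k + r))}

variable {A M s t}

lemma measurableSet_badRound (r : Fin k) : MeasurableSet (badRound A M s t r) := by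
  have : badRound A M s t r = (ties (n := n) A t k r)ᶜ ∩ ⋃ R : Fin k → Finset (Fin n),
      ({ω | IsRunUpTo A s t ω r R} ∩
        ((⋃ q, {ω | |inner ℝ (gaussVec ω d (k + r))
            ((roundSpace A t ω R r).starProjection (testVec M q))| <
          1 / ((k : ℝ) ^ 3 * √(k : ℝ)) * ‖(roundSpace A t ω R r).starProjection (testVec M q)‖}) ∪
        {ω | 4 * (k : ℝ) ≤
          ‖(roundSpace A t ω R r).starProjection (gaussVec ω d (k + r))‖ ^ 2})) := by
    ext ω; simp [badRound, BadDir]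
  rw [this]
  refine (measurableSet_ties _).compl.inter (.iUnion fun R => (measurableSet_isRunUpTo _ R).inter
    (.union (.iUnion fun q => ?_) ?_))
  · have h1 := measurable_starProjection_roundSpace (A := A) (t := t) R r
      (measurable_const (a := testVec M q))
    exact measurableSet_lt (Measurable.inner (𝕜 := ℝ) (measurable_gaussVec _) h1).abs
      (h1.norm.const_mul _)
  · have h2 := measurable_starProjection_roundSpace (A := A) (t := t) R r
      (measurable_gaussVec (k + r))
    exact measurableSet_le measurable_const (h2.norm.pow_const 2)

lemma isRunUpTo_splice {ω : ℕ → ℝ} {x : EuclideanSpace ℝ (Fin d)} {r : Fin k}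
    {R : Fin k → Finset (Fin n)} (h : IsRunUpTo A s t (splice (k + r) ω x) r R) :
    IsRunUpTo A s t ω r R := fun i hi => by
  have := h i hi
  rwa [roundDir_splice R hi] at this

lemma ties_splice {ω : ℕ → ℝ} {x : EuclideanSpace ℝ (Fin d)} {r : Fin k}
    (h : splice (k + r) ω x ∉ ties (n := n) A t k r) : ω ∉ ties (n := n) A t k r := by
  rintro ⟨R, i, S, S', b, hi, h1⟩
  refine h ⟨R, i, S, S', b, hi, ?_⟩
  rw [gaussVec_splice_of_ne (by omega)]
  simp only [roundSpace_splice]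
  exact h1

lemma finrank_roundSpace_le (ω : ℕ → ℝ) (R : Fin k → Finset (Fin n)) (r : Fin k) :
    Module.finrank ℝ (roundSpace A t ω R r) ≤ k := by
  have h := finrank_range_le_card (R := ℝ) (subspacePower A k ω t)
  rw [Fintype.card_fin] at h
  exact (Submodule.finrank_mono inf_le_left).trans h

lemma tapeLaw_badRound_le (hk : 2 ≤ k) (r : Fin k) :
    tapeLaw (badRound A M s t r) ≤ ENNReal.ofReal (11 / (k * √(k : ℝ))) := by
  refine tapeLaw_le_of_splice (d := d) (k + r) (measurableSet_badRound r) fun ω => ?_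
  by_cases hne : ∃ R : Fin k → Finset (Fin n),
      IsRunUpTo A s t ω r R ∧ ω ∉ ties (n := n) A t k r
  · obtain ⟨R₀, hR₀, hω⟩ := hne
    refine le_trans (measure_mono fun x hx => ?_)
      (stdGaussian_badDir_le hk M _ (finrank_roundSpace_le (A := A) (t := t) ω R₀ r))
    obtain ⟨-, R, hR, hbad⟩ := hx
    rw [gaussVec_splice_self, roundSpace_splice] at hbad
    have := stepSpace_eq_of_isRunUpTo r.2.le hω (isRunUpTo_splice hR) hR₀
    rw [roundSpace_eq, this] at hbad
    exact hbad
  · have : {x : EuclideanSpace ℝ (Fin d) | splice (k + r) ω x ∈ badRound A M s t r} = ∅ := by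
      ext x
      simp only [Set.mem_ofPred_eq, Set.mem_empty_iff_false, iff_false]
      rintro ⟨h1, R, hR, -⟩
      exact hne ⟨R, isRunUpTo_splice hR, ties_splice h1⟩
    rw [this, measure_empty]
    exact zero_le

end

namespace Model

variable {d n k s : ℕ} {A P : Matrix (Fin d) (Fin n) ℝ} {M : Matrix (Fin d) (Fin k) ℝ} {α δ : ℝ}

/-- The algorithm recovers the vertices with high probability. -/
theorem tapeLaw_not_recovers_le (h : Model A P M α δ s) {t : ℕ} (ht : 1 ≤ t)
    (hlog : Real.log d ≤ t) :
    tapeLaw {ω | ∃ R : Fin k → Finset (Fin n), IsLKSRun A s t ω R ∧ ¬ Recovers A P M α δ R} ≤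
      ENNReal.ofReal (140 / √(k : ℝ)) := by
  obtain ⟨W, hW, hstart⟩ := h.exists_start_subspace
  have hk := h.k_cast
  have hk0 : (0 : ℝ) < k := by linarith
  have hsk : 0 < √(k : ℝ) := Real.sqrt_pos.mpr hk0
  have hd : 0 < d := h.k_pos.trans_le h.k_le_d
  have hsub : {ω | ∃ R : Fin k → Finset (Fin n), IsLKSRun A s t ω R ∧ ¬ Recovers A P M α δ R} ⊆
      (((⋃ j, nearlyDependent k W (1 / (k : ℝ) ^ 2) j) ∪
        ⋃ j : Fin k, {ω | (k : ℝ) * √(d : ℝ) ≤ ‖gaussVec ω d j‖}) ∪ ties (n := n) A t k k) ∪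
        ⋃ r, badRound A M s t r := by
    rintro ω ⟨R, hR, hnot⟩
    by_contra hgood
    simp only [Set.mem_union, Set.mem_iUnion, not_or, not_exists, nearlyDependent,
      Set.mem_ofPred_eq, not_lt, not_le] at hgood
    obtain ⟨⟨⟨h1, h2⟩, h3⟩, h4⟩ := hgood
    refine hnot (h.recovers_of_generic
      (V := Submodule.span ℝ (Set.range (subspacePower A k ω t)))
      (w := fun r => (roundSpace A t ω R r).starProjection (gaussVec ω d (k + r))) ?_ fun r => ?_)
    · rw [span_subspacePower]
      exact hstart (fun i => gaussVec ω d i) (fun c j => h1 j c) (fun j => (h2 j).le) t ht hlog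
    · have hties : ω ∉ ties (n := n) A t k r := fun ⟨R, i, S, S', b, _, h5⟩ =>
        h3 ⟨R, i, S, S', b, i.2, h5⟩
      have hbad : ¬ BadDir M (roundSpace A t ω R r) (gaussVec ω d (k + r)) := fun hb =>
        h4 r ⟨hties, R, fun i _ => hR i, hb⟩
      obtain ⟨hg, hn⟩ := generic_of_not_badDir hbad
      exact ⟨Submodule.starProjection_apply_mem _ _, hg, hn, (hR r).1,
        fun S hS => abs_inner_le_of_roundDir ((hR r).2 S hS)⟩
  have hA : tapeLaw (⋃ j, nearlyDependent k W (1 / (k : ℝ) ^ 2) j) ≤ ENNReal.ofReal (1 / k) := by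
    refine (measure_iUnion_fintype_le _ _).trans
      ((Finset.sum_le_sum fun j _ => tapeLaw_nearlyDependent_le W hW _ j).trans_eq ?_)
    rw [Finset.sum_const, Finset.card_univ, Fintype.card_fin, nsmul_eq_mul,
      ← ENNReal.ofReal_natCast, ← ENNReal.ofReal_mul hk0.le]
    congr 1; field_simp
  have hB : tapeLaw (⋃ j : Fin k, {ω | (k : ℝ) * √(d : ℝ) ≤ ‖gaussVec ω d j‖}) ≤
      ENNReal.ofReal (128 / k) := by
    refine (measure_iUnion_fintype_le _ _).trans
      ((Finset.sum_le_sum fun j _ => tapeLaw_norm_gaussVec_ge_le hd h.two_le _).trans_eq ?_)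
    rw [Finset.sum_const, Finset.card_univ, Fintype.card_fin, nsmul_eq_mul,
      ← ENNReal.ofReal_natCast, ← ENNReal.ofReal_mul hk0.le]
    congr 1; field_simp
  have hC : tapeLaw (⋃ r, badRound A M s t r) ≤ ENNReal.ofReal (11 / √(k : ℝ)) := by
    refine (measure_iUnion_fintype_le _ _).trans
      ((Finset.sum_le_sum fun r _ => tapeLaw_badRound_le h.two_le r).trans_eq ?_)
    rw [Finset.sum_const, Finset.card_univ, Fintype.card_fin, nsmul_eq_mul,
      ← ENNReal.ofReal_natCast, ← ENNReal.ofReal_mul hk0.le]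
    congr 1; field_simp
  refine (measure_mono hsub).trans ((measure_union_le _ _).trans (le_trans (add_le_add
    ((measure_union_le _ _).trans (add_le_add ((measure_union_le _ _).trans (add_le_add hA hB))
      (tapeLaw_ties k).le)) hC) ?_))
  rw [add_zero, ← ENNReal.ofReal_add (by positivity) (by positivity),
    ← ENNReal.ofReal_add (by positivity) (by positivity)]
  refine ENNReal.ofReal_le_ofReal ?_
  have h5 : √(k : ℝ) ≤ k := by rw [Real.sqrt_le_left hk0.le]; nlinarith
  calc 1 / (k : ℝ) + 128 / k + 11 / √(k : ℝ)
      ≤ 1 / √(k : ℝ) + 128 / √(k : ℝ) + 11 / √(k : ℝ) := by gcongr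
    _ = _ := by ring

end Model

end LatentSimplex

theorem theorem5 :
    ∃ (a c C : ℝ) (p : ℕ) (prog : RealRAM.Cmd), 0 < a ∧ 0 < c ∧ 0 < C ∧
      ∀ (d n k s : ℕ) (A P : Matrix (Fin d) (Fin n) ℝ) (M : Matrix (Fin d) (Fin k) ℝ) (α δ : ℝ),
        2 ≤ k → 0 < n → 0 < δ → (s : ℝ) = δ * n → 0 < α → α < 1 →
        LinearIndependent ℝ (LatentSimplex.col M) →
        LatentSimplex.LatentPoints M P →
        LatentSimplex.WellSeparated M α →
        LatentSimplex.ProximateLatentPoints A P M δ s →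
        LatentSimplex.SpectrallyBounded A P M α δ →
        -- the algorithm fails with probability at most `c / √k`
        LatentSimplex.tapeLaw
            {ω | ∃ R : Fin k → Finset (Fin n),
              LatentSimplex.IsLKSRun A s ⌈a * Real.log d⌉₊ ω R ∧
                ¬ LatentSimplex.Recovers A P M α δ R}
          ≤ ENNReal.ofReal (c / √(k : ℝ)) ∧
        -- the program carries out the algorithm within the time bound
        ∀ (e : Fin (LatentSimplex.nnz A) ≃ {q : Fin d × Fin n // A q.1 q.2 ≠ 0}) (ω : ℕ → ℝ),
          ∃ R : Fin k → Finset (Fin n),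
            RealRAM.Outputs
              (prog.exec ω (RealRAM.input A k s ⌈a * Real.log d⌉₊ e)) s R ∧
            LatentSimplex.IsLKSRun A s ⌈a * Real.log d⌉₊ ω R ∧
            ((prog.exec ω (RealRAM.input A k s ⌈a * Real.log d⌉₊ e)).time : ℝ) ≤
              C * Real.log (n * k * d) ^ p / (δ * α) ^ p *
                (k * (LatentSimplex.nnz A + k * d)) := by
  refine ⟨1, 140, 10000, 1, RealRAM.lksCmd, one_pos, by norm_num, by norm_num, ?_⟩
  intro d n k s A P M α δ hk hn hδ hs hα hα1 hM hP hsep hprox hbdd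
  have h : LatentSimplex.Model A P M α δ s :=
    ⟨hk, hn, hδ, hs, hα, hα1, hM, hP, hsep, hprox, hbdd⟩
  have hd : (2 : ℝ) ≤ d := h.k_cast.trans (by exact_mod_cast h.k_le_d)
  have hlog : 0 < Real.log d := Real.log_pos (by linarith)
  rw [one_mul]
  refine ⟨h.tapeLaw_not_recovers_le (Nat.one_le_ceil_iff.mpr hlog) (Nat.le_ceil _), fun e ω => ?_⟩
  obtain ⟨R, h1, h2, lg, h3, h4⟩ := RealRAM.lksCmd_spec (A := A) (k := k) (s := s)
    (t := ⌈Real.log d⌉₊) (e := e) ω hn h.s_pos.ne' h.s_le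
  exact ⟨R, h1, h2, (Nat.cast_le.mpr h4).trans
    (h.time_le (Nat.ceil_lt_add_one hlog.le).le h3)⟩
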